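/- Let $V$ be a finite-dimensional real vector space of dimension $s$, let $\Lambda\subset V$ be a lattice spanning $V$, and normalize the Lebesgue measure $dx$ on $V$ so that a fundamental domain of $\Lambda$ has volume $1$. Let $X=(a_1,\dots,a_N)$ be a list of vectors of $\Lambda$ (repetitions allowed) that spans $V$ and such that $0$ is not in the convex hull of the $a_i$. Let $\mathcal P_X(v)=\#\{(n_1,\dots,n_N)\in\mathbb N^N \mid \sum_i n_ia_i=v\}$ for $v\in\Lambda$. For a sublist $A$ of $X$ let $C(A)$ be the cone of non-negative linear combinations of $A$; the regular points are the points of $C(X)$ that lie in no $C(A)$ with $A\subset X$ not spanning $V$. Let $P(X)$ be the set of characters $\chi:\Lambda\to\mathbb C^*$ for which there is a basis of $V$ extracted from $X$ on which $\chi$ is identically $1$. This set is finite, and every $\chi\in P(X)$ is of the form $\chi=e^{\phi}$, i.e. $\chi(v)=e^{\langle\phi|v\rangle}$ for $v\in\Lambda$, with $\phi\in\operatorname{Hom}_{\mathbb R}(V,\mathbb C)$. Choose one representative $\phi$ for each point of $P(X)$ (we then write $\phi\in P(X)$), and set $X_\phi=\{a\in X\mid e^{\langle\phi|a\rangle}=1\}$.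 Let $T_{X_\phi,\underline\phi}$ be the multivariate E-spline of the list $X_\phi$ with parameters $\phi_a=-\langle\phi|a\rangle$, i.e. the locally integrable function on $V$ with $$\int_V f(x)\,T_{X_\phi,\underline\phi}(x)\,dx=\int_{\mathbb R_{\ge 0}^{X_\phi}} e^{\sum_{a}t_a\langle\phi|a\rangle}\,f\Big(\sum_{a\in X_\phi}t_a a\Big)\,dt$$ for all continuous $f$ with compact support, with value at $x$ given by $\lim_{r\to0^+}\frac1{\operatorname{vol}B(x,r)}\int_{B(x,r)}T_{X_\phi,\underline\phi}$. Such a function exists, and near every regular point it is $e^{\phi}$ times a polynomial. Let $$\widehat Q_\phi=\prod_{a\in X\setminus X_\phi}\frac1{1-e^{-\langle\phi|a\rangle}e^{-\tilde a}}\ \prod_{a\in X_\phi}\frac{\tilde a}{1-e^{-\tilde a}},\qquad \tilde a:=D_a-\langle\phi|a\rangle,$$ where $D_a$ is the directional derivative and the product is expanded as a power series in the operators $\tilde a$, $a\in X$. On functions that near every regular point are $e^{\phi}$ times a polynomial, only finitely many terms of this series are nonzero near each regular point, and $\widehat Q_\phi$ is, on the set of regular points, an invertible operator on such functions, whose inverse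 is the operator given by the inverse power series. Then for every $v\in\Lambda$ that is a regular point, $$\mathcal P_X(v)=\sum_{\phi\in P(X)}\big(\widehat Q_\phi\,T_{X_\phi,\underline\phi}\big)(v).$$ -/

import Mathlib

open MeasureTheory Topology Filter

noncomputable section

namespace PartitionSpline

section Cones

variable {V : Type*} [AddCommGroup V] [Module ℝ V] {κ : Type*} [Fintype κ]

/-- The cone `C(A)` of non-negative combinations of the vectors of the list `a` indexed by `A`. -/
def cone (a : κ → V) (A : Set κ) : Set V :=
  {v | ∃ t : κ → ℝ, (∀ i, 0 ≤ t i) ∧ (∀ i, i ∉ A → t i = 0) ∧ v = ∑ i, t i • a i}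

/-- The union of the cones `C(A)` over the sublists `A` that do not span `V`. -/
def singularPoints (a : κ → V) : Set V :=
  {v | ∃ A : Set κ, Submodule.span ℝ (a '' A) ≠ ⊤ ∧ v ∈ cone a A}

/-- The regular points of the cone `C(X)`. -/
def regularPoints (a : κ → V) : Set V := cone a Set.univ \ singularPoints a

end Cones

section Splines

variable {V : Type*} [NormedAddCommGroup V] [NormedSpace ℝ V] [MeasurableSpace V]
  {κ : Type*} [Fintype κ]

/-- `T` is a multivariate E-spline `T_{X,μ}` of the list `a` with parameters `μ`: it represents
the distribution `f ↦ ∫_{t ≥ 0} exp (-∑ tᵢ μᵢ) f (∑ tᵢ aᵢ) dt` with respect to `ν`. -/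
structure IsESpline (ν : Measure V) (a : κ → V) (μ : κ → ℂ) (T : V → ℂ) : Prop where
  locallyIntegrable : LocallyIntegrable T ν
  integrableOn : ∀ f : V → ℂ, Continuous f → HasCompactSupport f →
    IntegrableOn (fun t : κ → ℝ => Complex.exp (-∑ i, (t i : ℂ) * μ i) * f (∑ i, t i • a i))
      {t | ∀ i, 0 ≤ t i}
  integral_eq : ∀ f : V → ℂ, Continuous f → HasCompactSupport f →
    ∫ x, f x * T x ∂ν =
      ∫ t in {t : κ → ℝ | ∀ i, 0 ≤ t i},
        Complex.exp (-∑ i, (t i : ℂ) * μ i) * f (∑ i, t i • a i)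

/-- The pointwise representative of the E-spline `T_{X,μ}`: the density at `x`, with respect to
`ν`, of the image under `t ↦ ∑ tᵢ aᵢ` of the measure `exp (-∑ tᵢ μᵢ) dt` on the positive orthant. -/
def eSpline (ν : Measure V) (a : κ → V) (μ : κ → ℂ) (x : V) : ℂ :=
  limUnder (𝓝[>] (0 : ℝ)) fun r =>
    (∫ t in {t : κ → ℝ | (∀ i, 0 ≤ t i) ∧ ∑ i, t i • a i ∈ Metric.closedBall x r},
      Complex.exp (-∑ i, (t i : ℂ) * μ i)) / (ν.real (Metric.closedBall x r) : ℂ)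

end Splines

section Operators

variable {V : Type*} [NormedAddCommGroup V] [NormedSpace ℝ V] {N : ℕ}

/-- Complex-valued polynomial functions on `V`: the `ℂ`-algebra generated by the real linear
forms. -/
def IsPolynomialFun (p : V → ℂ) : Prop :=
  p ∈ Algebra.adjoin ℂ (Set.range fun (u : V →ₗ[ℝ] ℝ) (x : V) => (u x : ℂ))

/-- Near every point of `R`, the function `f` is `e^φ` times a polynomial. -/
def IsLocallyExpPoly (φ : V →ₗ[ℝ] ℂ) (R : Set V) (f : V → ℂ) : Prop :=
  ∀ x ∈ R, ∃ p : V → ℂ, IsPolynomialFun p ∧ ∀ᶠ y in 𝓝 x, f y = Complex.exp (φ y) * p y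

/-- The differential operator `D_v - ⟨φ | v⟩`. -/
def shiftedDeriv (φ : V →ₗ[ℝ] ℂ) (v : V) (f : V → ℂ) : V → ℂ :=
  fun x => lineDeriv ℝ f x v - φ v * f x

/-- The monomial `∏ᵢ (D_{aᵢ} - ⟨φ | aᵢ⟩) ^ nᵢ` of (commuting) differential operators. -/
def monomialOp (φ : V →ₗ[ℝ] ℂ) (a : Fin N → V) (n : Fin N →₀ ℕ) (f : V → ℂ) : V → ℂ :=
  (List.finRange N).foldr (fun i g => (shiftedDeriv φ (a i))^[n i] g) f

/-- The power series `Q` in the operators `D_{aᵢ} - ⟨φ | aᵢ⟩`, applied to `f`. At the points where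
it is used only finitely many terms are nonzero. -/
def seriesOp (φ : V →ₗ[ℝ] ℂ) (a : Fin N → V) (Q : MvPowerSeries (Fin N) ℂ) (f : V → ℂ) :
    V → ℂ :=
  fun x => ∑ᶠ n : Fin N →₀ ℕ, MvPowerSeries.coeff n Q * monomialOp φ a n f x

/-- The power series of `e^{-z}`. -/
def expNegSeries : PowerSeries ℂ := PowerSeries.evalNegHom (PowerSeries.exp ℂ)

/-- The one-variable factor attached to a vector at which a character takes the value `c`:
`z / (1 - e^{-z})`, written as the inverse of `(1 - e^{-z}) / z`, if `c = 1`, and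
`1 / (1 - c⁻¹ e^{-z})` otherwise. -/
def toddFactor (c : ℂ) : PowerSeries ℂ :=
  open Classical in
  if c = 1 then (PowerSeries.mk fun k => PowerSeries.coeff (k + 1) (1 - expNegSeries))⁻¹
  else (1 - PowerSeries.C c⁻¹ * expNegSeries)⁻¹

/-- The power series `∏ᵢ Fᵢ(zᵢ)`, where `Fᵢ` is the factor attached to the value `c i`. -/
def toddSeries (c : Fin N → ℂ) : MvPowerSeries (Fin N) ℂ :=
  fun n => ∏ i, PowerSeries.coeff (n i) (toddFactor (c i))

end Operators

section Lattice

variable {V : Type*} [NormedAddCommGroup V] [NormedSpace ℝ V] {Λ : Submodule ℤ V} {N : ℕ}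

/-- The partition function `𝒫_X`. -/
def partitionFunction (X : Fin N → Λ) (v : Λ) : ℕ :=
  Set.ncard {n : Fin N → ℕ | ∑ i, n i • X i = v}

/-- The points `P(X)` of the toric arrangement: the characters of `Λ` that are trivial on some
basis of `V` extracted from `X`. -/
def arrangementPoints (X : Fin N → Λ) : Set (AddChar Λ ℂ) :=
  {χ | ∃ b : Set (Fin N), LinearIndependent ℝ (fun i : b => (X i : V)) ∧
    Submodule.span ℝ ((fun i => (X i : V)) '' b) = ⊤ ∧ ∀ i ∈ b, χ (X i) = 1}

/-- `φ` in the complexified dual represents the character `χ`, that is, `χ = e^φ` on `Λ`. -/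
def Represents (φ : V →ₗ[ℝ] ℂ) (χ : AddChar Λ ℂ) : Prop :=
  ∀ v : Λ, χ v = Complex.exp (φ v)

/-- The indices of the sublist `X_φ`. -/
abbrev LocalIndex (X : Fin N → Λ) (χ : AddChar Λ ℂ) : Type := {i : Fin N // χ (X i) = 1}

instance (X : Fin N → Λ) (χ : AddChar Λ ℂ) : Fintype (LocalIndex X χ) := Fintype.ofFinite _

/-- The sublist `X_φ`. -/
def localList (X : Fin N → Λ) (χ : AddChar Λ ℂ) : LocalIndex X χ → V := fun i => (X i.1 : V)

/-- The parameters `φ_a = -⟨φ | a⟩`, `a ∈ X_φ`. -/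
def localParam (X : Fin N → Λ) (χ : AddChar Λ ℂ) (φ : V →ₗ[ℝ] ℂ) : LocalIndex X χ → ℂ :=
  fun i => -φ (X i.1 : V)

/-- The local E-spline `T_{X_φ, φ}`. -/
def localSpline [MeasurableSpace V] (ν : Measure V) (X : Fin N → Λ) (χ : AddChar Λ ℂ)
    (φ : V →ₗ[ℝ] ℂ) : V → ℂ :=
  eSpline ν (localList X χ) (localParam X χ φ)

/-- The power series `Q_φ`. -/
def localSeries (X : Fin N → Λ) (χ : AddChar Λ ℂ) : MvPowerSeries (Fin N) ℂ :=
  toddSeries fun i => χ (X i)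

end Lattice

end PartitionSpline

end

/-! The proof compares the difference equations of the two sides. Adjoining a vector a to the list X
changes the partition function by P_{aX}(v) = P_X(v) + P_{aX}(v - a). The spline side obeys the same
rule once every spline is replaced by a polynomial. Conjugating by e^φ turns D_a - ⟨φ|a⟩ into D_a,
so everything reduces to the image of Lebesgue measure on the orthant (`coneMeasure`). Near a
non-singular point this measure has a polynomial density (`exists_hasPolyDensity`), and
differentiating the density along a generator removes that generator. Since e^{-D_a} is translation
by a, the difference operator of a inverts the factor of a in the Todd-type operator, up to the
factor D_a when the character is trivial on a (`IsGeneric.charTerm_cons`).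

To compare different lists, fix one point x lying on no proper subspace spanned by lattice vectors
and take all densities as germs at x. These germs exist for every list in an open half-space ℓ > 0.
Let `defect` be the partition function minus the resulting `splineSum`. The core claim is
`IsGeneric.vanishesNear_defect`: the defect of X vanishes at v as soon as x - v lies in the zonotope
of X.

The claim is reduced to lists with linearly independent support by partial fractions. The pair a, b
is traded for a + b, b and a + b, a (`vanishesNear_of_add`), and a is traded for a multiple m a
(`vanishesNear_of_nsmul`). Both follow formally from the difference equation, and the zonotope
condition is stable under both. A linear relation among the support vectors is first scaled to have
coefficients 0, 1, -1, then shortened until two vectors coincide (`vanishesOver_of_sign_relation`).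

For independent support with all multiplicities one, the claim is orthogonality of the characters of
Λ modulo the sublattice, the density being the reciprocal of the index. Multiplicities are then
raised one at a time: on both sides, adding a copy of a basis vector and translating by it amounts
to multiplication by the dual coordinate divided by the old multiplicity. On the spline side this
rests on e^{-z} T = 1 - z T'/T for T = z/(1 - e^{-z}).

Finally, for a regular v, finitely many local densities are polynomial on a common neighbourhood of
v. A generic x is chosen there with x - v in the zonotope (`exists_isGeneric_sub_mem_zonotope`), and
the germs at x are those at v. -/

noncomputable section

namespace PartitionSpline

open scoped ContDiff NNReal

set_option linter.unusedSectionVars false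

/-! ### Polynomial functions, their derivatives and Taylor's formula. -/

section PolynomialFunctions

variable {V : Type*} [NormedAddCommGroup V] [NormedSpace ℝ V]

/-- The algebra of complex-valued polynomial functions on `V`. -/
def PolyFun (V : Type*) [NormedAddCommGroup V] [NormedSpace ℝ V] : Subalgebra ℂ (V → ℂ) :=
  Algebra.adjoin ℂ (Set.range fun (u : V →ₗ[ℝ] ℝ) (x : V) => (u x : ℂ))

/-- A real linear form as a polynomial function. -/
def linPoly (u : V →ₗ[ℝ] ℝ) : PolyFun V :=
  ⟨fun x => (u x : ℂ), Algebra.subset_adjoin ⟨u, rfl⟩⟩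

@[simp] theorem linPoly_apply (u : V →ₗ[ℝ] ℝ) (x : V) : (linPoly u : V → ℂ) x = u x := rfl

theorem PolyFun.induction {C : PolyFun V → Prop} (hlin : ∀ u, C (linPoly u))
    (hconst : ∀ c : ℂ, C (algebraMap ℂ (PolyFun V) c))
    (hadd : ∀ p q, C p → C q → C (p + q)) (hmul : ∀ p q, C p → C q → C (p * q))
    (p : PolyFun V) : C p := by
  obtain ⟨p, hp⟩ := p
  refine Algebra.adjoin_induction (p := fun f hf => C ⟨f, hf⟩) ?_ ?_ ?_ ?_ hp
  · rintro _ ⟨u, rfl⟩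
    exact hlin u
  · intro c
    exact hconst c
  · intro f g hf hg h1 h2
    exact hadd _ _ h1 h2
  · intro f g hf hg h1 h2
    exact hmul _ _ h1 h2

theorem linPoly_hasLineDerivAt (u : V →ₗ[ℝ] ℝ) (x v : V) :
    HasLineDerivAt ℝ (fun x => (u x : ℂ)) (u v : ℂ) x v := by
  have h : HasDerivAt (fun t : ℝ => ((u x + t * u v : ℝ) : ℂ)) ((0 + 1 * u v : ℝ) : ℂ) 0 :=
    HasDerivAt.ofReal_comp ((hasDerivAt_const _ _).add ((hasDerivAt_id _).mul_const _))
  simpa [HasLineDerivAt] using h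

theorem polyFun_exists_lineDeriv (p : PolyFun V) (v : V) :
    ∃ q : PolyFun V, ∀ x, HasLineDerivAt ℝ (p : V → ℂ) ((q : V → ℂ) x) x v := by
  induction p using PolyFun.induction with
  | hlin u => exact ⟨algebraMap ℂ _ (u v : ℂ), fun x => linPoly_hasLineDerivAt u x v⟩
  | hconst c => exact ⟨0, fun x => hasDerivAt_const (0 : ℝ) c⟩
  | hadd p q hp hq =>
    obtain ⟨p', hp⟩ := hp
    obtain ⟨q', hq⟩ := hq
    exact ⟨p' + q', fun x => HasDerivAt.add (hp x) (hq x)⟩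
  | hmul p q hp hq =>
    obtain ⟨p', hp⟩ := hp
    obtain ⟨q', hq⟩ := hq
    refine ⟨p' * q + p * q', fun x => ?_⟩
    have h := HasDerivAt.fun_mul (hp x) (hq x)
    simp only [zero_smul, add_zero] at h
    exact h

theorem polyFun_lineDeriv_mem (p : PolyFun V) (v : V) :
    (fun x => lineDeriv ℝ (p : V → ℂ) x v) ∈ PolyFun V := by
  obtain ⟨q, hq⟩ := polyFun_exists_lineDeriv p v
  convert q.2 using 1
  exact funext fun x => (hq x).lineDeriv

theorem polyFun_hasLineDerivAt (p : PolyFun V) (x v : V) :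
    HasLineDerivAt ℝ (p : V → ℂ) (lineDeriv ℝ (p : V → ℂ) x v) x v := by
  obtain ⟨q, hq⟩ := polyFun_exists_lineDeriv p v
  rw [(hq x).lineDeriv]
  exact hq x

/-- The directional derivative on polynomial functions. -/
def polyDeriv (v : V) : Module.End ℂ (PolyFun V) where
  toFun p := ⟨fun x => lineDeriv ℝ (p : V → ℂ) x v, polyFun_lineDeriv_mem p v⟩
  map_add' p q := Subtype.ext <| funext fun x =>
    (HasDerivAt.add (polyFun_hasLineDerivAt p x v) (polyFun_hasLineDerivAt q x v)).deriv
  map_smul' c p := Subtype.ext <| funext fun x =>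
    (HasDerivAt.const_smul c (polyFun_hasLineDerivAt p x v)).deriv

theorem polyDeriv_apply (v : V) (p : PolyFun V) (x : V) :
    (polyDeriv v p : V → ℂ) x = lineDeriv ℝ (p : V → ℂ) x v := rfl

theorem hasLineDerivAt_polyDeriv (v : V) (p : PolyFun V) (x : V) :
    HasLineDerivAt ℝ (p : V → ℂ) ((polyDeriv v p : V → ℂ) x) x v := polyFun_hasLineDerivAt p x v

theorem polyDeriv_mul (v : V) (p q : PolyFun V) :
    polyDeriv v (p * q) = polyDeriv v p * q + p * polyDeriv v q := by
  refine Subtype.ext <| funext fun x => ?_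
  have h := (HasDerivAt.fun_mul (polyFun_hasLineDerivAt p x v)
    (polyFun_hasLineDerivAt q x v)).deriv
  simp only [zero_smul, add_zero] at h
  exact h

@[simp] theorem polyDeriv_linPoly (v : V) (u : V →ₗ[ℝ] ℝ) :
    polyDeriv v (linPoly u) = algebraMap ℂ _ (u v : ℂ) :=
  Subtype.ext <| funext fun x => (linPoly_hasLineDerivAt u x v).lineDeriv

@[simp] theorem polyDeriv_algebraMap (v : V) (c : ℂ) :
    polyDeriv v (algebraMap ℂ (PolyFun V) c) = 0 :=
  Subtype.ext <| funext fun _ => (hasDerivAt_const (0 : ℝ) c).deriv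

theorem polyDeriv_comm (v w : V) (p : PolyFun V) :
    polyDeriv v (polyDeriv w p) = polyDeriv w (polyDeriv v p) := by
  induction p using PolyFun.induction with
  | hlin u => simp
  | hconst c => simp
  | hadd p q hp hq => simp [hp, hq]
  | hmul p q hp hq => simp only [polyDeriv_mul, map_add, hp, hq]; ring

theorem commute_polyDeriv (v w : V) :
    Commute (polyDeriv v : Module.End ℂ (PolyFun V)) (polyDeriv w) :=
  LinearMap.ext fun p => polyDeriv_comm v w p

/-- All derivatives of order `n` of the polynomial function `p` vanish. -/
def DerivVanish : ℕ → PolyFun V → Prop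
  | 0, p => p = 0
  | n + 1, p => ∀ v, DerivVanish n (polyDeriv v p)

theorem derivVanish_zero (n : ℕ) : DerivVanish n (0 : PolyFun V) := by
  induction n with
  | zero => rfl
  | succ n ih => intro v; simpa using ih

theorem DerivVanish.succ {n : ℕ} {p : PolyFun V} (h : DerivVanish n p) :
    DerivVanish (n + 1) p := by
  induction n generalizing p with
  | zero =>
    intro v
    have : p = 0 := h
    simp [this, DerivVanish]
  | succ n ih => exact fun v => ih (h v)

theorem DerivVanish.mono {m n : ℕ} {p : PolyFun V} (h : DerivVanish m p) (hmn : m ≤ n) :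
    DerivVanish n p := by
  induction hmn with
  | refl => exact h
  | step _ ih => exact ih.succ

theorem DerivVanish.add {n : ℕ} {p q : PolyFun V} (hp : DerivVanish n p) (hq : DerivVanish n q) :
    DerivVanish n (p + q) := by
  induction n generalizing p q with
  | zero =>
    have h1 : p = 0 := hp
    have h2 : q = 0 := hq
    simp [h1, h2, DerivVanish]
  | succ n ih => intro v; rw [map_add]; exact ih (hp v) (hq v)

/-- By Leibniz, a derivative of the product is a sum of two products with one order lowered. The
order m + n is not sharp, but only its finiteness matters. -/
theorem DerivVanish.mul {m n : ℕ} {p q : PolyFun V} (hp : DerivVanish m p)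
    (hq : DerivVanish n q) : DerivVanish (m + n) (p * q) := by
  induction hk : m + n generalizing m n p q with
  | zero =>
    have h1 : p = 0 := by obtain rfl : m = 0 := by omega
                          exact hp
    simp [h1, DerivVanish]
  | succ k ih =>
    rcases m with _ | m
    · have h1 : p = 0 := hp
      rw [h1, zero_mul]; exact derivVanish_zero _
    rcases n with _ | n
    · have h1 : q = 0 := hq
      rw [h1, mul_zero]; exact derivVanish_zero _
    intro v
    rw [polyDeriv_mul]
    exact (ih (hp v) hq (by omega)).add (ih hp (hq v) (by omega))

theorem exists_derivVanish (p : PolyFun V) : ∃ n, DerivVanish n p := by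
  induction p using PolyFun.induction with
  | hlin u => exact ⟨2, fun v w => by simp [DerivVanish]⟩
  | hconst c => exact ⟨1, fun v => by simp [DerivVanish]⟩
  | hadd p q hp hq =>
    obtain ⟨m, hm⟩ := hp
    obtain ⟨n, hn⟩ := hq
    exact ⟨max m n, (hm.mono (le_max_left _ _)).add (hn.mono (le_max_right _ _))⟩
  | hmul p q hp hq =>
    obtain ⟨m, hm⟩ := hp
    obtain ⟨n, hn⟩ := hq
    exact ⟨m + n, hm.mul hn⟩

theorem DerivVanish.polyDeriv_iterate {n k : ℕ} {p : PolyFun V} (h : DerivVanish n p) (v : V) :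
    DerivVanish (n - k) ((polyDeriv v ^ k) p) := by
  induction k generalizing n p with
  | zero => simpa using h
  | succ k ih =>
    rw [pow_succ, Module.End.mul_apply]
    rcases n with _ | n
    · have h1 : p = 0 := h
      rw [h1, map_zero, map_zero]; exact derivVanish_zero _
    · simpa using ih (h v)

theorem exists_polyDeriv_pow_eq_zero (v : V) (p : PolyFun V) :
    ∃ n, ∀ k, n ≤ k → (polyDeriv v ^ k) p = 0 := by
  obtain ⟨n, hn⟩ := exists_derivVanish p
  refine ⟨n, fun k hk => ?_⟩
  have h := hn.polyDeriv_iterate (k := k) v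
  rw [Nat.sub_eq_zero_of_le hk] at h
  exact h

/-- Taylor's formula for polynomial functions. -/
theorem polyFun_taylor (v : V) (p : PolyFun V) (n : ℕ) (hn : (polyDeriv v ^ n) p = 0) (x : V)
    (t : ℝ) : (p : V → ℂ) (x + t • v) =
      ∑ k ∈ Finset.range n, ((t : ℂ) ^ k / (k.factorial : ℂ)) *
        ((polyDeriv v ^ k) p : PolyFun V).1 x := by
  induction n generalizing p t with
  | zero =>
    have : p = 0 := hn
    simp [this]
  | succ n ih =>
    -- As functions of t, both sides have as derivative the two sides of the formula for `polyDeriv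
    -- v p`, and they agree at t = 0.
    have ih' := ih (polyDeriv v p) (by rw [← Module.End.mul_apply, ← pow_succ]; exact hn)
    have hder : ∀ s : ℝ, HasDerivAt (fun t : ℝ => (p : V → ℂ) (x + t • v))
        ((polyDeriv v p : V → ℂ) (x + s • v)) s := by
      intro s
      have h := hasLineDerivAt_polyDeriv v p (x + s • v)
      have h2 : HasDerivAt (fun t : ℝ => t - s) 1 s := (hasDerivAt_id s).sub_const s
      have h3 := HasDerivAt.scomp_of_eq (g₁ := fun t : ℝ => (p : V → ℂ) (x + s • v + t • v))
        (h := fun t : ℝ => t - s) s h h2 (by simp)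
      rw [one_smul] at h3
      refine h3.congr_of_eventuallyEq (Eventually.of_forall fun t => ?_)
      have e : x + s • v + (t - s) • v = x + t • v := by module
      simp only [Function.comp, e]
    have hder2 : ∀ s : ℝ, HasDerivAt (fun t : ℝ => ∑ k ∈ Finset.range (n + 1),
        ((t : ℂ) ^ k / (k.factorial : ℂ)) * ((polyDeriv v ^ k) p : PolyFun V).1 x)
        ((polyDeriv v p : V → ℂ) (x + s • v)) s := by
      intro s
      rw [ih' s]
      simp_rw [Finset.sum_range_succ']
      have : HasDerivAt (fun t : ℝ => ∑ k ∈ Finset.range n,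
          ((t : ℂ) ^ (k + 1) / ((k + 1).factorial : ℂ)) *
            ((polyDeriv v ^ (k + 1)) p : PolyFun V).1 x)
          (∑ k ∈ Finset.range n, ((s : ℂ) ^ k / (k.factorial : ℂ)) *
            ((polyDeriv v ^ k) (polyDeriv v p) : PolyFun V).1 x) s := by
        refine HasDerivAt.fun_sum fun k _ => ?_
        have h1 : HasDerivAt (fun t : ℝ => (t : ℂ) ^ (k + 1)) (((k + 1 : ℕ) : ℂ) * (s : ℂ) ^ k) s := by
          have := ((hasDerivAt_id (s : ℂ)).pow (k + 1)).comp_ofReal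
          simpa using this
        have h2 := (h1.div_const (((k + 1).factorial : ℕ) : ℂ)).mul_const
          (((polyDeriv v ^ (k + 1)) p : PolyFun V).1 x)
        have e : ((k + 1 : ℕ) : ℂ) * (s : ℂ) ^ k / (((k + 1).factorial : ℕ) : ℂ) *
            ((polyDeriv v ^ (k + 1)) p : PolyFun V).1 x = ((s : ℂ) ^ k / (k.factorial : ℂ)) *
            ((polyDeriv v ^ k) (polyDeriv v p) : PolyFun V).1 x := ?_
        · rw [e] at h2
          exact h2
        rw [pow_succ, Module.End.mul_apply, Nat.factorial_succ]
        have : ((k : ℂ) + 1) ≠ 0 := by exact_mod_cast Nat.succ_ne_zero k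
        have h4 : ((k.factorial : ℕ) : ℂ) ≠ 0 := by exact_mod_cast k.factorial_ne_zero
        push_cast
        field_simp
      have h5 := this.add_const ((((0 : ℂ)) ^ 0 / ((Nat.factorial 0 : ℕ) : ℂ)) * (p : V → ℂ) x)
      simpa using h5
    have hconst := is_const_of_deriv_eq_zero (f := fun t : ℝ => (p : V → ℂ) (x + t • v) -
        ∑ k ∈ Finset.range (n + 1), ((t : ℂ) ^ k / (k.factorial : ℂ)) *
        ((polyDeriv v ^ k) p : PolyFun V).1 x)
      (fun s => ((hder s).sub (hder2 s)).differentiableAt)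
      (fun s => by
        have := ((hder s).sub (hder2 s)).deriv
        rw [sub_self] at this; exact this) t 0
    have h0 : (p : V → ℂ) (x + (0 : ℝ) • v) - ∑ k ∈ Finset.range (n + 1),
        (((0 : ℝ) : ℂ) ^ k / (k.factorial : ℂ)) * ((polyDeriv v ^ k) p : PolyFun V).1 x = 0 := by
      rw [Finset.sum_range_succ']
      simp
    rw [← sub_eq_zero]
    exact hconst.trans h0

end PolynomialFunctions

/-! ### Formal series of operators that are finite on each vector. -/

section FormalOperators

variable {A M : Type*} [AddCommGroup M] [Module ℂ M]

/-- The formal series `∑ n, c n • τ n` of operators applied to a vector that is killed by all but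
finitely many of the `τ n`. -/
def formalOp (τ : A → Module.End ℂ M) (hfin : ∀ p, {n | τ n p ≠ 0}.Finite) (c : A → ℂ) :
    Module.End ℂ M where
  toFun p := ∑ᶠ n, c n • τ n p
  map_add' p q := by
    rw [← finsum_add_distrib]
    · simp
    · exact (hfin p).subset fun n hn h => hn (by simp [h])
    · exact (hfin q).subset fun n hn h => hn (by simp [h])
  map_smul' r p := by
    rw [RingHom.id_apply, smul_finsum' r ((hfin p).subset fun n hn h => hn (by simp [h]))]
    exact finsum_congr fun n => by rw [map_smul, smul_comm]

theorem formalOp_apply (τ : A → Module.End ℂ M) (hfin : ∀ p, {n | τ n p ≠ 0}.Finite) (c : A → ℂ)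
    (p : M) : formalOp τ hfin c p = ∑ᶠ n, c n • τ n p := rfl

theorem formalOp_eq_sum (τ : A → Module.End ℂ M) (hfin : ∀ p, {n | τ n p ≠ 0}.Finite) (c : A → ℂ)
    (p : M) (s : Finset A) (hs : ∀ n, τ n p ≠ 0 → n ∈ s) :
    formalOp τ hfin c p = ∑ n ∈ s, c n • τ n p :=
  finsum_eq_sum_of_support_subset _ fun n hn => hs n fun h => hn (by simp [h])

/-- Cauchy product. If τ (i + j) p is nonzero then so are τ i p and τ j p, hence every sum can be
taken over the one finite set of indices that do not kill p. -/
theorem formalOp_mul [AddCommMonoid A] [DecidableEq A] [Finset.HasAntidiagonal A] (τ : A → Module.End ℂ M)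
    (hτ : ∀ i j, τ (i + j) = τ i * τ j)
    (hfin : ∀ p, {n | τ n p ≠ 0}.Finite) (c d : A → ℂ) :
    formalOp τ hfin (fun n => ∑ ij ∈ Finset.HasAntidiagonal.antidiagonal n, c ij.1 * d ij.2) =
      formalOp τ hfin c * formalOp τ hfin d := by
  refine LinearMap.ext fun p => ?_
  have hleft : ∀ i j, τ (i + j) p ≠ 0 → τ i p ≠ 0 := by
    intro i j h h0
    rw [add_comm, hτ, Module.End.mul_apply, h0, map_zero] at h
    exact h rfl
  have hright : ∀ i j, τ (i + j) p ≠ 0 → τ j p ≠ 0 := by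
    intro i j h h0
    rw [hτ, Module.End.mul_apply, h0, map_zero] at h
    exact h rfl
  set S := (hfin p).toFinset with hS
  have memS : ∀ n, n ∈ S ↔ τ n p ≠ 0 := fun n => by simp [hS]
  have e2 : formalOp τ hfin d p = ∑ j ∈ S, d j • τ j p :=
    formalOp_eq_sum τ hfin d p S fun n hn => (memS n).2 hn
  have e3 : ∀ i, τ i (formalOp τ hfin d p) = ∑ j ∈ S, d j • τ (i + j) p := by
    intro i
    simp [e2, map_sum, hτ]
  rw [Module.End.mul_apply, formalOp_eq_sum τ hfin _ p S fun n hn => (memS n).2 hn,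
    formalOp_eq_sum τ hfin c _ S]
  · simp_rw [e3, Finset.smul_sum, smul_smul]
    rw [← Finset.sum_product' S S (fun i j => (c i * d j) • τ (i + j) p)]
    rw [← Finset.sum_filter_of_ne (p := fun ij : A × A => ij.1 + ij.2 ∈ S)]
    · rw [← Finset.sum_fiberwise_of_maps_to (t := S) (g := fun ij : A × A => ij.1 + ij.2)]
      · refine Finset.sum_congr rfl fun n hn => ?_
        rw [Finset.sum_smul]
        have : ((S ×ˢ S).filter (fun ij : A × A => ij.1 + ij.2 ∈ S)).filter
            (fun ij : A × A => ij.1 + ij.2 = n) = Finset.HasAntidiagonal.antidiagonal n := by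
          ext ij
          simp only [Finset.mem_filter, Finset.mem_product, Finset.HasAntidiagonal.mem_antidiagonal]
          constructor
          · exact fun h => h.2
          · intro h
            have h' := (memS n).1 hn
            rw [← h] at h'
            exact ⟨⟨⟨(memS _).2 (hleft _ _ h'), (memS _).2 (hright _ _ h')⟩, h ▸ hn⟩, h⟩
        rw [this]
        refine Finset.sum_congr rfl fun ij hij => ?_
        rw [Finset.HasAntidiagonal.mem_antidiagonal.1 hij]
      · intro ij hij
        exact (Finset.mem_filter.1 hij).2
    · intro ij _ h
      exact (memS _).2 fun h0 => h (by simp [h0])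
  · intro i hi
    rw [e3] at hi
    obtain ⟨j, _, hj⟩ := Finset.exists_ne_zero_of_sum_ne_zero hi
    exact (memS i).2 (hleft i j fun h0 => hj (by simp [h0]))

theorem formalOp_add (τ : A → Module.End ℂ M)
    (hfin : ∀ p, {n | τ n p ≠ 0}.Finite) (c d : A → ℂ) :
    formalOp τ hfin (fun n => c n + d n) = formalOp τ hfin c + formalOp τ hfin d := by
  refine LinearMap.ext fun p => ?_
  rw [LinearMap.add_apply]
  have hs : ∀ n, τ n p ≠ 0 → n ∈ (hfin p).toFinset := by simp
  simp only [formalOp_eq_sum τ hfin _ p _ hs, add_smul, Finset.sum_add_distrib]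

theorem formalOp_ite [DecidableEq A] (τ : A → Module.End ℂ M)
    (hfin : ∀ p, {n | τ n p ≠ 0}.Finite) (i : A) (r : ℂ) :
    formalOp τ hfin (fun n => if n = i then r else 0) = r • τ i := by
  refine LinearMap.ext fun p => ?_
  rw [formalOp_apply, finsum_eq_single _ i (fun n hn => by simp [hn])]
  simp

theorem formalOp_commute (τ : A → Module.End ℂ M)
    (hfin : ∀ p, {n | τ n p ≠ 0}.Finite) (c : A → ℂ) (T : Module.End ℂ M)
    (h : ∀ n, Commute (τ n) T) : Commute (formalOp τ hfin c) T := by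
  refine LinearMap.ext fun p => ?_
  have h' : ∀ n, τ n (T p) = T (τ n p) := fun n => LinearMap.congr_fun (h n) p
  rw [Module.End.mul_apply, Module.End.mul_apply,
    formalOp_eq_sum τ hfin c p (hfin p).toFinset (by simp),
    formalOp_eq_sum τ hfin c (T p) (hfin p).toFinset, map_sum]
  · simp [h']
  · intro n hn
    rw [h'] at hn
    simp only [Set.Finite.mem_toFinset, Set.mem_ofPred_eq]
    exact fun h0 => hn (by simp [h0])

end FormalOperators

/-! ### Power series in a single directional derivative. -/

section OneVariable

variable {V : Type*} [NormedAddCommGroup V] [NormedSpace ℝ V]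

theorem finite_polyDeriv_pow_ne_zero (v : V) (p : PolyFun V) :
    {n : ℕ | (polyDeriv v ^ n) p ≠ 0}.Finite := by
  obtain ⟨n, hn⟩ := exists_polyDeriv_pow_eq_zero v p
  exact (Set.finite_lt_nat n).subset fun k hk => by
    by_contra h
    exact hk (hn k (not_lt.1 h))

/-- The operator `f(D_v)` on polynomial functions. -/
def serOp (v : V) : PowerSeries ℂ →+* Module.End ℂ (PolyFun V) where
  toFun f := formalOp (fun n : ℕ => polyDeriv v ^ n) (finite_polyDeriv_pow_ne_zero v)
    fun n => PowerSeries.coeff n f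
  map_one' := by
    simp only [PowerSeries.coeff_one]
    rw [formalOp_ite]
    simp
  map_mul' f g := by
    have e : (fun n => PowerSeries.coeff n (f * g)) = fun n =>
        ∑ ij ∈ Finset.HasAntidiagonal.antidiagonal n,
          PowerSeries.coeff ij.1 f * PowerSeries.coeff ij.2 g :=
      funext fun n => PowerSeries.coeff_mul n f g
    rw [e]
    exact formalOp_mul _ (fun i j => pow_add (polyDeriv v) i j) (finite_polyDeriv_pow_ne_zero v)
      (fun n => PowerSeries.coeff n f) (fun n => PowerSeries.coeff n g)
  map_zero' := LinearMap.ext fun p => by simp [formalOp_apply]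
  map_add' f g := by
    simp only [map_add]
    exact formalOp_add _ (finite_polyDeriv_pow_ne_zero v) _ _

theorem serOp_apply_eq_sum (v : V) (f : PowerSeries ℂ) (p : PolyFun V) (n : ℕ)
    (hn : ∀ k, n ≤ k → (polyDeriv v ^ k) p = 0) :
    serOp v f p = ∑ k ∈ Finset.range n, PowerSeries.coeff k f • (polyDeriv v ^ k) p :=
  formalOp_eq_sum _ (finite_polyDeriv_pow_ne_zero v) _ _ _ fun k hk => by
    rw [Finset.mem_range]
    by_contra h
    exact hk (hn k (not_lt.1 h))

@[simp] theorem serOp_X (v : V) : serOp v PowerSeries.X = polyDeriv v := by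
  have : serOp v PowerSeries.X = formalOp (fun n : ℕ => polyDeriv v ^ n)
    (finite_polyDeriv_pow_ne_zero v) fun n => PowerSeries.coeff n PowerSeries.X := rfl
  rw [this]
  simp only [PowerSeries.coeff_X]
  rw [formalOp_ite]
  simp

theorem serOp_C (v : V) (r : ℂ) : serOp v (PowerSeries.C r) = r • 1 := by
  have : serOp v (PowerSeries.C r) = formalOp (fun n : ℕ => polyDeriv v ^ n)
    (finite_polyDeriv_pow_ne_zero v) fun n => PowerSeries.coeff n (PowerSeries.C r) := rfl
  rw [this]
  simp only [PowerSeries.coeff_C]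
  rw [formalOp_ite]
  simp

theorem commute_serOp_polyDeriv (v w : V) (f : PowerSeries ℂ) :
    Commute (serOp v f) (polyDeriv w) :=
  formalOp_commute _ (finite_polyDeriv_pow_ne_zero v) _ _ fun n => (commute_polyDeriv v w).pow_left n

theorem commute_serOp (v w : V) (f g : PowerSeries ℂ) :
    Commute (serOp v f) (serOp w g) :=
  formalOp_commute _ (finite_polyDeriv_pow_ne_zero v) _ _ fun n =>
    ((commute_serOp_polyDeriv w v g).symm.pow_left n)

theorem serOp_comm_apply (v w : V) (f g : PowerSeries ℂ) (p : PolyFun V) :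
    serOp v f (serOp w g p) = serOp w g (serOp v f p) :=
  LinearMap.congr_fun (commute_serOp v w f g) p

theorem serOp_polyDeriv_apply (v w : V) (f : PowerSeries ℂ) (p : PolyFun V) :
    serOp v f (polyDeriv w p) = polyDeriv w (serOp v f p) :=
  LinearMap.congr_fun (commute_serOp_polyDeriv v w f) p

theorem coeff_expNegSeries (n : ℕ) :
    PowerSeries.coeff n expNegSeries = (-1) ^ n / (n.factorial : ℂ) := by
  rw [expNegSeries, PowerSeries.evalNegHom, PowerSeries.coeff_rescale, PowerSeries.coeff_exp]
  simp [div_eq_mul_inv]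

/-- The operator `e^{-D_v}` is the translation by `v`. -/
theorem serOp_expNegSeries (v : V) (p : PolyFun V) (x : V) :
    (serOp v expNegSeries p : V → ℂ) x = (p : V → ℂ) (x - v) := by
  obtain ⟨n, hn⟩ := exists_polyDeriv_pow_eq_zero v p
  have h := polyFun_taylor v p n (hn n le_rfl) x (-1)
  rw [serOp_apply_eq_sum v _ p n hn]
  have e : x - v = x + (-1 : ℝ) • v := by module
  rw [e, h]
  simp [coeff_expNegSeries, Finset.sum_apply]

theorem polyDeriv_pow_linPoly_mul (v : V) (u : V →ₗ[ℝ] ℝ) (p : PolyFun V) (k : ℕ) :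
    (polyDeriv v ^ (k + 1)) (linPoly u * p) = linPoly u * (polyDeriv v ^ (k + 1)) p +
      ((k + 1 : ℂ) * (u v : ℂ)) • (polyDeriv v ^ k) p := by
  induction k with
  | zero =>
    simp only [zero_add, pow_one, polyDeriv_mul, polyDeriv_linPoly, pow_zero, Module.End.one_apply,
      CharP.cast_eq_zero, one_mul]
    rw [Algebra.smul_def]; ring
  | succ k ih =>
    rw [pow_succ', Module.End.mul_apply, ih, map_add, map_smul, polyDeriv_mul, polyDeriv_linPoly,
      ← Module.End.mul_apply, ← pow_succ', ← Module.End.mul_apply, ← pow_succ', Algebra.smul_def,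
      Algebra.smul_def]
    simp only [Nat.cast_add, Nat.cast_one]
    simp only [map_add, map_mul, map_one]
    ring

/-- The commutator of `f(D_v)` with the multiplication by a linear form. -/
theorem serOp_linPoly_mul (v : V) (u : V →ₗ[ℝ] ℝ) (f : PowerSeries ℂ) (p : PolyFun V) :
    serOp v f (linPoly u * p) = linPoly u * serOp v f p +
      (u v : ℂ) • serOp v (PowerSeries.derivative ℂ f) p := by
  obtain ⟨n, hn⟩ := exists_polyDeriv_pow_eq_zero v p
  have hn' : ∀ k, n + 1 ≤ k → (polyDeriv v ^ k) (linPoly u * p) = 0 := by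
    intro k hk
    obtain ⟨k, rfl⟩ : ∃ j, k = j + 1 := ⟨k - 1, by omega⟩
    rw [polyDeriv_pow_linPoly_mul, hn _ (by omega), hn _ (by omega)]
    simp
  rw [serOp_apply_eq_sum v f _ (n + 1) hn', serOp_apply_eq_sum v (PowerSeries.derivative ℂ f) p n hn,
    serOp_apply_eq_sum v f p (n + 1) fun k hk => hn k (by omega),
    Finset.sum_range_succ', Finset.sum_range_succ']
  simp only [polyDeriv_pow_linPoly_mul, pow_zero, Module.End.one_apply, smul_add, mul_add,
    Finset.sum_add_distrib, Finset.mul_sum, Finset.smul_sum, PowerSeries.coeff_derivative,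
    smul_smul, mul_smul_comm]
  rw [add_assoc, add_comm (Finset.sum _ _) (_ • _), ← add_assoc]
  congr 1
  refine Finset.sum_congr rfl fun k _ => ?_
  congr 1
  ring

theorem serOp_algebraMap (v : V) (f : PowerSeries ℂ) (r : ℂ) :
    serOp v f (algebraMap ℂ (PolyFun V) r) =
      PowerSeries.coeff 0 f • algebraMap ℂ (PolyFun V) r := by
  rw [serOp_apply_eq_sum v f _ 1]
  · simp
  · intro k hk
    obtain ⟨k, rfl⟩ : ∃ j, k = j + 1 := ⟨k - 1, by omega⟩
    rw [pow_succ, Module.End.mul_apply, polyDeriv_algebraMap, map_zero]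

end OneVariable

/-! ### Power series in several directional derivatives. -/

section SeveralVariables

variable {V : Type*} [NormedAddCommGroup V] [NormedSpace ℝ V] {N : ℕ}

/-- The monomial `∏ i, D_{a i} ^ n i` on polynomial functions. -/
def polyMonomial (a : Fin N → V) (n : Fin N →₀ ℕ) : Module.End ℂ (PolyFun V) :=
  ((List.finRange N).map fun i => polyDeriv (a i) ^ n i).prod

theorem prod_map_pow_add {ι R : Type*} [Monoid R] (f : ι → R) (hf : ∀ i j, Commute (f i) (f j))
    (m n : ι → ℕ) (l : List ι) : (l.map fun i => f i ^ (m i + n i)).prod =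
      (l.map fun i => f i ^ m i).prod * (l.map fun i => f i ^ n i).prod := by
  induction l with
  | nil => simp
  | cons i l ih =>
    simp only [List.map_cons, List.prod_cons]
    rw [ih, pow_add]
    have h : Commute (f i ^ n i) (l.map fun j => f j ^ m j).prod :=
      Commute.list_prod_right _ _ fun x hx => by
        obtain ⟨j, -, rfl⟩ := List.mem_map.1 hx
        exact ((hf i j).pow_left _).pow_right _
    simp only [mul_assoc]
    congr 1
    rw [← mul_assoc, ← mul_assoc, h.eq]

theorem polyMonomial_add (a : Fin N → V) (m n : Fin N →₀ ℕ) :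
    polyMonomial a (m + n) = polyMonomial a m * polyMonomial a n :=
  prod_map_pow_add (fun i => polyDeriv (a i)) (fun i j => commute_polyDeriv (a i) (a j)) m n _

theorem DerivVanish.prod_map {m : ℕ} {p : PolyFun V} (hp : DerivVanish m p) (a : Fin N → V)
    (n : Fin N → ℕ) (l : List (Fin N)) :
    DerivVanish (m - (l.map n).sum) ((l.map fun i => polyDeriv (a i) ^ n i).prod p) := by
  induction l with
  | nil => simpa using hp
  | cons i l ih =>
    simp only [List.map_cons, List.sum_cons, List.prod_cons, Module.End.mul_apply]
    have h := ih.polyDeriv_iterate (k := n i) (a i)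
    rwa [Nat.sub_sub, Nat.add_comm] at h

theorem DerivVanish.polyMonomial_eq_zero {m : ℕ} {p : PolyFun V} (hp : DerivVanish m p)
    (a : Fin N → V) (n : Fin N →₀ ℕ) (h : polyMonomial a n p ≠ 0) (i : Fin N) : n i < m := by
  by_contra hlt
  apply h
  have h1 := hp.prod_map a n (List.finRange N)
  have h2 : n i ≤ ((List.finRange N).map n).sum :=
    List.single_le_sum (by simp) _ (List.mem_map.2 ⟨i, List.mem_finRange i, rfl⟩)
  rw [Nat.sub_eq_zero_of_le ((not_lt.1 hlt).trans h2)] at h1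
  exact h1

theorem finite_polyMonomial_ne_zero (a : Fin N → V) (p : PolyFun V) :
    {n | polyMonomial a n p ≠ 0}.Finite := by
  obtain ⟨m, hm⟩ := exists_derivVanish p
  refine (Set.finite_Iic (Finsupp.equivFunOnFinite.symm fun _ : Fin N => m)).subset fun n hn => ?_
  exact fun i => (hm.polyMonomial_eq_zero a n hn i).le

/-- The power series `Q` in the operators `D_{a i}`, on polynomial functions. -/
def mvOp (a : Fin N → V) : MvPowerSeries (Fin N) ℂ →+* Module.End ℂ (PolyFun V) where
  toFun Q := formalOp (polyMonomial a) (finite_polyMonomial_ne_zero a)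
    fun n => MvPowerSeries.coeff n Q
  map_one' := by
    classical
    simp only [MvPowerSeries.coeff_one]
    rw [formalOp_ite]
    simp [polyMonomial]
  map_mul' f g := by
    classical
    have e : (fun n => MvPowerSeries.coeff n (f * g)) = fun n =>
        ∑ ij ∈ Finset.HasAntidiagonal.antidiagonal n,
          MvPowerSeries.coeff ij.1 f * MvPowerSeries.coeff ij.2 g :=
      funext fun n => MvPowerSeries.coeff_mul n f g
    rw [e]
    exact formalOp_mul _ (polyMonomial_add a) (finite_polyMonomial_ne_zero a)
      (fun n => MvPowerSeries.coeff n f) (fun n => MvPowerSeries.coeff n g)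
  map_zero' := LinearMap.ext fun p => by simp [formalOp_apply]
  map_add' f g := by
    simp only [map_add]
    exact formalOp_add _ (finite_polyMonomial_ne_zero a) _ _

theorem mvOp_apply (a : Fin N → V) (Q : MvPowerSeries (Fin N) ℂ) (p : PolyFun V) :
    mvOp a Q p = ∑ᶠ n, MvPowerSeries.coeff n Q • polyMonomial a n p := rfl

/-- The power series `F` in the single variable `i`. -/
def oneVar (i : Fin N) (F : PowerSeries ℂ) : MvPowerSeries (Fin N) ℂ :=
  fun n => if n = Finsupp.single i (n i) then PowerSeries.coeff (n i) F else 0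

theorem coeff_oneVar (i : Fin N) (F : PowerSeries ℂ) (n : Fin N →₀ ℕ) :
    MvPowerSeries.coeff n (oneVar i F) =
      if n = Finsupp.single i (n i) then PowerSeries.coeff (n i) F else 0 := rfl

theorem prod_map_single {ι R : Type*} [Monoid R] [DecidableEq ι] (f : ι → R) (i : ι) (k : ℕ)
    (l : List ι) (hl : l.Nodup) :
    (l.map fun j => f j ^ (Finsupp.single i k) j).prod = if i ∈ l then f i ^ k else 1 := by
  induction l with
  | nil => simp
  | cons j l ih =>
    rw [List.nodup_cons] at hl
    simp only [List.map_cons, List.prod_cons, ih hl.2, List.mem_cons]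
    by_cases hij : i = j
    · subst hij
      simp [hl.1]
    · simp [hij]

theorem polyMonomial_single (a : Fin N → V) (i : Fin N) (k : ℕ) :
    polyMonomial a (Finsupp.single i k) = polyDeriv (a i) ^ k := by
  rw [polyMonomial, prod_map_single (fun j => polyDeriv (a j)) i k _ (List.nodup_finRange N)]
  simp

theorem mvOp_oneVar (a : Fin N → V) (i : Fin N) (F : PowerSeries ℂ) :
    mvOp a (oneVar i F) = serOp (a i) F := by
  refine LinearMap.ext fun p => ?_
  obtain ⟨m, hm⟩ := exists_derivVanish p
  obtain ⟨m', hm'⟩ := exists_polyDeriv_pow_eq_zero (a i) p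
  rw [serOp_apply_eq_sum (a i) F p (m + m') fun k hk => hm' k (by omega), mvOp_apply]
  rw [finsum_eq_sum_of_support_subset (s := (Finset.range (m + m')).image (Finsupp.single i))]
  · rw [Finset.sum_image fun x _ y _ h => Finsupp.single_injective i h]
    refine Finset.sum_congr rfl fun k _ => ?_
    rw [coeff_oneVar, polyMonomial_single]
    simp
  · intro n hn
    rw [Function.mem_support, coeff_oneVar] at hn
    split_ifs at hn with h
    · rw [Finset.coe_image]
      refine ⟨n i, ?_, h.symm⟩
      have : polyMonomial a n p ≠ 0 := fun h0 => hn (by simp [h0])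
      have := hm.polyMonomial_eq_zero a n this i
      simp only [Finset.coe_range, Set.mem_Iio]
      omega
    · simp at hn

/-- In the coefficient of the product at n, only the decomposition of n into its pieces
`Finsupp.single i (n i)` contributes. -/
theorem prod_oneVar (F : Fin N → PowerSeries ℂ) :
    ∏ i, oneVar i (F i) =
      (fun n => ∏ i, PowerSeries.coeff (n i) (F i) : MvPowerSeries (Fin N) ℂ) := by
  classical
  refine MvPowerSeries.ext fun n => ?_
  rw [MvPowerSeries.coeff_prod]
  have hmem : (Finsupp.equivFunOnFinite.symm fun i => Finsupp.single i (n i) :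
      Fin N →₀ Fin N →₀ ℕ) ∈ Finset.univ.finsuppAntidiag n := by
    rw [Finset.mem_finsuppAntidiag]
    refine ⟨?_, by simp⟩
    ext j
    simp
  rw [Finset.sum_eq_single_of_mem _ hmem]
  · have : MvPowerSeries.coeff n
        (fun n => ∏ i, PowerSeries.coeff (n i) (F i) : MvPowerSeries (Fin N) ℂ) =
        ∏ i, PowerSeries.coeff (n i) (F i) := rfl
    rw [this]
    refine Finset.prod_congr rfl fun i _ => ?_
    rw [coeff_oneVar]
    simp
  · intro l hl hne
    rw [Finset.mem_finsuppAntidiag] at hl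
    by_contra h0
    apply hne
    have h1 : ∀ i, l i = Finsupp.single i (l i i) := by
      intro i
      by_contra h
      exact h0 (Finset.prod_eq_zero (Finset.mem_univ i) (by rw [coeff_oneVar, if_neg h]))
    refine Finsupp.ext fun i => ?_
    rw [h1 i]
    simp only [Finsupp.equivFunOnFinite_symm_apply_apply]
    congr 1
    rw [← hl.1, Finsupp.finsetSum_apply, Finset.sum_eq_single_of_mem i (Finset.mem_univ i)]
    intro j _ hj
    rw [h1 j]
    simp [hj]

/-- The factorisation into one-variable operators is what allows vectors to be adjoined to the list
one at a time. -/
theorem mvOp_toddSeries (a : Fin N → V) (c : Fin N → ℂ) :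
    mvOp a (toddSeries c) =
      ((List.finRange N).map fun i => serOp (a i) (toddFactor (c i))).prod := by
  have h : toddSeries c = ∏ i, oneVar i (toddFactor (c i)) := (prod_oneVar _).symm
  rw [h, Fin.prod_univ_def, map_list_prod, List.map_map]
  congr 1
  refine List.map_congr_left fun i _ => ?_
  exact mvOp_oneVar a i _

end SeveralVariables

/-! ### Operators on exponential polynomials, and their inverses. -/

section ExpPoly

variable {V : Type*} [NormedAddCommGroup V] [NormedSpace ℝ V] {N : ℕ}

/-- The subtracted term cancels the derivative of the exponential, so conjugation by e^φ carries the
whole calculus over to plain derivatives of polynomials. -/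
theorem shiftedDeriv_expPoly (φ : V →ₗ[ℝ] ℂ) (v : V) {U : Set V} (hU : IsOpen U) {f : V → ℂ}
    {p : PolyFun V} (hf : ∀ y ∈ U, f y = Complex.exp (φ y) * (p : V → ℂ) y) :
    ∀ y ∈ U, shiftedDeriv φ v f y = Complex.exp (φ y) * (polyDeriv v p : V → ℂ) y := by
  intro y hy
  have h1 : f =ᶠ[𝓝 y] fun y => Complex.exp (φ y) * (p : V → ℂ) y :=
    Filter.eventually_of_mem (hU.mem_nhds hy) hf
  have h2 : HasLineDerivAt ℝ (fun y => Complex.exp (φ y)) (Complex.exp (φ y) * φ v) y v := by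
    have h3 : HasDerivAt (fun t : ℝ => φ y + (t : ℂ) * φ v) (0 + 1 * φ v) 0 :=
      (hasDerivAt_const _ _).add ((Complex.ofRealCLM.hasDerivAt (x := 0)).mul_const (φ v))
    have h4 := h3.cexp
    have e : (fun t : ℝ => Complex.exp (φ (y + t • v))) =
        fun t : ℝ => Complex.exp (φ y + (t : ℂ) * φ v) := by
      funext t
      rw [map_add, map_smul, Complex.real_smul]
    unfold HasLineDerivAt
    rw [e]
    simpa using h4
  have h3 := (HasDerivAt.fun_mul h2 (hasLineDerivAt_polyDeriv v p y)).deriv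
  simp only [zero_smul, add_zero] at h3
  rw [shiftedDeriv, h1.lineDeriv_eq, hf y hy]
  have h4 : lineDeriv ℝ (fun y => Complex.exp (φ y) * (p : V → ℂ) y) y v = _ := h3
  rw [h4]
  ring

theorem shiftedDeriv_iterate_expPoly (φ : V →ₗ[ℝ] ℂ) (v : V) {U : Set V} (hU : IsOpen U)
    (k : ℕ) {f : V → ℂ} {p : PolyFun V} (hf : ∀ y ∈ U, f y = Complex.exp (φ y) * (p : V → ℂ) y) :
    ∀ y ∈ U, (shiftedDeriv φ v)^[k] f y =
      Complex.exp (φ y) * ((polyDeriv v ^ k) p : PolyFun V).1 y := by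
  induction k generalizing f p with
  | zero => simpa using hf
  | succ k ih =>
    intro y hy
    rw [Function.iterate_succ_apply, pow_succ, Module.End.mul_apply]
    exact ih (shiftedDeriv_expPoly φ v hU hf) y hy

theorem monomialOp_expPoly (φ : V →ₗ[ℝ] ℂ) (a : Fin N → V) (n : Fin N →₀ ℕ) {U : Set V}
    (hU : IsOpen U) {f : V → ℂ} {p : PolyFun V}
    (hf : ∀ y ∈ U, f y = Complex.exp (φ y) * (p : V → ℂ) y) :
    ∀ y ∈ U, monomialOp φ a n f y = Complex.exp (φ y) * (polyMonomial a n p : V → ℂ) y := by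
  unfold monomialOp polyMonomial
  generalize List.finRange N = l
  induction l with
  | nil => simpa using hf
  | cons i l ih =>
    intro y hy
    rw [List.foldr_cons, List.map_cons, List.prod_cons, Module.End.mul_apply]
    exact shiftedDeriv_iterate_expPoly φ (a i) hU (n i) ih y hy

theorem seriesOp_expPoly (φ : V →ₗ[ℝ] ℂ) (a : Fin N → V) (Q : MvPowerSeries (Fin N) ℂ) {U : Set V}
    (hU : IsOpen U) {f : V → ℂ} {p : PolyFun V}
    (hf : ∀ y ∈ U, f y = Complex.exp (φ y) * (p : V → ℂ) y) :
    ∀ y ∈ U, seriesOp φ a Q f y = Complex.exp (φ y) * (mvOp a Q p : V → ℂ) y := by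
  intro y hy
  have hfin := finite_polyMonomial_ne_zero a p
  have e : mvOp a Q p = ∑ n ∈ hfin.toFinset, MvPowerSeries.coeff n Q • polyMonomial a n p :=
    formalOp_eq_sum _ (finite_polyMonomial_ne_zero a) _ _ _ (by simp)
  rw [seriesOp, finsum_eq_sum_of_support_subset (s := hfin.toFinset), e]
  · simp only [monomialOp_expPoly φ a _ hU hf y hy]
    rw [AddSubmonoidClass.coe_finsetSum, Finset.sum_apply, Finset.mul_sum]
    refine Finset.sum_congr rfl fun n _ => ?_
    simp only [SetLike.val_smul, Pi.smul_apply, smul_eq_mul]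
    ring
  · intro n hn
    simp only [Set.Finite.coe_toFinset, Set.mem_ofPred_eq]
    intro h0
    apply hn
    simp only [monomialOp_expPoly φ a _ hU hf y hy, h0]
    simp

theorem constantCoeff_toddFactor_ne_zero (c : ℂ) :
    PowerSeries.coeff 0 (toddFactor c) ≠ 0 := by
  rw [PowerSeries.coeff_zero_eq_constantCoeff_apply, toddFactor]
  split_ifs with h
  · rw [PowerSeries.constantCoeff_inv, ← PowerSeries.coeff_zero_eq_constantCoeff_apply]
    simp [coeff_expNegSeries, PowerSeries.coeff_one]
  · rw [PowerSeries.constantCoeff_inv]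
    have : PowerSeries.constantCoeff expNegSeries = 1 := by
      rw [← PowerSeries.coeff_zero_eq_constantCoeff_apply, coeff_expNegSeries]; simp
    simp only [map_sub, map_one, map_mul, PowerSeries.constantCoeff_C, this, mul_one]
    rw [ne_eq, inv_eq_zero, sub_eq_zero]
    intro h'
    exact h (by rw [← inv_inv c, ← h', inv_one])

theorem toddSeries_mul_inv (c : Fin N → ℂ) :
    toddSeries c * (toddSeries c)⁻¹ = 1 := by
  refine MvPowerSeries.mul_inv_cancel _ ?_
  have : MvPowerSeries.constantCoeff (toddSeries c) = ∏ i, PowerSeries.coeff 0 (toddFactor (c i)) :=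
    rfl
  rw [this]
  exact Finset.prod_ne_zero_iff.2 fun i _ => constantCoeff_toddFactor_ne_zero (c i)

theorem IsLocallyExpPoly.exists_isOpen {φ : V →ₗ[ℝ] ℂ} {R : Set V} {f : V → ℂ}
    (hf : IsLocallyExpPoly φ R f) {x : V} (hx : x ∈ R) : ∃ p : PolyFun V, ∃ U, IsOpen U ∧ x ∈ U ∧
      ∀ y ∈ U, f y = Complex.exp (φ y) * (p : V → ℂ) y := by
  obtain ⟨p, hp, h⟩ := hf x hx
  obtain ⟨U, hU, hUo, hxU⟩ := mem_nhds_iff.1 h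
  exact ⟨⟨p, hp⟩, U, hUo, hxU, fun y hy => hU hy⟩

theorem IsLocallyExpPoly.eventually_monomialOp {φ : V →ₗ[ℝ] ℂ} {R : Set V} {f : V → ℂ}
    (hf : IsLocallyExpPoly φ R f) (a : Fin N → V) {x : V} (hx : x ∈ R) :
    ∀ᶠ n in Filter.cofinite, ∀ᶠ y in 𝓝 x, monomialOp φ a n f y = 0 := by
  obtain ⟨p, U, hU, hxU, h⟩ := hf.exists_isOpen hx
  refine (finite_polyMonomial_ne_zero a p).subset fun n hn h0 => hn ?_
  filter_upwards [hU.mem_nhds hxU] with y hy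
  rw [monomialOp_expPoly φ a n hU h y hy, h0]
  simp

theorem IsLocallyExpPoly.seriesOp {φ : V →ₗ[ℝ] ℂ} {R : Set V} {f : V → ℂ}
    (hf : IsLocallyExpPoly φ R f) (a : Fin N → V) (Q : MvPowerSeries (Fin N) ℂ) :
    IsLocallyExpPoly φ R (seriesOp φ a Q f) := by
  intro x hx
  obtain ⟨p, U, hU, hxU, h⟩ := hf.exists_isOpen hx
  refine ⟨_, (mvOp a Q p).2, ?_⟩
  filter_upwards [hU.mem_nhds hxU] with y hy
  exact seriesOp_expPoly φ a Q hU h y hy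

theorem IsLocallyExpPoly.seriesOp_seriesOp {φ : V →ₗ[ℝ] ℂ} {R : Set V} {f : V → ℂ}
    (hf : IsLocallyExpPoly φ R f) (a : Fin N → V) {Q Q' : MvPowerSeries (Fin N) ℂ}
    (hQ : Q * Q' = 1) {x : V} (hx : x ∈ R) :
    PartitionSpline.seriesOp φ a Q (PartitionSpline.seriesOp φ a Q' f) x = f x := by
  obtain ⟨p, U, hU, hxU, h⟩ := hf.exists_isOpen hx
  rw [seriesOp_expPoly φ a Q hU (seriesOp_expPoly φ a Q' hU h) x hxU, ← Module.End.mul_apply,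
    ← map_mul, hQ, map_one, Module.End.one_apply, h x hxU]

end ExpPoly

/-! ### The image of Lebesgue measure on the orthant. -/

section ConeMeasure

variable {V : Type*} [NormedAddCommGroup V] [NormedSpace ℝ V]
  {κ : Type*} [Fintype κ]

/-- The closed positive orthant. -/
def orthant (κ : Type*) : Set (κ → ℝ) := {t | ∀ i, 0 ≤ t i}

theorem isClosed_orthant {κ : Type*} : IsClosed (orthant κ) := by
  have : orthant κ = ⋂ i, {t | 0 ≤ t i} := by ext t; simp [orthant]
  rw [this]
  exact isClosed_iInter fun i => isClosed_le continuous_const (continuous_apply i)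

/-- The map `t ↦ ∑ i, t i • a i`. -/
def comb (a : κ → V) (t : κ → ℝ) : V := ∑ i, t i • a i

theorem continuous_comb (a : κ → V) : Continuous (comb a) :=
  continuous_finsetSum _ fun i _ => (continuous_apply i).smul continuous_const

theorem comb_mem_cone (a : κ → V) {t : κ → ℝ} (ht : t ∈ orthant κ) :
    comb a t ∈ cone a Set.univ :=
  ⟨t, ht, fun i hi => absurd (Set.mem_univ i) hi, rfl⟩

theorem cone_univ_eq_image (a : κ → V) : cone a Set.univ = comb a '' orthant κ := by
  ext v
  constructor
  · rintro ⟨t, ht, -, rfl⟩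
    exact ⟨t, ht, rfl⟩
  · rintro ⟨t, ht, rfl⟩
    exact comb_mem_cone a ht

/-- Properness on the orthant: if ℓ ≤ C on K, then t i * ℓ (a i) ≤ ℓ (comb a t) ≤ C, because all the
other terms are non-negative. -/
theorem isCompact_orthant_inter_preimage [FiniteDimensional ℝ V] {a : κ → V} (ℓ : V →ₗ[ℝ] ℝ)
    (hℓ : ∀ i, 0 < ℓ (a i)) {K : Set V} (hK : IsCompact K) :
    IsCompact (orthant κ ∩ comb a ⁻¹' K) := by
  have hcont : Continuous ℓ := ℓ.continuous_of_finiteDimensional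
  obtain ⟨C, hC⟩ := (hK.image hcont).bddAbove
  refine (isCompact_univ_pi fun i : κ => isCompact_Icc (a := (0 : ℝ)) (b := C / ℓ (a i))).of_isClosed_subset
    (isClosed_orthant.inter (hK.isClosed.preimage (continuous_comb a))) ?_
  rintro t ⟨ht, htK⟩ i -
  refine ⟨ht i, ?_⟩
  rw [le_div_iff₀ (hℓ i)]
  have h1 : ℓ (comb a t) ≤ C := hC ⟨_, htK, rfl⟩
  rw [comb, map_sum] at h1
  simp only [map_smul, smul_eq_mul] at h1
  exact (Finset.single_le_sum (f := fun i => t i * ℓ (a i))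
    (fun j _ => mul_nonneg (ht j) (hℓ j).le) (Finset.mem_univ i)).trans h1

theorem isClosed_cone_univ [FiniteDimensional ℝ V] {a : κ → V} (ℓ : V →ₗ[ℝ] ℝ)
    (hℓ : ∀ i, 0 < ℓ (a i)) : IsClosed (cone a Set.univ) := by
  rw [cone_univ_eq_image, isClosed_iff_nhds]
  intro x hx
  have hK : IsCompact (Metric.closedBall x 1) := isCompact_closedBall x 1
  have hc : IsClosed (comb a '' (orthant κ ∩ comb a ⁻¹' Metric.closedBall x 1)) :=
    ((isCompact_orthant_inter_preimage ℓ hℓ hK).image (continuous_comb a)).isClosed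
  have : x ∈ comb a '' (orthant κ ∩ comb a ⁻¹' Metric.closedBall x 1) := by
    rw [← hc.closure_eq, mem_closure_iff_nhds]
    intro U hU
    obtain ⟨y, ⟨hyU, hyB⟩, t, ht, rfl⟩ :=
      hx _ (Filter.inter_mem hU (Metric.closedBall_mem_nhds x one_pos))
    exact ⟨_, hyU, t, ⟨ht, hyB⟩, rfl⟩
  obtain ⟨t, ht, rfl⟩ := this
  exact ⟨t, ht.1, rfl⟩

variable [MeasurableSpace V] [BorelSpace V]

/-- The image of the Lebesgue measure of the positive orthant under `t ↦ ∑ i, t i • a i`. -/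
def coneMeasure (a : κ → V) : Measure V := (volume.restrict (orthant κ)).map (comb a)

instance (a : κ → V) : SFinite (coneMeasure a) := by
  unfold coneMeasure; infer_instance

theorem measurable_comb (a : κ → V) : Measurable (comb a) := (continuous_comb a).measurable

theorem measurableSet_orthant : MeasurableSet (orthant κ) := isClosed_orthant.measurableSet

theorem coneMeasure_comp_equiv {κ' : Type*} [Fintype κ'] (e : κ ≃ κ') (a : κ' → V) :
    coneMeasure (a ∘ e) = coneMeasure a := by
  have h := (volume_measurePreserving_piCongrLeft (fun _ : κ' => ℝ) e)
  have h2 := h.restrict_preimage (measurableSet_orthant (κ := κ'))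
  have e1 : (MeasurableEquiv.piCongrLeft (fun _ : κ' => ℝ) e) ⁻¹' orthant κ' = orthant κ := by
    ext t
    simp only [orthant, Set.mem_preimage, Set.mem_ofPred_eq]
    constructor
    · intro ht i
      have := ht (e i)
      simpa [MeasurableEquiv.coe_piCongrLeft] using this
    · intro ht i
      obtain ⟨i, rfl⟩ := e.surjective i
      simpa [MeasurableEquiv.coe_piCongrLeft] using ht i
  rw [e1] at h2
  rw [coneMeasure, coneMeasure, ← h2.map_eq,
    Measure.map_map (measurable_comb a) (MeasurableEquiv.measurable _)]
  congr 1
  funext t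
  simp only [comb, Function.comp]
  rw [← e.sum_comp]
  refine Finset.sum_congr rfl fun i _ => ?_
  simp [MeasurableEquiv.coe_piCongrLeft]

theorem ae_mem_cone [FiniteDimensional ℝ V] {a : κ → V} (ℓ : V →ₗ[ℝ] ℝ)
    (hℓ : ∀ i, 0 < ℓ (a i)) : ∀ᵐ x ∂coneMeasure a, x ∈ cone a Set.univ := by
  refine (ae_map_iff (p := fun x => x ∈ cone a Set.univ) (measurable_comb a).aemeasurable
    (isClosed_cone_univ ℓ hℓ).measurableSet).2 ?_
  exact (ae_restrict_mem measurableSet_orthant).mono fun t ht => comb_mem_cone a ht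

theorem isFiniteMeasureOnCompacts_coneMeasure [FiniteDimensional ℝ V] {a : κ → V} (ℓ : V →ₗ[ℝ] ℝ)
    (hℓ : ∀ i, 0 < ℓ (a i)) : IsFiniteMeasureOnCompacts (coneMeasure a) := by
  refine ⟨fun K hK => ?_⟩
  rw [coneMeasure, Measure.map_apply (measurable_comb a) hK.measurableSet,
    Measure.restrict_apply' measurableSet_orthant, Set.inter_comm]
  exact (isCompact_orthant_inter_preimage ℓ hℓ hK).measure_lt_top

theorem isLocallyFiniteMeasure_coneMeasure [FiniteDimensional ℝ V] {a : κ → V} (ℓ : V →ₗ[ℝ] ℝ)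
    (hℓ : ∀ i, 0 < ℓ (a i)) : IsLocallyFiniteMeasure (coneMeasure a) := by
  have := isFiniteMeasureOnCompacts_coneMeasure ℓ hℓ
  exact isLocallyFiniteMeasure_of_isFiniteMeasureOnCompacts

theorem comb_succAbove {n : ℕ} (a : Fin (n + 1) → V) (i : Fin (n + 1)) (t : Fin (n + 1) → ℝ) :
    comb a t = t i • a i + comb (a ∘ i.succAbove) (i.removeNth t) := by
  rw [comb, Fin.sum_univ_succAbove _ i]
  rfl

theorem map_orthant_eq_prod {n : ℕ} (a : Fin (n + 1) → V) (i : Fin (n + 1)) :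
    (volume.restrict (orthant (Fin (n + 1)))).map
      (fun t => (t i, comb (a ∘ i.succAbove) (i.removeNth t))) =
    (volume.restrict (Set.Ici (0 : ℝ))).prod (coneMeasure (a ∘ i.succAbove)) := by
  have h := volume_preserving_piFinSuccAbove (fun _ : Fin (n + 1) => ℝ) i
  have h2 := h.restrict_preimage
    (measurableSet_Ici (a := (0 : ℝ)) |>.prod (measurableSet_orthant (κ := Fin n)))
  have e1 : (MeasurableEquiv.piFinSuccAbove (fun _ : Fin (n + 1) => ℝ) i) ⁻¹'
      (Set.Ici (0 : ℝ) ×ˢ orthant (Fin n)) = orthant (Fin (n + 1)) := by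
    ext t
    simp only [orthant, Set.mem_preimage, Set.mem_ofPred_eq, Set.mem_prod, Set.mem_Ici]
    rw [Fin.forall_iff_succAbove i]
    rfl
  rw [e1] at h2
  have h3 : (volume.restrict (Set.Ici (0 : ℝ))).prod (coneMeasure (a ∘ i.succAbove)) =
      ((volume.restrict (Set.Ici (0 : ℝ))).prod (volume.restrict (orthant (Fin n)))).map
        (Prod.map id (comb (a ∘ i.succAbove))) := by
    rw [← Measure.map_prod_map _ _ measurable_id (measurable_comb _), Measure.map_id, coneMeasure]
  have h4 := h2.map_eq
  rw [h3, Measure.prod_restrict, ← Measure.volume_eq_prod, ← h4,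
    Measure.map_map (measurable_id.prodMap (measurable_comb _)) (MeasurableEquiv.measurable _)]
  rfl

theorem measurable_removeNth_comb {n : ℕ} (a : Fin (n + 1) → V) (i : Fin (n + 1)) :
    Measurable fun t : Fin (n + 1) → ℝ => (t i, comb (a ∘ i.succAbove) (i.removeNth t)) :=
  (measurable_pi_apply i).prodMk ((measurable_comb _).comp
    (measurable_pi_lambda _ fun j => measurable_pi_apply (i.succAbove j)))

variable [FiniteDimensional ℝ V]

theorem measurable_smul_add (v : V) : Measurable fun sy : ℝ × V => sy.1 • v + sy.2 := by
  have : Continuous fun sy : ℝ × V => sy.1 • v + sy.2 := by fun_prop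
  exact Continuous.measurable ‹_›

theorem coneMeasure_eq_map_prod {n : ℕ} (a : Fin (n + 1) → V) (i : Fin (n + 1)) :
    coneMeasure a = ((volume.restrict (Set.Ici (0 : ℝ))).prod
      (coneMeasure (a ∘ i.succAbove))).map fun sy => sy.1 • a i + sy.2 := by
  rw [← map_orthant_eq_prod, Measure.map_map (measurable_smul_add _) (measurable_removeNth_comb a i),
    coneMeasure]
  congr 1
  exact funext fun t => comb_succAbove a i t

theorem integrable_coneMeasure {E : Type*} [NormedAddCommGroup E] {a : κ → V} (ℓ : V →ₗ[ℝ] ℝ)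
    (hℓ : ∀ i, 0 < ℓ (a i)) {f : V → E} (hf : Continuous f) (hc : HasCompactSupport f) :
    Integrable f (coneMeasure a) := by
  have := isFiniteMeasureOnCompacts_coneMeasure ℓ hℓ
  exact hf.integrable_of_hasCompactSupport hc

theorem hasCompactSupport_ray {E : Type*} [Zero E] {f : V → E} (hc : HasCompactSupport f) {v : V}
    (hv : v ≠ 0) (y : V) : HasCompactSupport fun s : ℝ => f (s • v + y) :=
  hc.comp_isClosedEmbedding
    ((Homeomorph.addRight y).isClosedEmbedding.comp (isClosedEmbedding_smul_left hv))

/-- Fundamental theorem of calculus along a ray, which leaves every compact set because v ≠ 0. -/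
theorem integral_ray_fderiv {f : V → ℝ} (hf : ContDiff ℝ 1 f) (hc : HasCompactSupport f) {v : V}
    (hv : v ≠ 0) (y : V) :
    ∫ s in Set.Ici (0 : ℝ), fderiv ℝ f (s • v + y) v = - f y := by
  have hd : ∀ s : ℝ, HasDerivAt (fun s : ℝ => f (s • v + y)) (fderiv ℝ f (s • v + y) v) s := by
    intro s
    have h1 : HasFDerivAt f (fderiv ℝ f (s • v + y)) (s • v + y) :=
      (hf.differentiable one_ne_zero _).hasFDerivAt
    have h2 : HasDerivAt (fun s : ℝ => s • v + y) ((1 : ℝ) • v) s :=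
      ((hasDerivAt_id s).smul_const v).add_const y
    rw [one_smul] at h2
    exact h1.comp_hasDerivAt s h2
  have hc1 := hasCompactSupport_ray hc hv y
  have hcd : HasCompactSupport fun y => fderiv ℝ f y v :=
    (hc.fderiv ℝ).comp_left (g := fun L : V →L[ℝ] ℝ => L v) (by simp)
  have hcont : Continuous fun y => fderiv ℝ f y v :=
    (hf.continuous_fderiv one_ne_zero).clm_apply continuous_const
  have hint : Integrable fun s : ℝ => fderiv ℝ f (s • v + y) v :=
    Continuous.integrable_of_hasCompactSupport (hcont.comp (by fun_prop))
      (hasCompactSupport_ray hcd hv y)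
  rw [integral_Ici_eq_integral_Ioi, integral_Ioi_of_hasDerivAt_of_tendsto' (fun s _ => hd s)
    hint.integrableOn (m := 0)]
  · simp
  · exact (hc1.is_zero_at_infty).mono_left atTop_le_cocompact

/-- Integration by parts along the generator `a i` of the cone. -/
theorem integral_fderiv_coneMeasure {n : ℕ} {a : Fin (n + 1) → V} (ℓ : V →ₗ[ℝ] ℝ)
    (hℓ : ∀ i, 0 < ℓ (a i)) (i : Fin (n + 1)) {f : V → ℝ} (hf : ContDiff ℝ 1 f)
    (hc : HasCompactSupport f) :
    ∫ y, fderiv ℝ f y (a i) ∂coneMeasure a = - ∫ y, f y ∂coneMeasure (a ∘ i.succAbove) := by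
  have hcd : HasCompactSupport fun y => fderiv ℝ f y (a i) :=
    (hc.fderiv ℝ).comp_left (g := fun L : V →L[ℝ] ℝ => L (a i)) (by simp)
  have hcont : Continuous fun y => fderiv ℝ f y (a i) :=
    (hf.continuous_fderiv one_ne_zero).clm_apply continuous_const
  have hint := integrable_coneMeasure ℓ hℓ hcont hcd
  have hne : a i ≠ 0 := fun h => (hℓ i).ne' (by rw [h, map_zero])
  rw [coneMeasure_eq_map_prod a i] at hint ⊢
  rw [integrable_map_measure hcont.aestronglyMeasurable (measurable_smul_add _).aemeasurable] at hint
  rw [integral_map (measurable_smul_add _).aemeasurable hcont.aestronglyMeasurable]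
  refine (integral_prod_symm _ hint).trans ?_
  rw [← integral_neg]
  refine integral_congr_ae (Eventually.of_forall fun y => ?_)
  exact integral_ray_fderiv hf hc hne y

/-- Substitute the sum s + r for r and exchange the integrals: for a given sum r, the variable s
runs over [0, r], whose length is the weight. -/
theorem lintegral_Ici_Ici (h : ℝ → ENNReal) (hh : Measurable h) :
    ∫⁻ s in Set.Ici (0 : ℝ), ∫⁻ r in Set.Ici (0 : ℝ), h (s + r) =
      ∫⁻ r in Set.Ici (0 : ℝ), ENNReal.ofReal r * h r := by
  have e1 : ∀ s : ℝ, ∫⁻ r in Set.Ici (0 : ℝ), h (s + r) =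
      ∫⁻ r, (Set.Ici s).indicator h r := by
    intro s
    rw [← lintegral_add_left_eq_self ((Set.Ici s).indicator h) s,
      ← lintegral_indicator measurableSet_Ici]
    refine lintegral_congr fun r => ?_
    simp [Set.indicator_apply]
  have e2 : ∀ s : ℝ, (Set.Ici (0 : ℝ)).indicator (fun s => ∫⁻ r, (Set.Ici s).indicator h r) s =
      ∫⁻ r, ({sr : ℝ × ℝ | 0 ≤ sr.1 ∧ sr.1 ≤ sr.2}.indicator (fun sr => h sr.2)) (s, r) := by
    intro s
    by_cases hs : 0 ≤ s
    · rw [Set.indicator_of_mem (Set.mem_Ici.2 hs)]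
      refine lintegral_congr fun r => ?_
      simp [Set.indicator_apply, hs]
    · rw [Set.indicator_of_notMem (by simpa using hs)]
      simp [hs]
  have hmeas : MeasurableSet {sr : ℝ × ℝ | 0 ≤ sr.1 ∧ sr.1 ≤ sr.2} :=
    (measurableSet_le measurable_const measurable_fst).inter
      (measurableSet_le measurable_fst measurable_snd)
  rw [← lintegral_indicator measurableSet_Ici]
  simp_rw [e1, e2]
  have hm2 : Measurable (Function.uncurry fun s r : ℝ =>
      {sr : ℝ × ℝ | 0 ≤ sr.1 ∧ sr.1 ≤ sr.2}.indicator (fun sr => h sr.2) (s, r)) :=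
    (hh.comp measurable_snd).indicator hmeas
  rw [lintegral_lintegral_swap hm2.aemeasurable, ← lintegral_indicator measurableSet_Ici]
  refine lintegral_congr fun r => ?_
  have e3 : ∀ s : ℝ, {sr : ℝ × ℝ | 0 ≤ sr.1 ∧ sr.1 ≤ sr.2}.indicator (fun sr => h sr.2) (s, r) =
      (Set.Icc 0 r).indicator (fun _ => h r) s := by
    intro s
    simp [Set.indicator_apply]
  simp_rw [e3]
  rw [lintegral_indicator measurableSet_Icc, lintegral_const, Measure.restrict_apply_univ,
    Real.volume_Icc, sub_zero, mul_comm]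
  by_cases hr : 0 ≤ r
  · rw [Set.indicator_of_mem (Set.mem_Ici.2 hr)]
  · rw [Set.indicator_of_notMem (by simpa using hr), ENNReal.ofReal_of_nonpos (not_le.1 hr).le,
      zero_mul]

/-- Repeating the generator `a i` multiplies the density of the measure by the coordinate `t i`. -/
theorem coneMeasure_cons_self {n : ℕ} (a : Fin n → V) (i : Fin n) :
    coneMeasure (Fin.cons (a i) a : Fin (n + 1) → V) =
      ((volume.restrict (orthant (Fin n))).withDensity fun t => ENNReal.ofReal (t i)).map
        (comb a) := by
  obtain ⟨n, rfl⟩ : ∃ m, n = m + 1 := ⟨n - 1, by have := i.pos; omega⟩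
  refine Measure.ext_of_lintegral _ fun f hf => ?_
  have h0 : (Fin.cons (a i) a : Fin (n + 2) → V) ∘ Fin.succAbove 0 = a := by
    funext j; simp
  set c' := coneMeasure (a ∘ i.succAbove)
  have hf1 : Measurable fun sy : ℝ × V => f (sy.1 • a i + sy.2) := hf.comp (measurable_smul_add _)
  have hf2 : Measurable fun sry : ℝ × ℝ × V => f (sry.1 • a i + (sry.2.1 • a i + sry.2.2)) :=
    hf1.comp (measurable_fst.prodMk ((measurable_smul_add (a i)).comp measurable_snd))
  calc ∫⁻ y, f y ∂coneMeasure (Fin.cons (a i) a : Fin (n + 2) → V)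
      = ∫⁻ s in Set.Ici (0 : ℝ), ∫⁻ y, f (s • a i + y) ∂coneMeasure a := by
        rw [coneMeasure_eq_map_prod _ 0, h0, lintegral_map hf (measurable_smul_add _)]
        exact lintegral_prod _ hf1.aemeasurable
    _ = ∫⁻ s in Set.Ici (0 : ℝ), ∫⁻ y, (∫⁻ r in Set.Ici (0 : ℝ),
          f (s • a i + (r • a i + y))) ∂c' := by
        refine lintegral_congr fun s => ?_
        have hfs : Measurable fun ry : ℝ × V => f (s • a i + (ry.1 • a i + ry.2)) :=
          hf2.comp (measurable_const.prodMk measurable_id)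
        rw [coneMeasure_eq_map_prod a i, lintegral_map _ (measurable_smul_add _),
          lintegral_prod_symm _ hfs.aemeasurable]
        exact hf1.comp (measurable_const.prodMk measurable_id)
    _ = ∫⁻ y, (∫⁻ s in Set.Ici (0 : ℝ), ∫⁻ r in Set.Ici (0 : ℝ),
          f ((s + r) • a i + y)) ∂c' := by
        rw [lintegral_lintegral_swap]
        · refine lintegral_congr fun y => lintegral_congr fun s => lintegral_congr fun r => ?_
          rw [add_smul, add_assoc]
        · refine Measurable.aemeasurable ?_
          refine Measurable.lintegral_prod_right' (f := fun syr : (ℝ × V) × ℝ =>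
            f (syr.1.1 • a i + (syr.2 • a i + syr.1.2))) ?_
          exact hf2.comp ((measurable_fst.comp measurable_fst).prodMk
            (measurable_snd.prodMk (measurable_snd.comp measurable_fst)))
    _ = ∫⁻ y, (∫⁻ r in Set.Ici (0 : ℝ), ENNReal.ofReal r * f (r • a i + y)) ∂c' := by
        refine lintegral_congr fun y => ?_
        exact lintegral_Ici_Ici (fun r => f (r • a i + y))
          (hf1.comp (measurable_id.prodMk measurable_const))
    _ = ∫⁻ ry, ENNReal.ofReal ry.1 * f (ry.1 • a i + ry.2)
          ∂((volume.restrict (Set.Ici (0 : ℝ))).prod c') := by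
        rw [lintegral_prod_symm _ ((by fun_prop : Measurable fun ry : ℝ × V =>
          ENNReal.ofReal ry.1 * f (ry.1 • a i + ry.2)).aemeasurable)]
    _ = ∫⁻ t in orthant (Fin (n + 1)), ENNReal.ofReal (t i) * f (comb a t) := by
        rw [← map_orthant_eq_prod, lintegral_map ((by fun_prop : Measurable fun ry : ℝ × V =>
          ENNReal.ofReal ry.1 * f (ry.1 • a i + ry.2))) (measurable_removeNth_comb a i)]
        refine lintegral_congr fun t => ?_
        rw [comb_succAbove a i]
    _ = _ := by
        rw [lintegral_map hf (measurable_comb a)]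
        exact (lintegral_withDensity_eq_lintegral_mul _
          (by fun_prop) (hf.comp (measurable_comb a))).symm

theorem integral_coneMeasure_cons_self {n : ℕ} (a : Fin n → V) (i : Fin n) {f : V → ℝ}
    (hf : Continuous f) : ∫ y, f y ∂coneMeasure (Fin.cons (a i) a : Fin (n + 1) → V) =
      ∫ t in orthant (Fin n), t i * f (comb a t) := by
  rw [coneMeasure_cons_self, integral_map (measurable_comb a).aemeasurable hf.aestronglyMeasurable]
  have : (fun t : Fin n → ℝ => ENNReal.ofReal (t i)) = fun t => ((t i).toNNReal : ENNReal) := rfl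
  rw [this, integral_withDensity_eq_integral_smul (measurable_pi_apply i).real_toNNReal]
  refine setIntegral_congr_fun measurableSet_orthant fun t ht => ?_
  change (t i).toNNReal • f (comb a t) = _
  rw [NNReal.smul_def, Real.coe_toNNReal _ (ht i), smul_eq_mul]

end ConeMeasure

/-! ### Continuity and the identity principle for polynomial functions. -/

section PolyContinuity

variable {V : Type*} [NormedAddCommGroup V] [NormedSpace ℝ V]

theorem continuous_polyFun [FiniteDimensional ℝ V] (p : PolyFun V) :
    Continuous (p : V → ℂ) := by
  induction p using PolyFun.induction with
  | hlin u => exact Complex.continuous_ofReal.comp u.continuous_of_finiteDimensional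
  | hconst c => exact continuous_const
  | hadd p q hp hq => exact hp.add hq
  | hmul p q hp hq => exact hp.mul hq

theorem polyDeriv_eqOn_zero {U : Set V} (hU : IsOpen U) {p : PolyFun V}
    (hp : ∀ y ∈ U, (p : V → ℂ) y = 0) (v : V) : ∀ y ∈ U, (polyDeriv v p : V → ℂ) y = 0 := by
  intro y hy
  have h : (p : V → ℂ) =ᶠ[𝓝 y] fun _ => 0 := Filter.eventually_of_mem (hU.mem_nhds hy) hp
  rw [polyDeriv_apply, h.lineDeriv_eq]
  exact (hasDerivAt_const (0 : ℝ) (0 : ℂ)).deriv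

/-- All iterated derivatives vanish on U, and Taylor's formula from a point of U reaches every point
of V. -/
theorem polyFun_eq_zero_of_eqOn {U : Set V} (hU : IsOpen U) (hne : U.Nonempty) {p : PolyFun V}
    (hp : ∀ y ∈ U, (p : V → ℂ) y = 0) : p = 0 := by
  obtain ⟨x, hx⟩ := hne
  refine Subtype.ext <| funext fun y => ?_
  obtain ⟨n, hn⟩ := exists_polyDeriv_pow_eq_zero (y - x) p
  have h := polyFun_taylor (y - x) p n (hn n le_rfl) x 1
  rw [one_smul, add_sub_cancel] at h
  rw [h]
  have hk : ∀ k : ℕ, ∀ z ∈ U, ((polyDeriv (y - x) ^ k) p : PolyFun V).1 z = 0 := by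
    intro k
    induction k with
    | zero => simpa using hp
    | succ k ih =>
      rw [pow_succ', Module.End.mul_apply]
      exact polyDeriv_eqOn_zero hU ih _
  exact Finset.sum_eq_zero fun k _ => by rw [hk k x hx, mul_zero]

end PolyContinuity

/-! ### Moment identities and homogeneity of the cone measure. -/

section Moments

variable {V : Type*} [NormedAddCommGroup V] [NormedSpace ℝ V] [FiniteDimensional ℝ V]
  [MeasurableSpace V] [BorelSpace V]

theorem integrableOn_orthant {n : ℕ} {a : Fin n → V} (ℓ : V →ₗ[ℝ] ℝ)
    (hℓ : ∀ i, 0 < ℓ (a i)) (g : (Fin n → ℝ) → ℝ) (hg : Continuous g) {K : Set V}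
    (hK : IsCompact K) (h0 : ∀ t, comb a t ∉ K → g t = 0) :
    IntegrableOn g (orthant (Fin n)) := by
  have hc := isCompact_orthant_inter_preimage ℓ hℓ hK
  have h1 : IntegrableOn g (orthant (Fin n) ∩ comb a ⁻¹' K) := hg.continuousOn.integrableOn_compact hc
  refine h1.of_forall_sdiff_eq_zero measurableSet_orthant fun t ht => h0 t fun hK => ?_
  exact ht.2 ⟨ht.1, hK⟩

/-- Multiplication of the cone measure by a linear form. -/
theorem integral_linear_mul_coneMeasure {n : ℕ} {a : Fin n → V} (ℓ : V →ₗ[ℝ] ℝ)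
    (hℓ : ∀ i, 0 < ℓ (a i)) (u : V →ₗ[ℝ] ℝ) {f : V → ℝ} (hf : Continuous f)
    (hc : HasCompactSupport f) : ∫ y, u y * f y ∂coneMeasure a =
      ∑ i, u (a i) * ∫ y, f y ∂coneMeasure (Fin.cons (a i) a : Fin (n + 1) → V) := by
  have hu : Continuous u := u.continuous_of_finiteDimensional
  simp_rw [integral_coneMeasure_cons_self a _ hf, ← integral_const_mul]
  rw [← integral_finsetSum]
  · rw [coneMeasure, integral_map (measurable_comb a).aemeasurable
      (f := fun y => u y * f y) (hu.mul hf).aestronglyMeasurable]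
    refine integral_congr_ae (Eventually.of_forall fun t => ?_)
    simp only [comb, map_sum, map_smul, smul_eq_mul, Finset.sum_mul]
    exact Finset.sum_congr rfl fun i _ => by ring
  · intro i _
    refine integrableOn_orthant ℓ hℓ _ ?_ hc ?_
    · exact continuous_const.mul ((continuous_apply i).mul (hf.comp (continuous_comb a)))
    · intro t ht
      rw [image_eq_zero_of_notMem_tsupport ht]
      ring

theorem pos_cons {n : ℕ} {a : Fin n → V} {ℓ : V →ₗ[ℝ] ℝ} (hℓ : ∀ i, 0 < ℓ (a i)) {v : V}
    (hv : 0 < ℓ v) (j : Fin (n + 1)) : 0 < ℓ ((Fin.cons v a : Fin (n + 1) → V) j) := by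
  refine Fin.cases ?_ (fun i => ?_) j
  · simpa using hv
  · simpa using hℓ i

/-- The Euler identity expressing the homogeneity of the cone measure. -/
theorem integral_euler_coneMeasure {n : ℕ} {a : Fin n → V} (ℓ : V →ₗ[ℝ] ℝ)
    (hℓ : ∀ i, 0 < ℓ (a i)) {f : V → ℝ} (hf : ContDiff ℝ 1 f)
    (hc : HasCompactSupport f) : ∫ y, fderiv ℝ f y y ∂coneMeasure a =
      - (n * ∫ y, f y ∂coneMeasure a) := by
  have hcd : ∀ v, HasCompactSupport fun y => fderiv ℝ f y v := fun v =>
    (hc.fderiv ℝ).comp_left (g := fun L : V →L[ℝ] ℝ => L v) (by simp)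
  have hcont : ∀ v, Continuous fun y => fderiv ℝ f y v := fun v =>
    (hf.continuous_fderiv one_ne_zero).clm_apply continuous_const
  have hcont2 : Continuous fun y => fderiv ℝ f y y :=
    (hf.continuous_fderiv one_ne_zero).clm_apply continuous_id
  -- The weight t i amounts to a second copy of `a i` in the list, and integration by parts along `a
  -- i` removes that copy again.
  have h1 : ∀ i, ∫ t in orthant (Fin n), t i * fderiv ℝ f (comb a t) (a i) =
      - ∫ y, f y ∂coneMeasure a := by
    intro i
    rw [← integral_coneMeasure_cons_self a i (hcont (a i))]
    have := integral_fderiv_coneMeasure ℓ (pos_cons hℓ (hℓ i)) 0 hf hc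
    have h0 : (Fin.cons (a i) a : Fin (n + 1) → V) ∘ Fin.succAbove 0 = a := by
      funext j; simp
    rwa [h0, Fin.cons_zero] at this
  calc ∫ y, fderiv ℝ f y y ∂coneMeasure a
      = ∫ t in orthant (Fin n), ∑ i, t i * fderiv ℝ f (comb a t) (a i) := by
        rw [coneMeasure, integral_map (measurable_comb a).aemeasurable hcont2.aestronglyMeasurable]
        refine integral_congr_ae (Eventually.of_forall fun t => ?_)
        change fderiv ℝ f (comb a t) (comb a t) = _
        conv_lhs => rw [show comb a t = ∑ i, t i • a i from rfl]
        rw [map_sum]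
        simp only [map_smul, smul_eq_mul]
        rfl
    _ = ∑ i, ∫ t in orthant (Fin n), t i * fderiv ℝ f (comb a t) (a i) := by
        refine integral_finsetSum _ fun i _ => integrableOn_orthant ℓ hℓ _ ?_ (hcd (a i)) ?_
        · exact (continuous_apply i).mul ((hcont (a i)).comp (continuous_comb a))
        · intro t ht
          rw [image_eq_zero_of_notMem_tsupport (f := fun y => fderiv ℝ f y (a i)) ht, mul_zero]
    _ = _ := by
        simp only [h1]
        simp

/-- The recursion expressing the cone measure through the measures with one generator less. -/
theorem integral_recursion_coneMeasure {n : ℕ} {a : Fin (n + 1) → V} (ℓ : V →ₗ[ℝ] ℝ)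
    (hℓ : ∀ i, 0 < ℓ (a i)) {ι : Type*} [Fintype ι] (b : Module.Basis ι ℝ V) (j : ι → Fin (n + 1))
    (hb : ∀ k, b k = a (j k)) {f : V → ℝ} (hf : ContDiff ℝ 1 f) (hc : HasCompactSupport f) :
    ((n + 1 : ℝ) - Fintype.card ι) * ∫ y, f y ∂coneMeasure a =
      ∑ k, ∫ y, b.coord k y * f y ∂coneMeasure (a ∘ (j k).succAbove) := by
  have hcont : ∀ k, Continuous (b.coord k) := fun k => (b.coord k).continuous_of_finiteDimensional
  have hsm : ∀ k, ContDiff ℝ 1 fun y => b.coord k y * f y := fun k =>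
    ((LinearMap.toContinuousLinearMap (b.coord k)).contDiff).mul hf
  have hcs : ∀ k, HasCompactSupport fun y => b.coord k y * f y := fun k => hc.mul_left
  have h1 : ∀ k y, fderiv ℝ (fun y => b.coord k y * f y) y (a (j k)) =
      b.coord k y * fderiv ℝ f y (a (j k)) + f y := by
    intro k y
    have h2 : HasFDerivAt (fun y => b.coord k y * f y) _ y :=
      ((LinearMap.toContinuousLinearMap (b.coord k)).hasFDerivAt (x := y)).mul
        (hf.differentiable one_ne_zero y).hasFDerivAt
    rw [h2.fderiv]
    have h3 : b.coord k (a (j k)) = 1 := by rw [← hb]; simp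
    simp only [add_apply, smul_apply, smul_eq_mul,
      LinearMap.coe_toContinuousLinearMap', h3, mul_one]
  have h2 : ∀ k, ∫ y, (b.coord k y * fderiv ℝ f y (a (j k)) + f y) ∂coneMeasure a =
      - ∫ y, b.coord k y * f y ∂coneMeasure (a ∘ (j k).succAbove) := by
    intro k
    rw [← integral_fderiv_coneMeasure ℓ hℓ (j k) (hsm k) (hcs k)]
    exact integral_congr_ae (Eventually.of_forall fun y => (h1 k y).symm)
  have hif := integrable_coneMeasure ℓ hℓ hf.continuous hc
  have hid : ∀ k, Integrable (fun y => b.coord k y * fderiv ℝ f y (a (j k))) (coneMeasure a) := by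
    intro k
    refine integrable_coneMeasure ℓ hℓ ((hcont k).mul
      ((hf.continuous_fderiv one_ne_zero).clm_apply continuous_const)) ?_
    exact HasCompactSupport.mul_left
      ((hc.fderiv ℝ).comp_left (g := fun L : V →L[ℝ] ℝ => L (a (j k))) (by simp))
  -- Expanding only the direction y in the basis b, rather than in all generators, splits the Euler
  -- derivative into one term per basis vector. Integrating each by parts also produces one copy of
  -- the integral of f, whence the factor n + 1 - card ι.
  have h3 : ∫ y, fderiv ℝ f y y ∂coneMeasure a =
      ∑ k, ∫ y, b.coord k y * fderiv ℝ f y (a (j k)) ∂coneMeasure a := by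
    rw [← integral_finsetSum _ fun k _ => hid k]
    refine integral_congr_ae (Eventually.of_forall fun y => ?_)
    change fderiv ℝ f y y = _
    have h6 : ∀ L : V →L[ℝ] ℝ, L y = ∑ k, b.coord k y * L (a (j k)) := by
      intro L
      conv_lhs => rw [← b.sum_repr y, map_sum]
      simp only [map_smul, smul_eq_mul, hb, Module.Basis.coord_apply]
    exact h6 _
  have h4 := integral_euler_coneMeasure ℓ hℓ hf hc
  rw [h3] at h4
  have h5 : ∀ k, ∫ y, b.coord k y * fderiv ℝ f y (a (j k)) ∂coneMeasure a =
      - (∫ y, b.coord k y * f y ∂coneMeasure (a ∘ (j k).succAbove)) -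
        ∫ y, f y ∂coneMeasure a := by
    intro k
    rw [← h2 k, integral_add (hid k) hif]
    ring
  simp only [h5, Finset.sum_sub_distrib, Finset.sum_neg_distrib, Finset.sum_const,
    Finset.card_univ, nsmul_eq_mul] at h4
  push_cast at h4
  linarith

end Moments

/-! ### Polynomial densities of cone measures near non-singular points. -/

section PolyDensity

variable {V : Type*} [NormedAddCommGroup V] [NormedSpace ℝ V] [FiniteDimensional ℝ V]
  [MeasurableSpace V] [BorelSpace V]

/-- On the set `U` the measure `μ` has the polynomial density `p` with respect to `ν`, tested
against smooth functions with compact support in `U`. -/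
def HasPolyDensity (ν μ : Measure V) (U : Set V) (p : PolyFun V) : Prop :=
  ∀ f : V → ℝ, ContDiff ℝ ∞ f → HasCompactSupport f → tsupport f ⊆ U →
    ∫ y, f y • (p : V → ℂ) y ∂ν = ((∫ y, f y ∂μ : ℝ) : ℂ)

variable {ν μ : Measure V} [ν.IsAddHaarMeasure]

theorem HasPolyDensity.mono {U W : Set V} {p : PolyFun V} (h : HasPolyDensity ν μ U p)
    (hW : W ⊆ U) : HasPolyDensity ν μ W p :=
  fun f hf hc hs => h f hf hc (hs.trans hW)

theorem integrable_smul_polyFun {f : V → ℝ} (hf : Continuous f) (hc : HasCompactSupport f)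
    (p : PolyFun V) : Integrable (fun y => f y • (p : V → ℂ) y) ν :=
  (hf.smul (continuous_polyFun p)).integrable_of_hasCompactSupport hc.smul_right

theorem polyFun_eq_of_integral_eq {U : Set V} (hU : IsOpen U) (hne : U.Nonempty) {p q : PolyFun V}
    (h : ∀ f : V → ℝ, ContDiff ℝ ∞ f → HasCompactSupport f → tsupport f ⊆ U →
      ∫ y, f y • (p : V → ℂ) y ∂ν = ∫ y, f y • (q : V → ℂ) y ∂ν) : p = q := by
  have hcont := continuous_polyFun (p - q)
  have hae : ∀ᵐ x ∂ν, x ∈ U → ((p - q : PolyFun V) : V → ℂ) x = 0 := by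
    refine hU.ae_eq_zero_of_integral_contDiff_smul_eq_zero
      (hcont.locallyIntegrable.locallyIntegrableOn U) fun f hf hc hs => ?_
    have h1 := h f hf hc hs
    rw [← sub_eq_zero, ← integral_sub (integrable_smul_polyFun hf.continuous hc p)
      (integrable_smul_polyFun hf.continuous hc q)] at h1
    rw [← h1]
    refine integral_congr_ae (Eventually.of_forall fun y => ?_)
    change f y • ((p : V → ℂ) y - (q : V → ℂ) y) = _
    rw [smul_sub]
  rw [← sub_eq_zero]
  refine polyFun_eq_zero_of_eqOn hU hne fun y hy => ?_
  by_contra hy0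
  have hO : IsOpen (U ∩ {y | ((p - q : PolyFun V) : V → ℂ) y ≠ 0}) :=
    hU.inter (isOpen_ne_fun hcont continuous_const)
  have hz : ν (U ∩ {y | ((p - q : PolyFun V) : V → ℂ) y ≠ 0}) = 0 := by
    refine measure_mono_null (fun z hz => ?_) (ae_iff.1 hae)
    exact fun h => hz.2 (h hz.1)
  have := hO.eq_empty_of_measure_zero hz
  exact (this ▸ (⟨hy, hy0⟩ : y ∈ U ∩ {y | ((p - q : PolyFun V) : V → ℂ) y ≠ 0}) : y ∈ (∅ : Set V))

theorem HasPolyDensity.unique {U : Set V} (hU : IsOpen U) (hne : U.Nonempty) {p q : PolyFun V}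
    (hp : HasPolyDensity ν μ U p) (hq : HasPolyDensity ν μ U q) : p = q :=
  polyFun_eq_of_integral_eq (ν := ν) hU hne fun f hf hc hs => by rw [hp f hf hc hs, hq f hf hc hs]

theorem hasPolyDensity_compl_cone {κ : Type*} [Fintype κ] {a : κ → V} (ℓ : V →ₗ[ℝ] ℝ)
    (hℓ : ∀ i, 0 < ℓ (a i)) : HasPolyDensity ν (coneMeasure a) (cone a Set.univ)ᶜ 0 := by
  intro f _ _ hs
  have : ∫ y, f y ∂coneMeasure a = 0 := by
    refine integral_eq_zero_of_ae ((ae_mem_cone ℓ hℓ).mono fun y hy => ?_)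
    exact image_eq_zero_of_notMem_tsupport fun h => hs h hy
  rw [this]
  simp

/-- Removing a generator corresponds to differentiating the density. -/
theorem HasPolyDensity.polyDeriv {n : ℕ} {a : Fin (n + 1) → V} (ℓ : V →ₗ[ℝ] ℝ)
    (hℓ : ∀ i, 0 < ℓ (a i)) (i : Fin (n + 1)) {U : Set V} {p : PolyFun V}
    (hp : HasPolyDensity ν (coneMeasure a) U p) :
    HasPolyDensity ν (coneMeasure (a ∘ i.succAbove)) U (polyDeriv (a i) p) := by
  intro f hf hc hs
  have hf1 : ContDiff ℝ 1 f := hf.of_le (by exact_mod_cast le_top)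
  have hfd : ContDiff ℝ ∞ fun y => fderiv ℝ f y (a i) :=
    (hf.fderiv_right (m := ∞) (by simp)).clm_apply contDiff_const
  have hcd : HasCompactSupport fun y => fderiv ℝ f y (a i) :=
    (hc.fderiv ℝ).comp_left (g := fun L : V →L[ℝ] ℝ => L (a i)) (by simp)
  have hsd : tsupport (fun y => fderiv ℝ f y (a i)) ⊆ U :=
    (closure_mono (Function.support_comp_subset (g := fun L : V →L[ℝ] ℝ => L (a i)) (by simp)
      (fderiv ℝ f))).trans ((tsupport_fderiv_subset ℝ).trans hs)
  have h1 := hp _ hfd hcd hsd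
  rw [integral_fderiv_coneMeasure ℓ hℓ i hf1 hc] at h1
  -- Integration by parts is applied twice, once against the cone measure and here against ν; the
  -- two signs cancel.
  have h2 := integral_bilinear_hasLineDerivAt_right_eq_neg_left_of_integrable (μ := ν)
    (f := f) (f' := fun y => fderiv ℝ f y (a i)) (g := (p : V → ℂ))
    (g' := (PartitionSpline.polyDeriv (a i) p : V → ℂ)) (v := a i)
    (B := ContinuousLinearMap.lsmul ℝ ℝ)
    (integrable_smul_polyFun hfd.continuous hcd p)
    (integrable_smul_polyFun hf.continuous hc _)
    (integrable_smul_polyFun hf.continuous hc p)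
    (fun y _ => (hf1.differentiable one_ne_zero y).hasFDerivAt.hasLineDerivAt (a i))
    (fun y _ => hasLineDerivAt_polyDeriv (a i) p y)
  simp only [ContinuousLinearMap.lsmul_apply] at h2
  rw [h2, h1]
  push_cast
  ring

/-- On the image point of t, the form u takes the value ∑ t i u (a i), and each weight t i is
realised by repeating `a i`. -/
theorem HasPolyDensity.linPoly_mul {n : ℕ} {a : Fin n → V} (ℓ : V →ₗ[ℝ] ℝ)
    (hℓ : ∀ i, 0 < ℓ (a i)) (u : V →ₗ[ℝ] ℝ) {U : Set V} (hU : IsOpen U) (hne : U.Nonempty)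
    {p : PolyFun V} (hp : HasPolyDensity ν (coneMeasure a) U p) {q : Fin n → PolyFun V}
    (hq : ∀ i, HasPolyDensity ν (coneMeasure (Fin.cons (a i) a : Fin (n + 1) → V)) U (q i)) :
    linPoly u * p = ∑ i, (u (a i) : ℂ) • q i := by
  have hu : ContDiff ℝ ∞ u := (LinearMap.toContinuousLinearMap u).contDiff
  refine polyFun_eq_of_integral_eq (ν := ν) hU hne fun f hf hc hs => ?_
  have h1 := hp (fun y => u y * f y) (hu.mul hf) hc.mul_left
    ((tsupport_mul_subset_right).trans hs)
  rw [integral_linear_mul_coneMeasure ℓ hℓ u hf.continuous hc] at h1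
  have e1 : ∫ y, f y • ((linPoly u * p : PolyFun V) : V → ℂ) y ∂ν =
      ∫ y, (u y * f y) • (p : V → ℂ) y ∂ν := by
    refine integral_congr_ae (Eventually.of_forall fun y => ?_)
    change f y • ((u y : ℂ) * (p : V → ℂ) y) = _
    simp only [Complex.real_smul]
    push_cast
    ring
  have e2 : ∫ y, f y • ((∑ i, (u (a i) : ℂ) • q i : PolyFun V) : V → ℂ) y ∂ν =
      ∑ i, (u (a i) : ℂ) * ∫ y, f y • (q i : V → ℂ) y ∂ν := by
    simp_rw [← integral_const_mul]
    rw [← integral_finsetSum _ fun i _ =>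
      (integrable_smul_polyFun hf.continuous hc (q i)).const_mul _]
    refine integral_congr_ae (Eventually.of_forall fun y => ?_)
    simp only [AddSubmonoidClass.coe_finsetSum, Finset.sum_apply, SetLike.val_smul, Pi.smul_apply,
      smul_eq_mul, Complex.real_smul, Finset.mul_sum]
    exact Finset.sum_congr rfl fun i _ => by ring
  rw [e1, h1, e2]
  push_cast
  exact Finset.sum_congr rfl fun i _ => by rw [hq i f hf hc hs]

theorem comb_eq_equivFun_symm {κ : Type*} [Fintype κ] (b : Module.Basis κ ℝ V) :
    comb b = b.equivFun.symm := by
  funext t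
  rw [Module.Basis.equivFun_symm_apply]
  rfl

/-- For a basis, `comb b` is a linear isomorphism taking the orthant to the cone of non-negative
coordinates, so the density is the constant comparing the two Haar measures. -/
theorem hasPolyDensity_basis {κ : Type*} [Fintype κ] (b : Module.Basis κ ℝ V) {c : ℝ} (hc : 0 ≤ c)
    (hν : volume.map (comb b) = ENNReal.ofReal c • ν) :
    HasPolyDensity ν (coneMeasure b) {y | ∀ k, 0 < b.coord k y} (algebraMap ℂ _ (c : ℂ)) := by
  intro f hf hcs hs
  have hmeas : MeasurableSet {y | ∀ k, 0 ≤ b.coord k y} := by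
    have : {y | ∀ k, 0 ≤ b.coord k y} = ⋂ k, {y | 0 ≤ b.coord k y} := by ext; simp
    rw [this]
    exact MeasurableSet.iInter fun k => measurableSet_le measurable_const
      (b.coord k).continuous_of_finiteDimensional.measurable
  have e1 : orthant κ = comb b ⁻¹' {y | ∀ k, 0 ≤ b.coord k y} := by
    ext t
    simp only [orthant, Set.mem_ofPred_eq, Set.mem_preimage, comb_eq_equivFun_symm]
    refine forall_congr' fun k => ?_
    rw [Module.Basis.coord_apply, ← Module.Basis.equivFun_apply, LinearEquiv.apply_symm_apply]
  rw [coneMeasure, e1, ← Measure.restrict_map (measurable_comb _) hmeas, hν,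
    Measure.restrict_smul, integral_smul_measure, ENNReal.toReal_ofReal hc]
  rw [setIntegral_eq_integral_of_forall_compl_eq_zero]
  · simp only [Complex.real_smul, smul_eq_mul]
    push_cast
    rw [← integral_complex_ofReal, ← integral_const_mul]
    refine integral_congr_ae (Eventually.of_forall fun y => ?_)
    change (f y : ℂ) * (c : ℂ) = _
    ring
  · intro y hy
    exact image_eq_zero_of_notMem_tsupport fun h => hy fun k => (hs h k).le

theorem isOpen_basis_pos {κ : Type*} [Fintype κ] (b : Module.Basis κ ℝ V) :
    IsOpen {y | ∀ k, 0 < b.coord k y} := by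
  have : {y | ∀ k, 0 < b.coord k y} = ⋂ k, {y | 0 < b.coord k y} := by ext; simp
  rw [this]
  exact isOpen_iInter_of_finite fun k => isOpen_lt continuous_const
    (b.coord k).continuous_of_finiteDimensional

theorem exists_map_comb_basis {κ : Type*} [Fintype κ] (b : Module.Basis κ ℝ V) :
    ∃ c : ℝ, 0 ≤ c ∧ volume.map (comb b) = ENNReal.ofReal c • ν := by
  have : (volume.map (b.equivFunL.symm : (κ → ℝ) ≃L[ℝ] V)).IsAddHaarMeasure := inferInstance
  have h := Measure.isAddLeftInvariant_eq_smul (volume.map (b.equivFunL.symm : (κ → ℝ) ≃L[ℝ] V)) ν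
  refine ⟨_, NNReal.coe_nonneg (Measure.addHaarScalarFactor
    (volume.map (b.equivFunL.symm : (κ → ℝ) ≃L[ℝ] V)) ν), ?_⟩
  rw [ENNReal.ofReal_coe_nnreal, comb_eq_equivFun_symm]
  exact h

theorem forall_pos_of_notMem_singularPoints {κ : Type*} [Fintype κ] {b : Module.Basis κ ℝ V} {t : κ → ℝ}
    (ht : ∀ i, 0 ≤ t i) (hx : comb b t ∉ singularPoints b) (i : κ) : 0 < t i := by
  refine lt_of_le_of_ne (ht i) fun h0 => hx ⟨{j | j ≠ i}, ?_, t, ht, ?_, rfl⟩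
  · intro htop
    have := b.linearIndependent.notMem_span_image (s := {j | j ≠ i}) (x := i) (by simp)
    exact this (htop ▸ Submodule.mem_top)
  · intro j hj
    have : j = i := by simpa using hj
    rw [this, h0]

theorem singularPoints_comp_subset {κ κ' : Type*} [Fintype κ] [Fintype κ'] (a : κ → V) {j : κ' → κ}
    (hj : Function.Injective j) : singularPoints (a ∘ j) ⊆ singularPoints a := by
  classical
  rintro x ⟨A, hA, t, ht, ht0, rfl⟩
  refine ⟨j '' A, by rwa [← Set.image_comp], Function.extend j t 0, ?_, ?_, ?_⟩
  · intro i
    by_cases h : ∃ k, j k = i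
    · obtain ⟨k, rfl⟩ := h
      rw [hj.extend_apply]; exact ht k
    · rw [Function.extend_apply' _ _ _ h]; exact le_rfl
  · intro i hi
    by_cases h : ∃ k, j k = i
    · obtain ⟨k, rfl⟩ := h
      rw [hj.extend_apply]; exact ht0 k fun hk => hi ⟨k, hk, rfl⟩
    · rw [Function.extend_apply' _ _ _ h]; rfl
  · rw [← Finset.sum_subset (Finset.subset_univ (Finset.univ.image j)),
      Finset.sum_image fun x _ y _ h => hj h]
    · exact Finset.sum_congr rfl fun k _ => by rw [hj.extend_apply]; rfl
    · intro i _ hi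
      rw [Function.extend_apply' _ _ _ fun ⟨k, hk⟩ => hi (by simp [← hk])]
      simp

/-- Near a point that is not singular the cone measure has a polynomial density. -/
theorem exists_hasPolyDensity {n : ℕ} {a : Fin n → V} (ℓ : V →ₗ[ℝ] ℝ)
    (hℓ : ∀ i, 0 < ℓ (a i)) {x : V} (hx : x ∉ singularPoints a) :
    ∃ p U, IsOpen U ∧ x ∈ U ∧ HasPolyDensity ν (coneMeasure a) U p := by
  induction n using Nat.strong_induction_on with
  | _ n ih =>
  by_cases hxc : x ∈ cone a Set.univ
  swap
  · exact ⟨0, _, (isClosed_cone_univ ℓ hℓ).isOpen_compl, hxc, hasPolyDensity_compl_cone ℓ hℓ⟩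
  have hspan : Submodule.span ℝ (Set.range a) = ⊤ := by
    by_contra h
    exact hx ⟨Set.univ, by rwa [Set.image_univ], hxc⟩
  obtain ⟨κ, j, hj, hsp, hli⟩ := exists_linearIndependent' ℝ a
  have : Fintype κ := Fintype.ofInjective j hj
  let b : Module.Basis κ ℝ V := Module.Basis.mk hli (by rw [hsp, hspan])
  have hb : ∀ k, b k = a (j k) := fun k => by simp [b]
  have hb' : (b : κ → V) = a ∘ j := funext hb
  -- If there are no more vectors than the dimension, the list is a basis, and non-singularity of x
  -- forces all its coordinates to be positive.
  by_cases hcard : Fintype.card κ = n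
  · have hbij : Function.Bijective j :=
      (Fintype.bijective_iff_injective_and_card j).2 ⟨hj, by simpa using hcard⟩
    let e : κ ≃ Fin n := Equiv.ofBijective j hbij
    have he : coneMeasure a = coneMeasure b := by
      rw [hb', ← coneMeasure_comp_equiv e a]; rfl
    obtain ⟨t, ht, -, hxt⟩ := hxc
    have hxb : x = comb b (t ∘ e) := by
      rw [hxt, comb, ← e.sum_comp, hb']
      rfl
    obtain ⟨c, hc0, hc⟩ := exists_map_comb_basis (ν := ν) b
    refine ⟨_, _, isOpen_basis_pos b, ?_, he ▸ hasPolyDensity_basis b hc0 hc⟩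
    have hpos := forall_pos_of_notMem_singularPoints (b := b) (t := t ∘ e) (fun i => ht (e i)) (by
      rw [← hxb, hb']
      exact fun h => hx (singularPoints_comp_subset a hj h))
    intro k
    have : b.coord k x = t (e k) := by
      rw [hxb, comb_eq_equivFun_symm, Module.Basis.coord_apply, ← Module.Basis.equivFun_apply,
        LinearEquiv.apply_symm_apply]
      rfl
    rw [this]
    exact hpos k
  -- Otherwise the factor (number of vectors) - (dimension) in the homogeneity recursion is nonzero.
  -- Dividing by it expresses the density through the lists with one basis vector removed, for which
  -- x is still non-singular.
  · have hlt : Fintype.card κ < n :=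
      lt_of_le_of_ne (by simpa using Fintype.card_le_of_injective j hj) hcard
    obtain ⟨n, rfl⟩ : ∃ m, n = m + 1 := ⟨n - 1, by omega⟩
    have hex : ∀ k, ∃ p U, IsOpen U ∧ x ∈ U ∧
        HasPolyDensity ν (coneMeasure (a ∘ (j k).succAbove)) U p := fun k =>
      ih n (Nat.lt_succ_self n) (fun i => hℓ _) fun h =>
        hx (singularPoints_comp_subset a Fin.succAbove_right_injective h)
    choose p U hU hxU hp using hex
    have hr : ((n + 1 : ℝ) - Fintype.card κ) ≠ 0 := by
      have : (Fintype.card κ : ℝ) < n + 1 := by exact_mod_cast hlt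
      linarith
    refine ⟨((((n + 1 : ℝ) - Fintype.card κ)⁻¹ : ℝ) : ℂ) • ∑ k, linPoly (b.coord k) * p k,
      ⋂ k, U k, isOpen_iInter_of_finite hU, Set.mem_iInter.2 hxU, fun f hf hc hs => ?_⟩
    have hf1 : ContDiff ℝ 1 f := hf.of_le (by exact_mod_cast le_top)
    have hrec := integral_recursion_coneMeasure ℓ hℓ b j hb hf1 hc
    have hk : ∀ k, ((∫ y, b.coord k y * f y ∂coneMeasure (a ∘ (j k).succAbove) : ℝ) : ℂ) =
        ∫ y, f y • ((linPoly (b.coord k) * p k : PolyFun V) : V → ℂ) y ∂ν := by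
      intro k
      have hu : ContDiff ℝ ∞ (b.coord k) := (LinearMap.toContinuousLinearMap (b.coord k)).contDiff
      rw [← hp k (fun y => b.coord k y * f y) (hu.mul hf) hc.mul_left
        ((tsupport_mul_subset_right).trans (hs.trans (Set.iInter_subset U k)))]
      refine integral_congr_ae (Eventually.of_forall fun y => ?_)
      change _ = f y • (((b.coord k y : ℝ) : ℂ) * (p k : V → ℂ) y)
      simp only [Complex.real_smul]
      push_cast
      ring
    have hint : ∫ y, f y ∂coneMeasure a = ((n + 1 : ℝ) - Fintype.card κ)⁻¹ *
        ∑ k, ∫ y, b.coord k y * f y ∂coneMeasure (a ∘ (j k).succAbove) := by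
      rw [← hrec, inv_mul_cancel_left₀ hr]
    rw [hint, Complex.ofReal_mul, Complex.ofReal_sum]
    simp_rw [hk]
    rw [← integral_finsetSum _ fun k _ =>
      integrable_smul_polyFun hf.continuous hc (linPoly (b.coord k) * p k), ← integral_const_mul]
    refine integral_congr_ae (Eventually.of_forall fun y => ?_)
    simp only [AddSubmonoidClass.coe_finsetSum, Finset.sum_apply, SetLike.val_smul, Pi.smul_apply,
      smul_eq_mul, Complex.real_smul, Finset.mul_sum]
    exact Finset.sum_congr rfl fun i _ => by ring

end PolyDensity

/-! ### The pointwise E-spline and its distributional characterisation. -/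

section ESpline

variable {V : Type*} [NormedAddCommGroup V] [NormedSpace ℝ V] [FiniteDimensional ℝ V]
  [MeasurableSpace V] [BorelSpace V] {ν : Measure V} [ν.IsAddHaarMeasure]
  {κ : Type*} [Fintype κ]

theorem exists_hasPolyDensity_family {a : κ → V} (ℓ : V →ₗ[ℝ] ℝ)
    (hℓ : ∀ i, 0 < ℓ (a i)) {x : V} (hx : x ∉ singularPoints a) :
    ∃ p U, IsOpen U ∧ x ∈ U ∧ HasPolyDensity ν (coneMeasure a) U p := by
  let e : Fin (Fintype.card κ) ≃ κ := (Fintype.equivFin κ).symm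
  obtain ⟨p, U, hU, hxU, hp⟩ := exists_hasPolyDensity (ν := ν) (a := a ∘ e) ℓ (fun i => hℓ _)
    fun h => hx (singularPoints_comp_subset a e.injective h)
  rw [coneMeasure_comp_equiv] at hp
  exact ⟨p, U, hU, hxU, hp⟩

theorem cone_subset_span (a : κ → V) (A : Set κ) :
    cone a A ⊆ (Submodule.span ℝ (a '' A) : Set V) := by
  rintro x ⟨t, -, ht0, rfl⟩
  refine Submodule.sum_mem _ fun i _ => ?_
  by_cases hi : i ∈ A
  · exact Submodule.smul_mem _ _ (Submodule.subset_span ⟨i, hi, rfl⟩)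
  · rw [ht0 i hi, zero_smul]
    exact Submodule.zero_mem _

theorem measure_singularPoints (a : κ → V) : ν (singularPoints a) = 0 := by
  have : singularPoints a ⊆ ⋃ A : {A : Set κ // Submodule.span ℝ (a '' A) ≠ ⊤},
      (Submodule.span ℝ (a '' A.1) : Set V) := by
    rintro x ⟨A, hA, hx⟩
    exact Set.mem_iUnion.2 ⟨⟨A, hA⟩, cone_subset_span a A hx⟩
  refine measure_mono_null this (measure_iUnion_null fun A => ?_)
  exact Measure.addHaar_submodule ν _ A.2

theorem surjective_comb {a : κ → V} (hspan : Submodule.span ℝ (Set.range a) = ⊤) :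
    Function.Surjective (Fintype.linearCombination ℝ a) := by
  rw [← LinearMap.range_eq_top, Fintype.range_linearCombination, hspan]

/-- A surjective linear map sends Lebesgue measure to a multiple of ν. The multiple is infinite when
the kernel is nontrivial, which does no harm to absolute continuity. -/
theorem coneMeasure_absolutelyContinuous {a : κ → V}
    (hspan : Submodule.span ℝ (Set.range a) = ⊤) : coneMeasure a ≪ ν := by
  obtain ⟨c, -, hc⟩ := LinearMap.exists_map_addHaar_eq_smul_addHaar
    (Fintype.linearCombination ℝ a) (volume : Measure (κ → ℝ)) ν (surjective_comb hspan)
  have h1 : volume.map (comb a) = c • ν := hc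
  have h2 : coneMeasure a ≪ volume.map (comb a) :=
    (Measure.absolutelyContinuous_of_le Measure.restrict_le_self).map (measurable_comb a)
  rw [h1] at h2
  exact h2.trans Measure.smul_absolutelyContinuous

theorem locallyIntegrable_rnDeriv (μ : Measure V) [IsLocallyFiniteMeasure μ] :
    LocallyIntegrable (fun y => (μ.rnDeriv ν y).toReal) ν := by
  rw [locallyIntegrable_iff]
  intro K hK
  refine integrable_toReal_of_lintegral_ne_top (Measure.measurable_rnDeriv _ _).aemeasurable ?_
  exact (Measure.lintegral_rnDeriv_lt_top_of_measure_ne_top ν hK.measure_lt_top.ne).ne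

theorem HasPolyDensity.ae_eq_rnDeriv {μ : Measure V} [IsLocallyFiniteMeasure μ]
    (hμ : μ ≪ ν) {U : Set V} (hU : IsOpen U) {p : PolyFun V} (hp : HasPolyDensity ν μ U p) :
    ∀ᵐ y ∂ν, y ∈ U → ((μ.rnDeriv ν y).toReal : ℂ) = (p : V → ℂ) y := by
  have hT : LocallyIntegrable (fun y => ((μ.rnDeriv ν y).toReal : ℂ)) ν := by
    rw [locallyIntegrable_iff]
    intro K hK
    exact ((locallyIntegrable_iff.1 (locallyIntegrable_rnDeriv (ν := ν) μ)) K hK).ofReal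
  have h := hU.ae_eq_zero_of_integral_contDiff_smul_eq_zero (μ := ν)
    (f := fun y => ((μ.rnDeriv ν y).toReal : ℂ) - (p : V → ℂ) y)
    ((hT.sub (continuous_polyFun p).locallyIntegrable).locallyIntegrableOn U) ?_
  · filter_upwards [h] with y hy hyU
    exact sub_eq_zero.1 (hy hyU)
  · intro g hg hc hs
    have e : ∀ y, g y • (((μ.rnDeriv ν y).toReal : ℂ) - (p : V → ℂ) y) =
        (((μ.rnDeriv ν y).toReal • g y : ℝ) : ℂ) - g y • (p : V → ℂ) y := by
      intro y
      rw [smul_sub]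
      simp only [Complex.real_smul, smul_eq_mul]
      push_cast
      ring
    simp_rw [e]
    have hgi : Integrable (fun y => (μ.rnDeriv ν y).toReal • g y) ν := by
      rw [integrable_rnDeriv_smul_iff hμ]
      exact hg.continuous.integrable_of_hasCompactSupport hc
    have hgi' : Integrable (fun y => (((μ.rnDeriv ν y).toReal • g y : ℝ) : ℂ)) ν := hgi.ofReal
    rw [integral_sub hgi' (integrable_smul_polyFun hg.continuous hc p), hp g hg hc hs,
      integral_complex_ofReal, integral_rnDeriv_smul hμ, sub_self]

theorem tendsto_average_closedBall {h : V → ℂ} (hh : Continuous h) (y : V) :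
    Tendsto (fun r => (∫ z in Metric.closedBall y r, h z ∂ν) /
      (ν.real (Metric.closedBall y r) : ℂ)) (𝓝[>] (0 : ℝ)) (𝓝 (h y)) := by
  rw [Metric.tendsto_nhdsWithin_nhds]
  intro ε hε
  obtain ⟨δ, hδ, hδh⟩ := Metric.continuous_iff.1 hh y (ε / 2) (half_pos hε)
  refine ⟨δ, hδ, fun r hr hrδ => ?_⟩
  have hr0 : 0 < r := hr
  rw [Real.dist_eq, sub_zero, abs_of_pos hr0] at hrδ
  have hB : 0 < ν.real (Metric.closedBall y r) :=
    ENNReal.toReal_pos (Metric.measure_closedBall_pos ν y hr0).ne'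
      (isCompact_closedBall y r).measure_lt_top.ne
  have hint : IntegrableOn h (Metric.closedBall y r) ν :=
    hh.continuousOn.integrableOn_compact (isCompact_closedBall y r)
  have e : (∫ z in Metric.closedBall y r, h z ∂ν) / (ν.real (Metric.closedBall y r) : ℂ) - h y =
      (∫ z in Metric.closedBall y r, (h z - h y) ∂ν) / (ν.real (Metric.closedBall y r) : ℂ) := by
    have hfin : IntegrableOn (fun _ => h y) (Metric.closedBall y r) ν :=
      continuous_const.continuousOn.integrableOn_compact (isCompact_closedBall y r)
    rw [integral_sub hint hfin, setIntegral_const, sub_div, Complex.real_smul,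
      mul_div_cancel_left₀]
    exact_mod_cast hB.ne'
  rw [dist_eq_norm, e, norm_div, Complex.norm_real, Real.norm_of_nonneg hB.le, div_lt_iff₀ hB]
  have hb := norm_setIntegral_le_of_norm_le_const (μ := ν) (f := fun z => h z - h y)
    (s := Metric.closedBall y r) (C := ε / 2) (isCompact_closedBall y r).measure_lt_top
    (fun z hz => by
      rw [← dist_eq_norm]
      exact (hδh z (lt_of_le_of_lt hz hrδ)).le)
  refine hb.trans_lt ?_
  exact mul_lt_mul_of_pos_right (by linarith) hB

/-- The parameters of the E-spline attached to a complex linear form. -/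
theorem exp_neg_sum_param (a : κ → V) (φ : V →ₗ[ℝ] ℂ) {μ : κ → ℂ} (hμ : ∀ i, μ i = -φ (a i))
    (t : κ → ℝ) : Complex.exp (-∑ i, (t i : ℂ) * μ i) = Complex.exp (φ (comb a t)) := by
  congr 1
  simp only [comb, map_sum, map_smul, hμ, mul_neg, Finset.sum_neg_distrib, neg_neg,
    Complex.real_smul]

theorem setIntegral_param (a : κ → V) (φ : V →ₗ[ℝ] ℂ) {μ : κ → ℂ} (hμ : ∀ i, μ i = -φ (a i))
    {S : Set V} (hS : MeasurableSet S) :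
    ∫ t in {t : κ → ℝ | (∀ i, 0 ≤ t i) ∧ ∑ i, t i • a i ∈ S},
      Complex.exp (-∑ i, (t i : ℂ) * μ i) = ∫ y in S, Complex.exp (φ y) ∂coneMeasure a := by
  have hφ : Continuous φ := φ.continuous_of_finiteDimensional
  rw [coneMeasure, setIntegral_map hS (f := fun y => Complex.exp (φ y)) (Complex.continuous_exp.comp hφ).aestronglyMeasurable
    (measurable_comb a).aemeasurable, Measure.restrict_restrict (measurable_comb a hS)]
  have : {t : κ → ℝ | (∀ i, 0 ≤ t i) ∧ ∑ i, t i • a i ∈ S} = comb a ⁻¹' S ∩ orthant κ := by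
    ext t
    exact and_comm
  rw [this]
  exact integral_congr_ae (Eventually.of_forall fun t => exp_neg_sum_param a φ hμ t)

/-- On U the Radon–Nikodym derivative agrees almost everywhere with p, so for small radius the
quotients defining `eSpline` are averages of a continuous function. They converge at every point of
U, not just at almost every one. -/
theorem eSpline_eq_of_hasPolyDensity {a : κ → V} (ℓ : V →ₗ[ℝ] ℝ) (hℓ : ∀ i, 0 < ℓ (a i))
    (hspan : Submodule.span ℝ (Set.range a) = ⊤)
    (φ : V →ₗ[ℝ] ℂ) {μ : κ → ℂ} (hμ : ∀ i, μ i = -φ (a i)) {U : Set V} (hU : IsOpen U)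
    {p : PolyFun V} (hp : HasPolyDensity ν (coneMeasure a) U p) {y : V} (hy : y ∈ U) :
    eSpline ν a μ y = Complex.exp (φ y) * (p : V → ℂ) y := by
  have := isLocallyFiniteMeasure_coneMeasure ℓ hℓ
  have hφ : Continuous φ := φ.continuous_of_finiteDimensional
  have hac : coneMeasure a ≪ ν := coneMeasure_absolutelyContinuous hspan
  have hae := hp.ae_eq_rnDeriv hac hU
  refine Tendsto.limUnder_eq ?_
  refine (tendsto_average_closedBall (ν := ν) (h := fun z => Complex.exp (φ z) * (p : V → ℂ) z)
    ((Complex.continuous_exp.comp hφ).mul (continuous_polyFun p)) y).congr' ?_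
  obtain ⟨δ, hδ, hδU⟩ := Metric.isOpen_iff.1 hU y hy
  filter_upwards [Ioo_mem_nhdsGT hδ] with r hr
  congr 1
  rw [setIntegral_param a φ hμ Metric.isClosed_closedBall.measurableSet,
    ← setIntegral_rnDeriv_smul hac Metric.isClosed_closedBall.measurableSet]
  refine setIntegral_congr_ae Metric.isClosed_closedBall.measurableSet ?_
  filter_upwards [hae] with z hz hzB
  have hzU : z ∈ U := hδU (lt_of_le_of_lt hzB hr.2)
  rw [← hz hzU, Complex.real_smul]
  ring

theorem isLocallyExpPoly_eSpline {a : κ → V} (ℓ : V →ₗ[ℝ] ℝ) (hℓ : ∀ i, 0 < ℓ (a i))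
    (hspan : Submodule.span ℝ (Set.range a) = ⊤)
    (φ : V →ₗ[ℝ] ℂ) {μ : κ → ℂ} (hμ : ∀ i, μ i = -φ (a i)) :
    IsLocallyExpPoly φ (singularPoints a)ᶜ (eSpline ν a μ) := by
  intro x hx
  obtain ⟨p, U, hU, hxU, hp⟩ := exists_hasPolyDensity_family (ν := ν) ℓ hℓ hx
  refine ⟨p, p.2, ?_⟩
  filter_upwards [hU.mem_nhds hxU] with y hy
  exact eSpline_eq_of_hasPolyDensity ℓ hℓ hspan φ hμ hU hp hy

/-- The two sides agree almost everywhere near each non-singular point, and the singular points lie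
in a finite union of proper subspaces, which is null. -/
theorem ae_eSpline_eq {a : κ → V} (ℓ : V →ₗ[ℝ] ℝ) (hℓ : ∀ i, 0 < ℓ (a i))
    (hspan : Submodule.span ℝ (Set.range a) = ⊤)
    (φ : V →ₗ[ℝ] ℂ) {μ : κ → ℂ} (hμ : ∀ i, μ i = -φ (a i)) :
    ∀ᵐ y ∂ν, Complex.exp (φ y) * (((coneMeasure a).rnDeriv ν y).toReal : ℂ) = eSpline ν a μ y := by
  have := isLocallyFiniteMeasure_coneMeasure ℓ hℓ
  have hac : coneMeasure a ≪ ν := coneMeasure_absolutelyContinuous hspan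
  set S := {y | Complex.exp (φ y) * (((coneMeasure a).rnDeriv ν y).toReal : ℂ) ≠ eSpline ν a μ y}
  have h1 : ν (S \ singularPoints a) = 0 := by
    refine measure_null_of_locally_null _ fun x hx => ?_
    obtain ⟨p, U, hU, hxU, hp⟩ := exists_hasPolyDensity_family (ν := ν) ℓ hℓ hx.2
    refine ⟨U ∩ (S \ singularPoints a), inter_mem (mem_nhdsWithin_of_mem_nhds (hU.mem_nhds hxU)) self_mem_nhdsWithin, ?_⟩
    refine measure_mono_null (fun z hz => ?_) (ae_iff.1 (hp.ae_eq_rnDeriv hac hU))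
    intro hz'
    apply hz.2.1
    rw [eSpline_eq_of_hasPolyDensity ℓ hℓ hspan φ hμ hU hp hz.1, hz' hz.1]
  refine ae_iff.2 (measure_mono_null (t := S \ singularPoints a ∪ singularPoints a) ?_
    (measure_union_null h1 (measure_singularPoints a)))
  intro y hy
  by_cases h : y ∈ singularPoints a
  · exact Or.inr h
  · exact Or.inl ⟨hy, h⟩

theorem isESpline_eSpline {a : κ → V} (ℓ : V →ₗ[ℝ] ℝ) (hℓ : ∀ i, 0 < ℓ (a i))
    (hspan : Submodule.span ℝ (Set.range a) = ⊤)
    (φ : V →ₗ[ℝ] ℂ) {μ : κ → ℂ} (hμ : ∀ i, μ i = -φ (a i)) :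
    IsESpline ν a μ (eSpline ν a μ) := by
  have := isLocallyFiniteMeasure_coneMeasure ℓ hℓ
  have hφ : Continuous fun y => Complex.exp (φ y) :=
    Complex.continuous_exp.comp φ.continuous_of_finiteDimensional
  have hac : coneMeasure a ≪ ν := coneMeasure_absolutelyContinuous hspan
  have hae := ae_eSpline_eq (ν := ν) ℓ hℓ hspan φ hμ
  refine ⟨?_, fun f hf hc => ?_, fun f hf hc => ?_⟩
  · refine LocallyIntegrable.congr ?_ hae
    rw [locallyIntegrable_iff]
    intro K hK
    exact IntegrableOn.continuousOn_mul hφ.continuousOn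
      ((locallyIntegrable_iff.1 (locallyIntegrable_rnDeriv (ν := ν) (coneMeasure a))) K hK).ofReal hK
  · have h1 : Integrable (fun y => Complex.exp (φ y) * f y) (coneMeasure a) :=
      integrable_coneMeasure ℓ hℓ (hφ.mul hf) hc.mul_left
    rw [coneMeasure, integrable_map_measure (f := comb a) (g := fun y => Complex.exp (φ y) * f y)
      (hφ.mul hf).aestronglyMeasurable
      (measurable_comb a).aemeasurable] at h1
    refine h1.congr (Eventually.of_forall fun t => ?_)
    simp only [Function.comp, exp_neg_sum_param a φ hμ]
    rfl
  · have e1 : ∫ x, f x * eSpline ν a μ x ∂ν = ∫ y, Complex.exp (φ y) * f y ∂coneMeasure a := by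
      rw [← integral_rnDeriv_smul hac]
      refine integral_congr_ae ?_
      filter_upwards [hae] with y hy
      rw [← hy, Complex.real_smul]
      ring
    rw [e1, coneMeasure, integral_map (f := fun y => Complex.exp (φ y) * f y)
      (measurable_comb a).aemeasurable (hφ.mul hf).aestronglyMeasurable]
    refine integral_congr_ae (Eventually.of_forall fun t => ?_)
    simp only [exp_neg_sum_param a φ hμ]
    rfl

end ESpline

/-! ### Passing between families and multisets. -/

section Families

variable {W : Type*}

/-- Over each value w both fibres have as many elements as the multiplicity of w, so they can be
matched. This is how invariants of families descend to multisets. -/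
theorem exists_equiv_of_map_eq {κ κ' : Type*} [Fintype κ] [Fintype κ'] (a : κ → W) (b : κ' → W)
    (h : Finset.univ.val.map a = Finset.univ.val.map b) : ∃ e : κ ≃ κ', a = b ∘ e := by
  classical
  have hcard : ∀ w, Fintype.card {i // a i = w} = Fintype.card {i // b i = w} := by
    intro w
    have := congrArg (Multiset.count w) h
    rw [Multiset.count_map, Multiset.count_map] at this
    rw [Fintype.card_subtype, Fintype.card_subtype]
    simpa [Finset.card, Finset.filter_val, eq_comm] using this
  let e := Equiv.ofFiberEquiv fun w => Fintype.equivOfCardEq (hcard w)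
  exact ⟨e, funext fun i => (Equiv.ofFiberEquiv_map _ i).symm⟩

/-- A family enumerating a multiset. -/
def fam (X : Multiset W) : Fin X.toList.length → W := X.toList.get

theorem map_fam (X : Multiset W) : Finset.univ.val.map (fam X) = X := by
  rw [Fin.univ_val_map, fam, List.ofFn_get, Multiset.coe_toList]

theorem fam_mem (X : Multiset W) (i) : fam X i ∈ X := by
  rw [← Multiset.mem_toList]
  exact List.get_mem _ _

theorem range_fam (X : Multiset W) : Set.range (fam X) = {w | w ∈ X} := by
  ext w
  constructor
  · rintro ⟨i, rfl⟩
    exact fam_mem X i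
  · intro hw
    have : w ∈ Finset.univ.val.map (fam X) := by rw [map_fam]; exact hw
    obtain ⟨i, -, hi⟩ := Multiset.mem_map.1 this
    exact ⟨i, hi⟩

theorem map_finCons {n : ℕ} (w : W) (a : Fin n → W) :
    Finset.univ.val.map (Fin.cons w a : Fin (n + 1) → W) = w ::ₘ Finset.univ.val.map a := by
  rw [Fin.univ_val_map, Fin.univ_val_map, List.ofFn_succ]
  simp

end Families

/-! ### Cones as spans over the non-negative reals. -/

section Cones

variable {V : Type*} [AddCommGroup V] [Module ℝ V] {κ : Type*} [Fintype κ]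

theorem mem_cone_univ_iff (a : κ → V) (x : V) :
    x ∈ cone a Set.univ ↔ x ∈ Submodule.span ℝ≥0 (Set.range a) := by
  rw [Submodule.mem_span_range_iff_exists_fun]
  constructor
  · rintro ⟨t, ht, -, rfl⟩
    exact ⟨fun i => ⟨t i, ht i⟩, rfl⟩
  · rintro ⟨c, rfl⟩
    exact ⟨fun i => c i, fun i => (c i).2, fun i hi => absurd (Set.mem_univ i) hi, rfl⟩

end Cones

/-! ### Germs of densities attached to multisets. -/

section Germs

variable {V : Type*} [NormedAddCommGroup V] [NormedSpace ℝ V] [FiniteDimensional ℝ V]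
  [MeasurableSpace V] [BorelSpace V]

/-- The cone measure of a multiset of vectors. -/
def msMeasure (X : Multiset V) : Measure V := coneMeasure (fam X)

theorem msMeasure_map {κ : Type*} [Fintype κ] (a : κ → V) :
    msMeasure (Finset.univ.val.map a) = coneMeasure a := by
  obtain ⟨e, he⟩ := exists_equiv_of_map_eq _ a (map_fam (Finset.univ.val.map a))
  rw [msMeasure, he, coneMeasure_comp_equiv]

/-- The polynomial `p` is the density of the cone measure of `X` near `x`. -/
def IsGerm (ν : Measure V) (x : V) (X : Multiset V) (p : PolyFun V) : Prop :=
  ∃ U, IsOpen U ∧ x ∈ U ∧ HasPolyDensity ν (msMeasure X) U p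

open Classical in
/-- The density of the cone measure of `X` near `x`. -/
def germ (ν : Measure V) (x : V) (X : Multiset V) : PolyFun V :=
  if h : ∃ p, IsGerm ν x X p then h.choose else 0

variable {ν : Measure V} [ν.IsAddHaarMeasure] {x : V} {X : Multiset V}

theorem IsGerm.unique {p q : PolyFun V} (hp : IsGerm ν x X p) (hq : IsGerm ν x X q) : p = q := by
  obtain ⟨U, hU, hxU, hp⟩ := hp
  obtain ⟨W, hW, hxW, hq⟩ := hq
  exact (hp.mono Set.inter_subset_left).unique (hU.inter hW) ⟨x, hxU, hxW⟩
    (hq.mono Set.inter_subset_right)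

theorem IsGerm.germ_eq {p : PolyFun V} (hp : IsGerm ν x X p) : germ ν x X = p := by
  have h : ∃ p, IsGerm ν x X p := ⟨p, hp⟩
  rw [germ, dif_pos h]
  exact h.choose_spec.unique hp

theorem isGerm_germ (h : ∃ p, IsGerm ν x X p) : IsGerm ν x X (germ ν x X) := by
  obtain ⟨p, hp⟩ := h
  rwa [hp.germ_eq]

theorem exists_isGerm (ℓ : V →ₗ[ℝ] ℝ) (hℓ : ∀ v ∈ X, 0 < ℓ v) (hx : x ∉ singularPoints (fam X)) :
    ∃ p, IsGerm ν x X p := by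
  obtain ⟨p, U, hU, hxU, hp⟩ := exists_hasPolyDensity (ν := ν) ℓ (fun i => hℓ _ (fam_mem X i)) hx
  exact ⟨p, U, hU, hxU, hp⟩

theorem germ_eq_zero (ℓ : V →ₗ[ℝ] ℝ) (hℓ : ∀ v ∈ X, 0 < ℓ v)
    (hx : x ∉ Submodule.span ℝ≥0 {v | v ∈ X}) : germ ν x X = 0 := by
  refine IsGerm.germ_eq ⟨(cone (fam X) Set.univ)ᶜ,
    (isClosed_cone_univ ℓ fun i => hℓ _ (fam_mem X i)).isOpen_compl, ?_,
    hasPolyDensity_compl_cone ℓ fun i => hℓ _ (fam_mem X i)⟩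
  rwa [Set.mem_compl_iff, mem_cone_univ_iff, range_fam]

theorem polyDeriv_germ_cons (ℓ : V →ₗ[ℝ] ℝ) {v : V} (hℓ : ∀ w ∈ v ::ₘ X, 0 < ℓ w)
    (h : ∃ p, IsGerm ν x (v ::ₘ X) p) :
    polyDeriv v (germ ν x (v ::ₘ X)) = germ ν x X := by
  obtain ⟨U, hU, hxU, hp⟩ := isGerm_germ h
  have e : msMeasure (v ::ₘ X) = coneMeasure (Fin.cons v (fam X) : Fin _ → V) := by
    rw [← msMeasure_map, map_finCons, map_fam]
  have hX : ∀ w ∈ X, 0 < ℓ w := fun w hw => hℓ w (Multiset.mem_cons_of_mem hw)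
  rw [e] at hp
  have h2 := hp.polyDeriv ℓ (pos_cons (fun i => hX _ (fam_mem X i))
    (hℓ v (Multiset.mem_cons_self v X))) 0
  have h0 : (Fin.cons v (fam X) : Fin (X.toList.length + 1) → V) ∘ Fin.succAbove 0 = fam X := by
    funext j; simp
  rw [h0, Fin.cons_zero] at h2
  exact (IsGerm.germ_eq ⟨U, hU, hxU, h2⟩).symm

theorem linPoly_mul_germ (ℓ : V →ₗ[ℝ] ℝ) (hℓ : ∀ w ∈ X, 0 < ℓ w) (u : V →ₗ[ℝ] ℝ)
    (h : ∃ p, IsGerm ν x X p) (h' : ∀ v ∈ X, ∃ p, IsGerm ν x (v ::ₘ X) p) :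
    linPoly u * germ ν x X = (X.map fun v => (u v : ℂ) • germ ν x (v ::ₘ X)).sum := by
  obtain ⟨U, hU, hxU, hp⟩ := isGerm_germ h
  have hex : ∀ i, ∃ W, IsOpen W ∧ x ∈ W ∧ HasPolyDensity ν
      (coneMeasure (Fin.cons (fam X i) (fam X) : Fin _ → V)) W (germ ν x (fam X i ::ₘ X)) := by
    intro i
    obtain ⟨W, hW, hxW, hq⟩ := isGerm_germ (h' _ (fam_mem X i))
    have e : msMeasure (fam X i ::ₘ X) = coneMeasure (Fin.cons (fam X i) (fam X) : Fin _ → V) := by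
      rw [← msMeasure_map, map_finCons, map_fam]
    rw [e] at hq
    exact ⟨W, hW, hxW, hq⟩
  choose W hW hxW hq using hex
  have hO : IsOpen (U ∩ ⋂ i, W i) := hU.inter (isOpen_iInter_of_finite hW)
  have hxO : x ∈ U ∩ ⋂ i, W i := ⟨hxU, Set.mem_iInter.2 hxW⟩
  have h1 := HasPolyDensity.linPoly_mul (ν := ν) ℓ (fun i => hℓ _ (fam_mem X i)) u hO ⟨x, hxO⟩
    (hp.mono Set.inter_subset_left) (q := fun i => germ ν x (fam X i ::ₘ X))
    (fun i => (hq i).mono (Set.inter_subset_right.trans (Set.iInter_subset W i)))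
  rw [h1]
  conv_rhs => rw [← map_fam X, Multiset.map_map]
  simp only [map_fam]
  rfl

end Germs

/-! ### Partition functions and their difference equation. -/

section Partitions

variable {V : Type*} [NormedAddCommGroup V] [NormedSpace ℝ V] {Λ : Submodule ℤ V}

theorem finite_partitions {N : ℕ} {X : Fin N → Λ} (ℓ : V →ₗ[ℝ] ℝ) (hℓ : ∀ i, 0 < ℓ (X i))
    (v : Λ) : {n : Fin N → ℕ | ∑ i, n i • X i = v}.Finite := by
  refine (Set.Finite.pi' (t := fun i => Set.Iic ⌊ℓ v / ℓ (X i)⌋₊)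
    fun i => Set.finite_Iic _).subset fun n hn i => ?_
  rw [Set.mem_Iic]
  refine Nat.le_floor ?_
  rw [le_div_iff₀ (hℓ i)]
  have h1 : ((∑ i, n i • X i : Λ) : V) = v := congrArg _ hn
  have h2 : ∑ i, (n i : ℝ) * ℓ (X i) = ℓ v := by
    rw [← h1]
    simp
  rw [← h2]
  exact Finset.single_le_sum (f := fun i => (n i : ℝ) * ℓ (X i))
    (fun j _ => mul_nonneg (Nat.cast_nonneg _) (hℓ j).le) (Finset.mem_univ i)

theorem partitionFunction_comp_equiv {N M : ℕ} (e : Fin N ≃ Fin M) (X : Fin M → Λ) (v : Λ) :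
    partitionFunction (X ∘ e) v = partitionFunction X v := by
  unfold partitionFunction
  refine Set.ncard_congr (fun n _ => n ∘ e.symm) ?_ ?_ ?_
  · intro n hn
    rw [Set.mem_ofPred_eq] at hn ⊢
    rw [← hn, ← e.sum_comp]
    simp
  · intro n m _ _ h
    funext i
    have := congrFun h (e i)
    simpa using this
  · intro n hn
    refine ⟨n ∘ e, ?_, by ext; simp⟩
    rw [Set.mem_ofPred_eq] at hn ⊢
    rw [← hn, ← e.sum_comp]
    simp

/-- Either a is not used, or one copy of it can be taken away. Positivity of ℓ provides the
finiteness needed for `Set.ncard` to be additive, its value on infinite sets being 0. -/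
theorem partitionFunction_cons {N : ℕ} {a : Λ} {X : Fin N → Λ} (ℓ : V →ₗ[ℝ] ℝ) (ha : 0 < ℓ a)
    (hℓ : ∀ i, 0 < ℓ (X i)) (v : Λ) :
    partitionFunction (Fin.cons a X : Fin (N + 1) → Λ) v =
      partitionFunction X v + partitionFunction (Fin.cons a X : Fin (N + 1) → Λ) (v - a) := by
  have hpos : ∀ i, 0 < ℓ ((Fin.cons a X : Fin (N + 1) → Λ) i) := by
    intro j
    refine Fin.cases ?_ (fun i => ?_) j
    · simpa using ha
    · simpa using hℓ i
  have hsum : ∀ n : Fin (N + 1) → ℕ, ∑ i, n i • (Fin.cons a X : Fin (N + 1) → Λ) i =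
      n 0 • a + ∑ i, n i.succ • X i := by
    intro n
    rw [Fin.sum_univ_succ]
    simp
  unfold partitionFunction
  have e : {n : Fin (N + 1) → ℕ | ∑ i, n i • (Fin.cons a X : Fin (N + 1) → Λ) i = v} =
      (fun n : Fin N → ℕ => (Fin.cons 0 n : Fin (N + 1) → ℕ)) '' {n | ∑ i, n i • X i = v} ∪
      (fun n : Fin (N + 1) → ℕ => (Fin.cons (n 0 + 1) (fun i => n i.succ) : Fin (N + 1) → ℕ)) ''
        {n | ∑ i, n i • (Fin.cons a X : Fin (N + 1) → Λ) i = v - a} := by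
    ext n
    simp only [Set.mem_union, Set.mem_image, Set.mem_ofPred_eq, hsum]
    constructor
    · intro h
      rcases hn : n 0 with _ | k
      · left
        refine ⟨fun i => n i.succ, ?_, ?_⟩
        · rw [← h, hn]; simp
        · refine funext fun j => Fin.cases ?_ (fun i => ?_) j
          · simp [hn]
          · simp
      · right
        refine ⟨Fin.cons k fun i => n i.succ, ?_, ?_⟩
        · rw [← h, hn]
          simp only [Fin.cons_zero, Fin.cons_succ, succ_nsmul]
          abel
        · refine funext fun j => Fin.cases ?_ (fun i => ?_) j
          · simp [hn]
          · simp
    · rintro (⟨m, hm, rfl⟩ | ⟨m, hm, rfl⟩)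
      · simpa using hm
      · simp only [Fin.cons_zero, Fin.cons_succ, succ_nsmul]
        rw [eq_sub_iff_add_eq] at hm
        rw [← hm]
        abel
  rw [e, Set.ncard_union_eq ?_ ((finite_partitions ℓ hℓ v).image _)
    ((finite_partitions ℓ hpos (v - a)).image _), Set.ncard_image_of_injective,
    Set.ncard_image_of_injective]
  · intro n m h
    refine funext fun j => Fin.cases ?_ (fun i => ?_) j
    · have := congrFun h 0
      simpa using this
    · have := congrFun h i.succ
      simpa using this
  · intro n m h
    funext i
    have := congrFun h i.succ
    simpa using this
  · rw [Set.disjoint_left]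
    rintro _ ⟨m, _, rfl⟩ ⟨m', _, h⟩
    have := congrFun h 0
    simp at this

/-- The partition function of a multiset of lattice vectors. -/
def msPartition (X : Multiset Λ) (v : Λ) : ℕ := partitionFunction (fam X) v

theorem msPartition_map {N : ℕ} (X : Fin N → Λ) (v : Λ) :
    msPartition (Finset.univ.val.map X) v = partitionFunction X v := by
  obtain ⟨e, he⟩ := exists_equiv_of_map_eq _ X (map_fam (Finset.univ.val.map X))
  rw [msPartition, he, partitionFunction_comp_equiv]

theorem msPartition_cons {a : Λ} {X : Multiset Λ} (ℓ : V →ₗ[ℝ] ℝ) (hℓ : ∀ w ∈ a ::ₘ X, 0 < ℓ w)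
    (v : Λ) : msPartition (a ::ₘ X) v = msPartition X v + msPartition (a ::ₘ X) (v - a) := by
  have h := partitionFunction_cons ℓ (hℓ a (Multiset.mem_cons_self a X))
    (X := fam X) (fun i => hℓ _ (Multiset.mem_cons_of_mem (fam_mem X i))) v
  rwa [← msPartition_map, ← msPartition_map, ← msPartition_map, map_finCons, map_fam] at h

theorem exists_of_msPartition_ne_zero {X : Multiset Λ} {v : Λ} (h : msPartition X v ≠ 0) :
    ∃ n : Fin X.toList.length → ℕ, ∑ i, n i • fam X i = v := by
  have := Set.nonempty_of_ncard_ne_zero h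
  exact this

theorem mem_span_of_msPartition_ne_zero {X : Multiset Λ} {v : Λ} (h : msPartition X v ≠ 0) :
    (v : V) ∈ Submodule.span ℝ≥0 {w | w ∈ X.map ((↑) : Λ → V)} := by
  obtain ⟨n, hn⟩ := exists_of_msPartition_ne_zero h
  have : (v : V) = ∑ i, (n i : ℝ≥0) • ((fam X i : Λ) : V) := by
    rw [← hn]
    simp [Nat.cast_smul_eq_nsmul]
  rw [this]
  exact Submodule.sum_mem _ fun i _ => Submodule.smul_mem _ _ (Submodule.subset_span
    (Multiset.mem_map_of_mem _ (fam_mem X i)))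

theorem msPartition_eq_zero_of_neg {X : Multiset Λ} (ℓ : V →ₗ[ℝ] ℝ) (hℓ : ∀ w ∈ X, 0 < ℓ w)
    {v : Λ} (hv : ℓ v < 0) : msPartition X v = 0 := by
  by_contra h
  obtain ⟨n, hn⟩ := exists_of_msPartition_ne_zero h
  have : ℓ v = ∑ i, (n i : ℝ) * ℓ ((fam X i : Λ) : V) := by
    rw [← hn]
    simp
  rw [this] at hv
  exact absurd hv (not_lt.2 (Finset.sum_nonneg fun i _ =>
    mul_nonneg (Nat.cast_nonneg _) (hℓ _ (fam_mem X i)).le))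

end Partitions

/-! ### Characters of the lattice and the points of the arrangement. -/

section Characters

variable {V : Type*} [NormedAddCommGroup V] [NormedSpace ℝ V] [FiniteDimensional ℝ V]
  {Λ : Submodule ℤ V}

/-- Discreteness makes integral and real rank agree. This yields both the finiteness of quotients by
full-rank sublattices and the passage from integral to real independence. -/
theorem finrank_real_span_eq [DiscreteTopology Λ] (s : Set Λ) :
    Module.finrank ℝ (Submodule.span ℝ (((↑) : Λ → V) '' s)) =
      Module.finrank ℤ (Submodule.span ℤ s) := by
  have hle : Submodule.span ℤ (((↑) : Λ → V) '' s) ≤ Λ := by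
    rw [Submodule.span_le]
    rintro _ ⟨w, -, rfl⟩
    exact w.2
  have hd : DiscreteTopology (Submodule.span ℤ (((↑) : Λ → V) '' s)) :=
    DiscreteTopology.of_subset (s := (Λ : Set V)) (by assumption) hle
  have h := Real.finrank_eq_int_finrank_of_discrete hd
  have e : Submodule.span ℤ (((↑) : Λ → V) '' s) = (Submodule.span ℤ s).map Λ.subtype := by
    rw [Submodule.map_span]
    rfl
  rw [Set.finrank, Set.finrank, e] at h
  rw [h]
  exact LinearEquiv.finrank_eq
    (Submodule.equivMapOfInjective Λ.subtype Subtype.val_injective (Submodule.span ℤ s)).symm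

variable [DiscreteTopology Λ] [IsZLattice ℝ Λ]

theorem finite_quotient_span {s : Set Λ} (hs : Submodule.span ℝ (((↑) : Λ → V) '' s) = ⊤) :
    Finite (Λ ⧸ Submodule.span ℤ s) := by
  have := ZLattice.module_finite ℝ Λ
  have := ZLattice.module_free ℝ Λ
  rw [Submodule.finiteQuotient_iff, ← finrank_real_span_eq, hs, finrank_top, ZLattice.rank ℝ Λ]

theorem apply_eq_one_of_mem_span {χ : AddChar Λ ℂ} {s : Set Λ} (h : ∀ a ∈ s, χ a = 1) {v : Λ}
    (hv : v ∈ Submodule.span ℤ s) : χ v = 1 := by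
  induction hv using Submodule.span_induction with
  | mem x hx => exact h x hx
  | zero => exact χ.map_zero_eq_one
  | add x y _ _ hx hy => rw [χ.map_add_eq_mul, hx, hy, one_mul]
  | smul n x _ hx => rw [χ.map_zsmul_eq_zpow, hx, one_zpow]

theorem setOf_char_eq_range (s : Set Λ) : {χ : AddChar Λ ℂ | ∀ a ∈ s, χ a = 1} =
    Set.range fun ψ : AddChar (Λ ⧸ Submodule.span ℤ s) ℂ =>
      ψ.compAddMonoidHom (Submodule.span ℤ s).mkQ.toAddMonoidHom := by
  ext χ
  constructor
  · intro hχ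
    let f : Λ ⧸ (Submodule.span ℤ s).toAddSubgroup →+ Additive ℂ :=
      QuotientAddGroup.lift _ (AddChar.toAddMonoidHom χ) fun v hv =>
        congrArg Additive.ofMul (apply_eq_one_of_mem_span hχ hv)
    exact ⟨AddChar.toAddMonoidHomEquiv.symm f, DFunLike.ext _ _ fun v => rfl⟩
  · rintro ⟨ψ, rfl⟩ a ha
    have : (Submodule.span ℤ s).mkQ a = 0 := by
      rw [Submodule.mkQ_apply, Submodule.Quotient.mk_eq_zero]
      exact Submodule.subset_span ha
    change ψ ((Submodule.span ℤ s).mkQ a) = 1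
    rw [this, ψ.map_zero_eq_one]

theorem finite_char {s : Set Λ} (hs : Submodule.span ℝ (((↑) : Λ → V) '' s) = ⊤) :
    {χ : AddChar Λ ℂ | ∀ a ∈ s, χ a = 1}.Finite := by
  have := finite_quotient_span hs
  rw [setOf_char_eq_range]
  exact Set.finite_range _

/-- A finite S has finitely many spanning subsets s, and the characters trivial on one such s are
characters of the finite group Λ / span s. -/
theorem finite_char_span {S : Set Λ} (hS : S.Finite) :
    {χ : AddChar Λ ℂ | Submodule.span ℝ (((↑) : Λ → V) '' {a | a ∈ S ∧ χ a = 1}) = ⊤}.Finite := by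
  have : {χ : AddChar Λ ℂ | Submodule.span ℝ (((↑) : Λ → V) '' {a | a ∈ S ∧ χ a = 1}) = ⊤} ⊆
      ⋃ s ∈ {s : Set Λ | s ⊆ S ∧ Submodule.span ℝ (((↑) : Λ → V) '' s) = ⊤},
        {χ : AddChar Λ ℂ | ∀ a ∈ s, χ a = 1} := by
    intro χ hχ
    refine Set.mem_biUnion (x := {a | a ∈ S ∧ χ a = 1}) ⟨fun a ha => ha.1, hχ⟩ fun a ha => ha.2
  refine Set.Finite.subset (Set.Finite.biUnion ?_ fun s hs => finite_char hs.2) this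
  exact hS.finite_subsets.subset fun s hs => hs.1

theorem mem_arrangementPoints_iff {N : ℕ} (X : Fin N → Λ) (χ : AddChar Λ ℂ) :
    χ ∈ arrangementPoints X ↔ Submodule.span ℝ (Set.range (localList X χ)) = ⊤ := by
  constructor
  · rintro ⟨b, -, hb, h1⟩
    rw [← top_le_iff, ← hb]
    refine Submodule.span_mono ?_
    rintro _ ⟨i, hi, rfl⟩
    exact ⟨⟨i, h1 i hi⟩, rfl⟩
  · intro h
    obtain ⟨b, hb, hspan, hli⟩ := exists_linearIndependent ℝ (Set.range (localList X χ))
    -- The list may contain repetitions, so one index is chosen for each vector of the extracted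
    -- basis.
    choose f hf using fun w : b => hb w.2
    have hf' : ∀ w, ((X (f w).1 : Λ) : V) = w := hf
    refine ⟨Set.range fun w => (f w).1, ?_, ?_, ?_⟩
    · let g : Set.range (fun w => (f w).1) → b := fun i => ⟨X i.1, by
        obtain ⟨_, w, rfl⟩ := i
        exact (hf' w).symm ▸ w.2⟩
      have hg : Function.Injective g := by
        rintro ⟨_, w, rfl⟩ ⟨_, w', rfl⟩ h
        have h3 : ((X (f w).1 : Λ) : V) = X (f w').1 := congrArg (Subtype.val : b → V) h
        rw [hf', hf'] at h3
        rw [Subtype.ext h3]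
      exact hli.comp g hg
    · rw [← h, ← hspan, ← Set.range_comp]
      congr 1
      have : (fun i => ((X i : Λ) : V)) ∘ (fun w => (f w).1) = ((↑) : b → V) := funext hf'
      rw [this, Subtype.range_coe]
    · rintro _ ⟨w, rfl⟩
      exact (f w).2

theorem finite_arrangementPoints {N : ℕ} (X : Fin N → Λ) : (arrangementPoints X).Finite := by
  refine (finite_char_span (Set.finite_range X)).subset fun χ hχ => ?_
  rw [mem_arrangementPoints_iff] at hχ
  rw [Set.mem_ofPred_eq, ← hχ]
  congr 1
  ext w
  constructor
  · rintro ⟨_, ⟨⟨i, rfl⟩, hi⟩, rfl⟩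
    exact ⟨⟨i, hi⟩, rfl⟩
  · rintro ⟨i, rfl⟩
    exact ⟨X i.1, ⟨⟨i.1, rfl⟩, i.2⟩, rfl⟩

theorem char_ne_zero (χ : AddChar Λ ℂ) (v : Λ) : χ v ≠ 0 := by
  intro h
  have h1 : χ (v + -v) = 1 := by rw [add_neg_cancel, χ.map_zero_eq_one]
  rw [χ.map_add_eq_mul, h, zero_mul] at h1
  exact zero_ne_one h1

theorem char_sub (χ : AddChar Λ ℂ) (v w : Λ) : χ (v - w) = χ v * (χ w)⁻¹ := by
  rw [eq_mul_inv_iff_mul_eq₀ (char_ne_zero χ w), ← χ.map_add_eq_mul, sub_add_cancel]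

/-- A ℤ-basis of Λ is an ℝ-basis of V, so φ may be prescribed on it by choosing logarithms. -/
theorem exists_represents (χ : AddChar Λ ℂ) : ∃ φ : V →ₗ[ℝ] ℂ, Represents φ χ := by
  have := ZLattice.module_finite ℝ Λ
  have := ZLattice.module_free ℝ Λ
  let b := Module.Free.chooseBasis ℤ Λ
  let B := b.ofZLatticeBasis ℝ Λ
  let φ : V →ₗ[ℝ] ℂ := B.constr ℝ fun i => Complex.log (χ (b i))
  have hφ : ∀ i, Complex.exp (φ (b i)) = χ (b i) := by
    intro i
    have : φ (b i) = Complex.log (χ (b i)) := by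
      rw [← b.ofZLatticeBasis_apply ℝ Λ i]
      exact B.constr_basis ℝ _ i
    rw [this, Complex.exp_log (char_ne_zero χ _)]
  refine ⟨φ, fun v => ?_⟩
  have hv : v ∈ Submodule.span ℤ (Set.range b) := by rw [b.span_eq]; trivial
  induction hv using Submodule.span_induction with
  | mem x hx =>
    obtain ⟨i, rfl⟩ := hx
    exact (hφ i).symm
  | zero => simp
  | add x y _ _ hx hy => rw [χ.map_add_eq_mul, hx, hy, ← Complex.exp_add]; simp
  | smul n x _ hx =>
    rw [χ.map_zsmul_eq_zpow, hx, ← Complex.exp_int_mul]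
    simp

end Characters

/-! ### The Todd-type operator of a character and a multiset. -/

section CharOp

variable {V : Type*} [NormedAddCommGroup V] [NormedSpace ℝ V] [FiniteDimensional ℝ V]
  {Λ : Submodule ℤ V}

/-- The endomorphism ring is not commutative, so a product over a multiset makes sense only because
the factors commute with each other. -/
instance (χ : AddChar Λ ℂ) : LeftCommutative fun (a : Λ) (T : Module.End ℂ (PolyFun V)) =>
    serOp (a : V) (toddFactor (χ a)) * T :=
  ⟨fun a b T => by rw [← mul_assoc, (commute_serOp _ _ _ _).eq, mul_assoc]⟩

/-- The operator `∏ Fₐ(Dₐ)`, where `Fₐ` is the factor attached to the value `χ a`. -/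
def charOp (χ : AddChar Λ ℂ) (X : Multiset Λ) : Module.End ℂ (PolyFun V) :=
  X.foldr (fun (a : Λ) (T : Module.End ℂ (PolyFun V)) => serOp (a : V) (toddFactor (χ a)) * T) 1

theorem charOp_zero (χ : AddChar Λ ℂ) : charOp χ (0 : Multiset Λ) = 1 := rfl

theorem charOp_cons (χ : AddChar Λ ℂ) (a : Λ) (X : Multiset Λ) :
    charOp χ (a ::ₘ X) = serOp (a : V) (toddFactor (χ a)) * charOp χ X :=
  Multiset.foldr_cons ..

theorem charOp_cons_apply (χ : AddChar Λ ℂ) (a : Λ) (X : Multiset Λ) (p : PolyFun V) :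
    charOp χ (a ::ₘ X) p = serOp (a : V) (toddFactor (χ a)) (charOp χ X p) := by
  rw [charOp_cons]
  rfl

theorem mvOp_localSeries {N : ℕ} (X : Fin N → Λ) (χ : AddChar Λ ℂ) :
    mvOp (fun i => (X i : V)) (localSeries X χ) = charOp χ (Finset.univ.val.map X) := by
  rw [localSeries, mvOp_toddSeries]
  have h : ∀ l : List (Fin N), (l.map fun i => serOp (X i : V) (toddFactor (χ (X i)))).prod =
      charOp χ ((l.map X : List Λ) : Multiset Λ) := by
    intro l
    induction l with
    | nil => rfl
    | cons i l ih =>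
      rw [List.map_cons, List.prod_cons, ih, List.map_cons, ← Multiset.cons_coe, charOp_cons]
  rw [h, Fin.univ_val_map, List.ofFn_eq_map]

theorem charOp_polyDeriv (χ : AddChar Λ ℂ) (X : Multiset Λ) (w : V) (p : PolyFun V) :
    charOp χ X (polyDeriv w p) = polyDeriv w (charOp χ X p) := by
  induction X using Multiset.induction_on with
  | empty => rfl
  | cons a X ih => rw [charOp_cons_apply, charOp_cons_apply, ih, serOp_polyDeriv_apply]

/-- Since 1 - e^{-z} has no constant term, it is z times the series of which `toddFactor 1` is the
inverse. -/
theorem one_sub_expNegSeries_mul_toddFactor :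
    (1 - expNegSeries) * toddFactor 1 = PowerSeries.X := by
  have h0 : PowerSeries.coeff 0 (1 - expNegSeries) = 0 := by
    rw [map_sub, coeff_expNegSeries]; simp
  have h1 : 1 - expNegSeries = PowerSeries.X *
      (PowerSeries.mk fun k => PowerSeries.coeff (k + 1) (1 - expNegSeries)) := by
    refine PowerSeries.ext fun n => ?_
    cases n with
    | zero => rw [h0]; simp
    | succ n => rw [PowerSeries.coeff_succ_X_mul, PowerSeries.coeff_mk]
  have hc : PowerSeries.constantCoeff
      (PowerSeries.mk fun k => PowerSeries.coeff (k + 1) (1 - expNegSeries)) ≠ 0 := by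
    rw [← PowerSeries.coeff_zero_eq_constantCoeff_apply, PowerSeries.coeff_mk, map_sub,
      coeff_expNegSeries]
    simp [PowerSeries.coeff_one]
  rw [toddFactor, if_pos rfl]
  nth_rewrite 1 [h1]
  rw [mul_assoc, PowerSeries.mul_inv_cancel _ hc, mul_one]

theorem one_sub_mul_toddFactor {c : ℂ} (hc : c ≠ 1) :
    (1 - PowerSeries.C c⁻¹ * expNegSeries) * toddFactor c = 1 := by
  rw [toddFactor, if_neg hc]
  refine PowerSeries.mul_inv_cancel _ ?_
  have h0 : PowerSeries.constantCoeff expNegSeries = 1 := by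
    rw [← PowerSeries.coeff_zero_eq_constantCoeff_apply, coeff_expNegSeries]; simp
  rw [map_sub, map_mul, h0, map_one, PowerSeries.constantCoeff_C, mul_one, sub_ne_zero]
  intro h
  exact hc (inv_eq_one.1 h.symm)

end CharOp

/-! ### Generic points. -/

section Generic

variable {V : Type*} [NormedAddCommGroup V] [NormedSpace ℝ V] [FiniteDimensional ℝ V]

/-- The point `x` lies in no proper subspace spanned by vectors of `Λ`. -/
def IsGeneric (Λ : Submodule ℤ V) (x : V) : Prop :=
  ∀ s : Set V, s ⊆ Λ → Submodule.span ℝ s ≠ ⊤ → x ∉ Submodule.span ℝ s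

variable [MeasurableSpace V] [BorelSpace V]

/-- The countable lattice has countably many finite subsets, so the proper subspaces they span form
a null set, which cannot contain U. Finite subsets suffice because every span is already spanned by
a linearly independent subset. -/
theorem exists_isGeneric (Λ : Submodule ℤ V) [DiscreteTopology Λ] [IsZLattice ℝ Λ] {U : Set V}
    (hU : IsOpen U) (hne : U.Nonempty) : ∃ x ∈ U, IsGeneric Λ x := by
  let ν : Measure V := Measure.addHaar
  have hc : (Λ : Set V).Countable := Set.countable_coe_iff.1 (inferInstanceAs (Countable Λ))
  let S : Set (Set V) := {s | s.Finite ∧ s ⊆ Λ ∧ Submodule.span ℝ s ≠ ⊤}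
  have hS : S.Countable :=
    (Set.countable_ofPred_finite_subset hc).mono fun s (hs : _ ∧ _) => And.intro hs.1 hs.2.1
  have h0 : ν (⋃ s ∈ S, (Submodule.span ℝ s : Set V)) = 0 :=
    (measure_biUnion_null_iff hS).2 fun s hs => Measure.addHaar_submodule ν _ hs.2.2
  have hpos : 0 < ν U := hU.measure_pos ν hne
  obtain ⟨x, hxU, hx⟩ : ∃ x ∈ U, x ∉ ⋃ s ∈ S, (Submodule.span ℝ s : Set V) := by
    by_contra hcon
    push Not at hcon
    exact hpos.ne' (measure_mono_null hcon h0)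
  refine ⟨x, hxU, fun s hs hsp hxs => ?_⟩
  obtain ⟨b, hb, hspan, hli⟩ := exists_linearIndependent ℝ s
  refine hx (Set.mem_biUnion (x := b) ⟨hli.setFinite, hb.trans hs, ?_⟩ ?_)
  · rwa [hspan]
  · rw [SetLike.mem_coe, hspan]
    exact hxs

variable {Λ : Submodule ℤ V} {x : V}

/-- Genericity refers to all subsets of Λ rather than to one list, so that x stays non-singular for
every auxiliary list created by partial fractions. -/
theorem IsGeneric.exists_isGerm {ν : Measure V} [ν.IsAddHaarMeasure] (hx : IsGeneric Λ x)
    {X : Multiset Λ} (ℓ : V →ₗ[ℝ] ℝ) (hℓ : ∀ v ∈ X, 0 < ℓ v) :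
    ∃ p, IsGerm ν x (X.map (↑)) p := by
  refine PartitionSpline.exists_isGerm ℓ ?_ ?_
  · intro v hv
    obtain ⟨w, hw, rfl⟩ := Multiset.mem_map.1 hv
    exact hℓ w hw
  · rintro ⟨A, hA, hxA⟩
    refine hx _ ?_ hA (cone_subset_span _ A hxA)
    rintro _ ⟨i, -, rfl⟩
    obtain ⟨w, -, hw⟩ := Multiset.mem_map.1 (fam_mem (X.map ((↑) : Λ → V)) i)
    rw [← hw]
    exact w.2

theorem IsGeneric.span_eq_top (hx : IsGeneric Λ x) {X : Multiset Λ}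
    (h : x ∈ Submodule.span ℝ≥0 {v | v ∈ X.map ((↑) : Λ → V)}) :
    Submodule.span ℝ (((↑) : Λ → V) '' {a | a ∈ X}) = ⊤ := by
  by_contra hne
  refine hx _ ?_ hne ?_
  · rintro _ ⟨w, -, rfl⟩
    exact w.2
  · have e : {v | v ∈ X.map ((↑) : Λ → V)} = ((↑) : Λ → V) '' {a | a ∈ X} := by
      ext v
      simp [Multiset.mem_map]
    rw [e] at h
    exact Submodule.span_le_restrictScalars ℝ≥0 ℝ _ h

end Generic

/-! ### The spline formula with germs at a generic point. -/

section Formula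

variable {V : Type*} [NormedAddCommGroup V] [NormedSpace ℝ V] [FiniteDimensional ℝ V]
  [MeasurableSpace V] [BorelSpace V] {Λ : Submodule ℤ V}

open Classical in
/-- The germ at `x` of the density attached to the elements of `X` on which `χ` is trivial. -/
def charGerm (ν : Measure V) (x : V) (χ : AddChar Λ ℂ) (X : Multiset Λ) : PolyFun V :=
  germ ν x ((X.filter fun a => χ a = 1).map (↑))

/-- The contribution of `χ` to the spline formula with germs taken at `x`. -/
def charTerm (ν : Measure V) (x : V) (X : Multiset Λ) (v : Λ) (χ : AddChar Λ ℂ) : ℂ :=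
  χ v * (charOp χ X (charGerm ν x χ X) : V → ℂ) v

/-- The spline formula with germs taken at `x`. -/
def splineSum (ν : Measure V) (x : V) (X : Multiset Λ) (v : Λ) : ℂ :=
  ∑ᶠ χ : AddChar Λ ℂ, charTerm ν x X v χ

variable {ν : Measure V} [ν.IsAddHaarMeasure] {x : V} {X : Multiset Λ}

theorem charGerm_eq_zero (ℓ : V →ₗ[ℝ] ℝ) (hℓ : ∀ v ∈ X, 0 < ℓ v) (χ : AddChar Λ ℂ)
    (hx : x ∉ Submodule.span ℝ≥0 {v | v ∈ X.map ((↑) : Λ → V)}) : charGerm ν x χ X = 0 := by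
  classical
  refine germ_eq_zero ℓ ?_ fun h => hx (Submodule.span_mono ?_ h)
  · intro v hv
    obtain ⟨w, hw, rfl⟩ := Multiset.mem_map.1 hv
    exact hℓ w (Multiset.mem_of_mem_filter hw)
  · intro v hv
    obtain ⟨w, hw, rfl⟩ := Multiset.mem_map.1 hv
    exact Multiset.mem_map_of_mem _ (Multiset.mem_of_mem_filter hw)

theorem splineSum_eq_zero (ℓ : V →ₗ[ℝ] ℝ) (hℓ : ∀ v ∈ X, 0 < ℓ v) (v : Λ)
    (hx : x ∉ Submodule.span ℝ≥0 {v | v ∈ X.map ((↑) : Λ → V)}) : splineSum ν x X v = 0 := by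
  refine finsum_eq_zero_of_forall_eq_zero fun χ => ?_
  rw [charTerm, charGerm_eq_zero ℓ hℓ χ hx, map_zero]
  simp

/-- If the vectors with χ = 1 do not span, their cone misses the generic point x and the germ is
zero. The sum over all characters is thus a finite one. -/
theorem IsGeneric.span_of_charTerm_ne_zero (hx : IsGeneric Λ x) (ℓ : V →ₗ[ℝ] ℝ)
    (hℓ : ∀ v ∈ X, 0 < ℓ v) {v : Λ} {χ : AddChar Λ ℂ} (h : charTerm ν x X v χ ≠ 0) :
    Submodule.span ℝ (((↑) : Λ → V) '' {a | a ∈ X ∧ χ a = 1}) = ⊤ := by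
  classical
  have := hx.span_eq_top (X := X.filter fun a => χ a = 1) (by
    by_contra hn
    apply h
    have hz : charGerm ν x χ X = 0 := by
      refine germ_eq_zero ℓ ?_ hn
      intro v hv
      obtain ⟨w, hw, rfl⟩ := Multiset.mem_map.1 hv
      exact hℓ w (Multiset.mem_of_mem_filter hw)
    rw [charTerm, hz, map_zero]
    simp)
  simpa [Multiset.mem_filter] using this

theorem IsGeneric.finite_support_charTerm [DiscreteTopology Λ] [IsZLattice ℝ Λ]
    (hx : IsGeneric Λ x) (ℓ : V →ₗ[ℝ] ℝ) (hℓ : ∀ v ∈ X, 0 < ℓ v) (v : Λ) :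
    (Function.support (charTerm ν x X v)).Finite := by
  classical
  refine (finite_char_span (S := {a | a ∈ X}) ?_).subset fun χ hχ =>
    hx.span_of_charTerm_ne_zero ℓ hℓ hχ
  exact (X.toFinset.finite_toSet).subset fun a ha => by simpa using ha

/-- The left side applies 1 - χ(a)⁻¹ e^{-D_a}. If χ a = 1, this times the factor of a leaves D_a,
which removes a from the germ. If χ a ≠ 1, it cancels the factor exactly, and a does not enter the
germ. -/
theorem IsGeneric.charTerm_cons [DiscreteTopology Λ] [IsZLattice ℝ Λ] (hx : IsGeneric Λ x) (ℓ : V →ₗ[ℝ] ℝ) {a : Λ}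
    (hℓ : ∀ v ∈ a ::ₘ X, 0 < ℓ v) (v : Λ) (χ : AddChar Λ ℂ) :
    charTerm ν x (a ::ₘ X) v χ - charTerm ν x (a ::ₘ X) (v - a) χ = charTerm ν x X v χ := by
  classical
  unfold charTerm
  by_cases h1 : χ a = 1
  · have hg : polyDeriv (a : V) (charGerm ν x χ (a ::ₘ X)) = charGerm ν x χ X := by
      have hpos : ∀ w ∈ a ::ₘ X.filter fun a => χ a = 1, 0 < ℓ w := by
        intro w hw
        refine hℓ w ?_
        rcases Multiset.mem_cons.1 hw with rfl | hw
        · exact Multiset.mem_cons_self _ _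
        · exact Multiset.mem_cons_of_mem (Multiset.mem_of_mem_filter hw)
      have h := hx.exists_isGerm (ν := ν) ℓ hpos
      rw [Multiset.map_cons] at h
      rw [charGerm, charGerm, Multiset.filter_cons_of_pos (p := fun a => χ a = 1) X h1,
        Multiset.map_cons]
      refine polyDeriv_germ_cons ℓ ?_ h
      intro w hw
      rw [← Multiset.map_cons] at hw
      obtain ⟨w', hw', rfl⟩ := Multiset.mem_map.1 hw
      exact hpos w' hw'
    rw [char_sub, h1, inv_one, mul_one, Submodule.coe_sub, ← serOp_expNegSeries, ← mul_sub]
    congr 1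
    have key : charOp χ (a ::ₘ X) (charGerm ν x χ (a ::ₘ X)) -
        serOp (a : V) expNegSeries (charOp χ (a ::ₘ X) (charGerm ν x χ (a ::ₘ X))) =
        charOp χ X (charGerm ν x χ X) := by
      have h2 : ∀ p : PolyFun V, p - serOp (a : V) expNegSeries p =
          serOp (a : V) (1 - expNegSeries) p := by
        intro p
        rw [map_sub, map_one]
        rfl
      rw [h2, charOp_cons_apply, h1, ← Module.End.mul_apply, ← map_mul,
        one_sub_expNegSeries_mul_toddFactor, serOp_X, ← charOp_polyDeriv, hg]
    rw [← key]
    rfl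
  · have hg : charGerm ν x χ (a ::ₘ X) = charGerm ν x χ X := by
      rw [charGerm, charGerm, Multiset.filter_cons_of_neg (p := fun a => χ a = 1) X h1]
    rw [char_sub, Submodule.coe_sub, ← serOp_expNegSeries, mul_assoc, ← mul_sub, hg]
    congr 1
    have key : charOp χ (a ::ₘ X) (charGerm ν x χ X) -
        (χ a)⁻¹ • serOp (a : V) expNegSeries (charOp χ (a ::ₘ X) (charGerm ν x χ X)) =
        charOp χ X (charGerm ν x χ X) := by
      have h2 : ∀ p : PolyFun V, p - (χ a)⁻¹ • serOp (a : V) expNegSeries p =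
          serOp (a : V) (1 - PowerSeries.C (χ a)⁻¹ * expNegSeries) p := by
        intro p
        rw [map_sub, map_one, map_mul, serOp_C]
        rfl
      rw [h2, charOp_cons_apply, ← Module.End.mul_apply, ← map_mul,
        one_sub_mul_toddFactor h1, map_one]
      rfl
    rw [← key]
    rfl

theorem IsGeneric.splineSum_cons [DiscreteTopology Λ] [IsZLattice ℝ Λ]
    (hx : IsGeneric Λ x) (ℓ : V →ₗ[ℝ] ℝ) {a : Λ}
    (hℓ : ∀ v ∈ a ::ₘ X, 0 < ℓ v) (v : Λ) :
    splineSum ν x (a ::ₘ X) v = splineSum ν x X v + splineSum ν x (a ::ₘ X) (v - a) := by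
  rw [← sub_eq_iff_eq_add]
  unfold splineSum
  rw [← finsum_sub_distrib (hx.finite_support_charTerm ℓ hℓ v)
    (hx.finite_support_charTerm ℓ hℓ (v - a))]
  exact finsum_congr fun χ => hx.charTerm_cons ℓ hℓ v χ

end Formula

/-! ### Reduction to linearly independent support by partial fractions. -/

section PartialFractions

open scoped Pointwise

variable {V : Type*} [NormedAddCommGroup V] [NormedSpace ℝ V] {Λ : Submodule ℤ V}

/-- The sum of the segments `[0, a]`, `a ∈ X`. -/
def zonotope (X : Multiset Λ) : Set V :=
  (X.map fun a : Λ => (fun s : ℝ => s • (a : V)) '' Set.Icc 0 1).sum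

theorem mem_zonotope_cons {a : Λ} {X : Multiset Λ} {y : V} :
    y ∈ zonotope (a ::ₘ X) ↔ ∃ s : ℝ, 0 ≤ s ∧ s ≤ 1 ∧ y - s • (a : V) ∈ zonotope X := by
  rw [zonotope, Multiset.map_cons, Multiset.sum_cons, Set.mem_add]
  constructor
  · rintro ⟨_, ⟨s, hs, rfl⟩, z, hz, rfl⟩
    exact ⟨s, hs.1, hs.2, by rw [add_sub_cancel_left]; exact hz⟩
  · rintro ⟨s, h0, h1, h⟩
    exact ⟨_, ⟨s, ⟨h0, h1⟩, rfl⟩, _, h, by simp⟩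

theorem mem_zonotope_cons_of_sub {a : Λ} {X : Multiset Λ} {y : V} {s : ℝ} (h0 : 0 ≤ s) (h1 : s ≤ 1)
    (h : y - s • (a : V) ∈ zonotope X) : y ∈ zonotope (a ::ₘ X) :=
  mem_zonotope_cons.2 ⟨s, h0, h1, h⟩

/-- The function `D X` vanishes at the lattice points `v` with `x - v` in the zonotope of `X`. -/
def VanishesNear (D : Multiset Λ → Λ → ℂ) (x : V) (X : Multiset Λ) : Prop :=
  ∀ v : Λ, x - v ∈ zonotope X → D X v = 0

/-- `VanishesNear` for all multisets with elements in `A`. -/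
def VanishesOver (D : Multiset Λ → Λ → ℂ) (x : V) (A : Set Λ) : Prop :=
  ∀ X : Multiset Λ, (∀ w ∈ X, w ∈ A) → VanishesNear D x X

theorem VanishesOver.mono {D : Multiset Λ → Λ → ℂ} {x : V} {A B : Set Λ} (h : VanishesOver D x B)
    (hAB : A ⊆ B) : VanishesOver D x A :=
  fun X hX => h X fun w hw => hAB (hX w hw)

variable {D : Multiset Λ → Λ → ℂ} {ℓ : V →ₗ[ℝ] ℝ} {x : V}

/-- This reflects 1/((1-α)(1-β)) = 1/((1-αβ)(1-β)) + α/((1-αβ)(1-α)), or the same identity with α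
and β exchanged. Let s, t be the zonotope coordinates of x - v along a, b. For s ≤ t one has s a + t
b = s (a+b) + (t-s) b and, after replacing v by v - a, (s+1) a + t b = t (a+b) + (s+1-t) a, all with
coefficients in [0, 1]. For t ≤ s the exchanged identity is used. -/
theorem vanishesNear_of_add
    (hD : ∀ (a : Λ) (X : Multiset Λ), (∀ w ∈ a ::ₘ X, 0 < ℓ w) →
      ∀ v, D (a ::ₘ X) v = D X v + D (a ::ₘ X) (v - a))
    {a b : Λ} {Y : Multiset Λ} (ha : 0 < ℓ a) (hb : 0 < ℓ b) (hY : ∀ w ∈ Y, 0 < ℓ w)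
    (h1 : VanishesNear D x ((a + b) ::ₘ b ::ₘ Y)) (h2 : VanishesNear D x ((a + b) ::ₘ a ::ₘ Y)) :
    VanishesNear D x (a ::ₘ b ::ₘ Y) := by
  have hc : 0 < ℓ (a + b : Λ) := by
    rw [Submodule.coe_add, map_add]
    positivity
  have hpos : ∀ w ∈ a ::ₘ b ::ₘ (a + b) ::ₘ Y, 0 < ℓ w := by
    intro w hw
    simp only [Multiset.mem_cons] at hw
    rcases hw with rfl | rfl | rfl | hw
    exacts [ha, hb, hc, hY w hw]
  have eb : a ::ₘ b ::ₘ (a + b) ::ₘ Y = b ::ₘ (a + b) ::ₘ a ::ₘ Y := by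
    rw [Multiset.cons_swap a b, Multiset.cons_swap a (a + b)]
  have ec : a ::ₘ b ::ₘ (a + b) ::ₘ Y = (a + b) ::ₘ a ::ₘ b ::ₘ Y := by
    rw [Multiset.cons_swap b (a + b), Multiset.cons_swap a (a + b)]
  have ea : a ::ₘ b ::ₘ (a + b) ::ₘ Y = a ::ₘ (a + b) ::ₘ b ::ₘ Y := by
    rw [Multiset.cons_swap b (a + b)]
  have da := hD a ((a + b) ::ₘ b ::ₘ Y) (by rwa [← ea])
  have db := hD b ((a + b) ::ₘ a ::ₘ Y) (by rwa [← eb])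
  have dc := hD (a + b) (a ::ₘ b ::ₘ Y) (by rwa [← ec])
  rw [← ea] at da
  rw [← eb] at db
  rw [← ec] at dc
  intro v hv
  obtain ⟨s, hs0, hs1, hv⟩ := mem_zonotope_cons.1 hv
  obtain ⟨t, ht0, ht1, hv⟩ := mem_zonotope_cons.1 hv
  rcases le_total s t with hst | hst
  · have e1 := h1 v (mem_zonotope_cons_of_sub hs0 hs1
      (mem_zonotope_cons_of_sub (s := t - s) (by linarith) (by linarith) (by
        convert hv using 1
        rw [Submodule.coe_add]
        module)))
    have e2 := h2 (v - a) (mem_zonotope_cons_of_sub ht0 ht1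
      (mem_zonotope_cons_of_sub (s := s + 1 - t) (by linarith) (by linarith) (by
        convert hv using 1
        rw [Submodule.coe_add, Submodule.coe_sub]
        module)))
    have h3 := da v
    have h4 := db (v - a)
    have h5 := dc v
    rw [sub_sub] at h4
    rw [e1] at h3
    rw [e2] at h4
    rw [h3, h4] at h5
    simpa using h5.symm
  · have e1 := h2 v (mem_zonotope_cons_of_sub ht0 ht1
      (mem_zonotope_cons_of_sub (s := s - t) (by linarith) (by linarith) (by
        convert hv using 1
        rw [Submodule.coe_add]
        module)))
    have e2 := h1 (v - b) (mem_zonotope_cons_of_sub hs0 hs1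
      (mem_zonotope_cons_of_sub (s := t + 1 - s) (by linarith) (by linarith) (by
        convert hv using 1
        rw [Submodule.coe_add, Submodule.coe_sub]
        module)))
    have h3 := db v
    have h4 := da (v - b)
    have h5 := dc v
    rw [sub_sub, add_comm b a] at h4
    rw [e1] at h3
    rw [e2] at h4
    rw [h3, h4] at h5
    simpa using h5.symm

/-- This reflects 1/(1-α) = (1 + α + ... + α^{m-1})/(1-α^m). For r < m the point v - r a is still
covered by the hypothesis, since (s + r) a is the multiple (s + r)/m ≤ 1 of m a. -/
theorem vanishesNear_of_nsmul
    (hD : ∀ (a : Λ) (X : Multiset Λ), (∀ w ∈ a ::ₘ X, 0 < ℓ w) →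
      ∀ v, D (a ::ₘ X) v = D X v + D (a ::ₘ X) (v - a))
    {a : Λ} {Y : Multiset Λ} {m : ℕ} (hm : 0 < m) (ha : 0 < ℓ a) (hY : ∀ w ∈ Y, 0 < ℓ w)
    (h : VanishesNear D x ((m • a) ::ₘ Y)) : VanishesNear D x (a ::ₘ Y) := by
  have hm' : (0 : ℝ) < m := Nat.cast_pos.2 hm
  have hma : 0 < ℓ (m • a : Λ) := by
    rw [Submodule.coe_smul_of_tower, map_nsmul]
    exact nsmul_pos ha hm.ne'
  have hpos : ∀ w ∈ a ::ₘ (m • a) ::ₘ Y, 0 < ℓ w := by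
    intro w hw
    simp only [Multiset.mem_cons] at hw
    rcases hw with rfl | rfl | hw
    exacts [ha, hma, hY w hw]
  have da := hD a ((m • a) ::ₘ Y) hpos
  have dm := hD (m • a) (a ::ₘ Y) (by rwa [Multiset.cons_swap])
  rw [Multiset.cons_swap] at dm
  intro v hv
  obtain ⟨s, hs0, hs1, hv⟩ := mem_zonotope_cons.1 hv
  have key : ∀ r ≤ m, D (a ::ₘ (m • a) ::ₘ Y) v = D (a ::ₘ (m • a) ::ₘ Y) (v - r • a) := by
    intro r
    induction r with
    | zero => simp
    | succ r ih =>
      intro hr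
      have hr' : (r : ℝ) + 1 ≤ m := by exact_mod_cast hr
      have h0 : D ((m • a) ::ₘ Y) (v - r • a) = 0 := by
        refine h _ (mem_zonotope_cons_of_sub (s := (s + r) / m) (by positivity) ?_ ?_)
        · rw [div_le_one hm']
          linarith
        · convert hv using 1
          simp only [Submodule.coe_sub, Submodule.coe_smul_of_tower]
          rw [← Nat.cast_smul_eq_nsmul ℝ m, smul_smul, div_mul_cancel₀ _ hm'.ne',
            ← Nat.cast_smul_eq_nsmul ℝ r]
          module
      rw [ih (by omega), da, h0, zero_add, sub_sub, succ_nsmul]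
  have h5 := dm v
  rw [← key m le_rfl] at h5
  simpa using h5.symm

/-- Each partial fraction step replaces one copy of a or b by a + b, which differs from both because
ℓ is positive. The total multiplicity of a and b therefore drops, until one of them is exhausted and
a hypothesis applies. -/
theorem vanishesOver_of_add
    (hD : ∀ (a : Λ) (X : Multiset Λ), (∀ w ∈ a ::ₘ X, 0 < ℓ w) →
      ∀ v, D (a ::ₘ X) v = D X v + D (a ::ₘ X) (v - a))
    {a b : Λ} {S : Set Λ} (ha : 0 < ℓ a) (hb : 0 < ℓ b) (hS : ∀ w ∈ S, 0 < ℓ w)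
    (h1 : VanishesOver D x (insert (a + b) (insert b S)))
    (h2 : VanishesOver D x (insert (a + b) (insert a S))) :
    VanishesOver D x (insert a (insert b S)) := by
  classical
  have hca : a + b ≠ a := by
    intro h
    rw [add_eq_left.1 h] at hb
    simp at hb
  have hcb : a + b ≠ b := by
    intro h
    rw [add_eq_right.1 h] at ha
    simp at ha
  have hc : 0 < ℓ (a + b : Λ) := by
    rw [Submodule.coe_add, map_add]
    positivity
  suffices H : ∀ n, ∀ X : Multiset Λ, X.count a + X.count b ≤ n →
      (∀ w ∈ X, w ∈ insert (a + b) (insert a (insert b S))) → VanishesNear D x X from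
    fun X hX => H _ X le_rfl fun w hw => Set.mem_insert_of_mem _ (hX w hw)
  intro n
  induction n with
  | zero =>
    intro X hn hX
    refine h1 X fun w hw => ?_
    rcases hX w hw with h | rfl | h
    · exact Or.inl h
    · have := Multiset.count_pos.2 hw
      omega
    · exact Or.inr h
  | succ n ih =>
    intro X hn hX
    by_cases hbX : b ∈ X
    swap
    · refine h2 X fun w hw => ?_
      rcases hX w hw with h | h | rfl | h
      · exact Or.inl h
      · exact Or.inr (Or.inl h)
      · exact absurd hw hbX
      · exact Or.inr (Or.inr h)
    obtain ⟨Z, rfl⟩ := Multiset.exists_cons_of_mem hbX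
    by_cases haX : a ∈ b ::ₘ Z
    swap
    · refine h1 _ fun w hw => ?_
      rcases hX w hw with h | rfl | h
      · exact Or.inl h
      · exact absurd hw haX
      · exact Or.inr h
    -- When a and b coincide, the support allowed in `h1` already contains everything.
    by_cases hab : a = b
    · subst hab
      refine h1 _ fun w hw => ?_
      rcases hX w hw with h | h | h
      · exact Or.inl h
      · exact Or.inr (Or.inl h)
      · exact Or.inr h
    have haZ : a ∈ Z := (Multiset.mem_cons.1 haX).resolve_left hab
    obtain ⟨Y, rfl⟩ := Multiset.exists_cons_of_mem haZ
    rw [Multiset.cons_swap]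
    have hY : ∀ w ∈ Y, w ∈ insert (a + b) (insert a (insert b S)) := fun w hw =>
      hX w (Multiset.mem_cons_of_mem (Multiset.mem_cons_of_mem hw))
    have hpos : ∀ w ∈ Y, 0 < ℓ w := by
      intro w hw
      rcases hY w hw with rfl | rfl | rfl | h
      exacts [hc, ha, hb, hS w h]
    simp only [Multiset.count_cons_self, Multiset.count_cons_of_ne hab,
      Multiset.count_cons_of_ne (Ne.symm hab)] at hn
    refine vanishesNear_of_add hD ha hb hpos (ih _ ?_ ?_) (ih _ ?_ ?_)
    · simp only [Multiset.count_cons_self, Multiset.count_cons_of_ne hab,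
        Multiset.count_cons_of_ne hca.symm, Multiset.count_cons_of_ne hcb.symm]
      omega
    · intro w hw
      simp only [Multiset.mem_cons] at hw
      rcases hw with rfl | rfl | hw
      · exact Or.inl rfl
      · exact Or.inr (Or.inr (Or.inl rfl))
      · exact hY w hw
    · simp only [Multiset.count_cons_self, Multiset.count_cons_of_ne (Ne.symm hab),
        Multiset.count_cons_of_ne hca.symm, Multiset.count_cons_of_ne hcb.symm]
      omega
    · intro w hw
      simp only [Multiset.mem_cons] at hw
      rcases hw with rfl | rfl | hw
      · exact Or.inl rfl
      · exact Or.inr (Or.inl rfl)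
      · exact hY w hw

theorem vanishesOver_of_nsmul
    (hD : ∀ (a : Λ) (X : Multiset Λ), (∀ w ∈ a ::ₘ X, 0 < ℓ w) →
      ∀ v, D (a ::ₘ X) v = D X v + D (a ::ₘ X) (v - a))
    {a : Λ} {S : Set Λ} {m : ℕ} (hm : 0 < m) (ha : 0 < ℓ a) (hS : ∀ w ∈ S, 0 < ℓ w)
    (h : VanishesOver D x (insert (m • a) S)) : VanishesOver D x (insert a S) := by
  classical
  rcases eq_or_lt_of_le (Nat.succ_le_of_lt hm) with rfl | hm1
  · simpa using h
  have hma : 0 < ℓ (m • a : Λ) := by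
    rw [Submodule.coe_smul_of_tower, map_nsmul]
    exact nsmul_pos ha hm.ne'
  have hne : a ≠ m • a := by
    intro h
    have h2 : ℓ (m • a : Λ) = m * ℓ a := by
      rw [Submodule.coe_smul_of_tower, map_nsmul, nsmul_eq_mul]
    rw [← h] at h2
    have : (1 : ℝ) < m := by exact_mod_cast hm1
    nlinarith
  suffices H : ∀ n, ∀ X : Multiset Λ, X.count a ≤ n →
      (∀ w ∈ X, w ∈ insert (m • a) (insert a S)) → VanishesNear D x X from
    fun X hX => H _ X le_rfl fun w hw => Set.mem_insert_of_mem _ (hX w hw)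
  have hout : ∀ X : Multiset Λ, a ∉ X → (∀ w ∈ X, w ∈ insert (m • a) (insert a S)) →
      VanishesNear D x X := by
    intro X haX hX
    refine h X fun w hw => ?_
    rcases hX w hw with h | rfl | h
    · exact Or.inl h
    · exact absurd hw haX
    · exact Or.inr h
  intro n
  induction n with
  | zero =>
    intro X hn hX
    exact hout X (Multiset.count_eq_zero.1 (Nat.le_zero.1 hn)) hX
  | succ n ih =>
    intro X hn hX
    by_cases haX : a ∈ X
    swap
    · exact hout X haX hX
    obtain ⟨Y, rfl⟩ := Multiset.exists_cons_of_mem haX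
    have hY : ∀ w ∈ Y, w ∈ insert (m • a) (insert a S) := fun w hw =>
      hX w (Multiset.mem_cons_of_mem hw)
    rw [Multiset.count_cons_self] at hn
    refine vanishesNear_of_nsmul hD hm ha ?_ (ih _ ?_ ?_)
    · intro w hw
      rcases hY w hw with rfl | rfl | h
      exacts [hma, ha, hS w h]
    · rw [Multiset.count_cons_of_ne hne]
      omega
    · intro w hw
      rcases Multiset.mem_cons.1 hw with rfl | hw
      · exact Or.inl rfl
      · exact hY w hw

theorem vanishesOver_range_of_add
    (hD : ∀ (a : Λ) (X : Multiset Λ), (∀ w ∈ a ::ₘ X, 0 < ℓ w) →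
      ∀ v, D (a ::ₘ X) v = D X v + D (a ::ₘ X) (v - a))
    {d : ℕ} {a : Fin d → Λ} (hℓ : ∀ i, 0 < ℓ (a i)) {i j : Fin d} (hij : i ≠ j)
    (h1 : VanishesOver D x (Set.range (Function.update a i (a i + a j))))
    (h2 : VanishesOver D x (Set.range (Function.update a j (a i + a j)))) :
    VanishesOver D x (Set.range a) := by
  refine (vanishesOver_of_add hD (hℓ i) (hℓ j) (S := a '' {k | k ≠ i ∧ k ≠ j}) ?_
    (h1.mono ?_) (h2.mono ?_)).mono ?_
  · rintro _ ⟨k, -, rfl⟩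
    exact hℓ k
  · rintro w (rfl | rfl | ⟨k, hk, rfl⟩)
    · exact ⟨i, by simp⟩
    · exact ⟨j, by simp [hij.symm]⟩
    · exact ⟨k, by simp [hk.1]⟩
  · rintro w (rfl | rfl | ⟨k, hk, rfl⟩)
    · exact ⟨j, by simp⟩
    · exact ⟨i, by simp [hij]⟩
    · exact ⟨k, by simp [hk.2]⟩
  · rintro _ ⟨k, rfl⟩
    by_cases hki : k = i
    · subst hki
      exact Or.inl rfl
    by_cases hkj : k = j
    · subst hkj
      exact Or.inr (Or.inl rfl)
    exact Or.inr (Or.inr ⟨k, ⟨hki, hkj⟩, rfl⟩)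

theorem vanishesOver_range_of_nsmul
    (hD : ∀ (a : Λ) (X : Multiset Λ), (∀ w ∈ a ::ₘ X, 0 < ℓ w) →
      ∀ v, D (a ::ₘ X) v = D X v + D (a ::ₘ X) (v - a))
    {d : ℕ} {a : Fin d → Λ} (hℓ : ∀ i, 0 < ℓ (a i)) (m : Fin d → ℕ) (hm : ∀ i, 0 < m i)
    (h : VanishesOver D x (Set.range fun i => m i • a i)) : VanishesOver D x (Set.range a) := by
  classical
  suffices H : ∀ T : Finset (Fin d),
      VanishesOver D x (Set.range (T.piecewise (fun i => m i • a i) a)) →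
      VanishesOver D x (Set.range a) from H Finset.univ (by rwa [Finset.piecewise_univ])
  intro T
  induction T using Finset.induction_on with
  | empty => rw [Finset.piecewise_empty]; exact id
  | insert i T hi ih =>
    intro h
    refine ih ?_
    rw [Finset.piecewise_insert] at h
    set f := T.piecewise (fun i => m i • a i) a with hf
    have hfi : f i = a i := Finset.piecewise_eq_of_notMem _ _ _ hi
    have hfpos : ∀ k, 0 < ℓ (f k) := by
      intro k
      by_cases hk : k ∈ T
      · rw [hf, Finset.piecewise_eq_of_mem _ _ _ hk, Submodule.coe_smul_of_tower, map_nsmul]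
        exact nsmul_pos (hℓ k) (hm k).ne'
      · rw [hf, Finset.piecewise_eq_of_notMem _ _ _ hk]
        exact hℓ k
    refine (vanishesOver_of_nsmul hD (hm i) (hfpos i) (S := f '' {k | k ≠ i}) ?_
      (h.mono ?_)).mono ?_
    · rintro _ ⟨k, -, rfl⟩
      exact hfpos k
    · rintro w (rfl | ⟨k, hk, rfl⟩)
      · exact ⟨i, by rw [hfi, Function.update_self]⟩
      · exact ⟨k, by rw [Function.update_of_ne hk]⟩
    · rintro _ ⟨k, rfl⟩
      by_cases hki : k = i
      · subst hki
        exact Or.inl rfl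
      · exact Or.inr ⟨k, hki, rfl⟩

/-- Induction on the number of terms of the relation. If ε i = ε j, then ε i a_i + ε j a_j = ε i
(a_i + a_j), so putting a_i + a_j in place of either vector and dropping the other from the relation
shortens it by one term; these are the two lists of the partial fraction step. If no nonzero sign is
repeated, positivity of ℓ leaves exactly one plus and one minus, so two of the vectors are equal. -/
theorem vanishesOver_of_sign_relation
    (hD : ∀ (a : Λ) (X : Multiset Λ), (∀ w ∈ a ::ₘ X, 0 < ℓ w) →
      ∀ v, D (a ::ₘ X) v = D X v + D (a ::ₘ X) (v - a)) {d : ℕ}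
    (hdup : ∀ a : Fin d → Λ, (∀ i, 0 < ℓ (a i)) → ¬ Function.Injective a →
      VanishesOver D x (Set.range a))
    (n : ℕ) {a : Fin d → Λ} (hℓ : ∀ i, 0 < ℓ (a i)) (ε : Fin d → SignType)
    (hn : (Finset.univ.filter fun i => ε i ≠ 0).card = n) (hne : ∃ i, ε i ≠ 0)
    (hsum : ∑ i, (ε i : ℤ) • a i = 0) : VanishesOver D x (Set.range a) := by
  classical
  induction n generalizing a ε with
  | zero =>
    obtain ⟨i, hi⟩ := hne
    rw [Finset.card_eq_zero] at hn
    have : i ∈ Finset.univ.filter fun i => ε i ≠ 0 := by simp [hi]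
    rw [hn] at this
    simp at this
  | succ n ih =>
    by_cases hpair : ∃ i j, i ≠ j ∧ ε i ≠ 0 ∧ ε i = ε j
    · obtain ⟨i, j, hij, hi0, he⟩ := hpair
      have step : ∀ i j : Fin d, i ≠ j → ε i ≠ 0 → ε i = ε j →
          VanishesOver D x (Set.range (Function.update a i (a i + a j))) := by
        intro i j hij hi0 he
        refine ih (ε := Function.update ε j 0) ?_ ?_ ⟨i, by simpa [hij] using hi0⟩ ?_
        · intro k
          by_cases hk : k = i
          · subst hk
            rw [Function.update_self, Submodule.coe_add, map_add]
            exact add_pos (hℓ k) (hℓ j)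
          · rw [Function.update_of_ne hk]
            exact hℓ k
        · have : (Finset.univ.filter fun k => Function.update ε j 0 k ≠ 0) =
              (Finset.univ.filter fun k => ε k ≠ 0).erase j := by
            ext k
            by_cases hk : k = j
            · subst hk; simp
            · simp [hk]
          rw [this, Finset.card_erase_of_mem (by simp [← he, hi0]), hn]
          rfl
        · rw [← hsum, ← Finset.add_sum_erase _ _ (Finset.mem_univ i),
            ← Finset.add_sum_erase _ _ (Finset.mem_univ i)]
          have hji : j ∈ Finset.univ.erase i := by simp [hij.symm]
          rw [← Finset.add_sum_erase _ _ hji, ← Finset.add_sum_erase _ _ hji]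
          have h3 : ∀ k ∈ (Finset.univ.erase i).erase j,
              ((Function.update ε j 0 k : SignType) : ℤ) • Function.update a i (a i + a j) k =
                (ε k : ℤ) • a k := by
            intro k hk
            simp only [Finset.mem_erase, Finset.mem_univ, and_true] at hk
            rw [Function.update_of_ne hk.1, Function.update_of_ne hk.2]
          rw [Finset.sum_congr rfl h3]
          rw [Function.update_self, Function.update_self, Function.update_of_ne hij, ← he]
          simp only [SignType.coe_zero, zero_smul, zero_add, smul_add]
          abel
      refine vanishesOver_range_of_add hD hℓ hij (step i j hij hi0 he) ?_
      rw [add_comm]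
      exact step j i hij.symm (he ▸ hi0) he.symm
    · push Not at hpair
      refine hdup a hℓ fun hinj => ?_
      have hsum' : ∑ i, ((ε i : ℤ) : ℝ) * ℓ (a i) = 0 := by
        have := congrArg (fun v : Λ => ℓ v) hsum
        simpa using this
      -- Both signs must occur: if all nonzero signs were equal, ℓ would be nonzero on the left side
      -- of the relation.
      have hex : ∀ σ : SignType, σ ≠ 0 → ∃ i, ε i = σ := by
        intro σ hσ
        by_contra hno
        push Not at hno
        obtain ⟨i, hi⟩ := hne
        have hk : ∀ k, ε k = 0 ∨ ε k = -σ := by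
          intro k
          have h6 : ∀ σ τ : SignType, σ ≠ 0 → τ ≠ σ → τ = 0 ∨ τ = -σ := by decide
          exact h6 σ (ε k) hσ (hno k)
        have h5 : ∑ k, (((σ : ℤ) : ℝ) * (((ε k : ℤ) : ℝ) * ℓ (a k))) < 0 := by
          have hσ2 : ((σ : ℤ) : ℝ) * ((-σ : SignType) : ℤ) = -1 := by
            rcases σ with _ | _ | _ <;> simp at hσ ⊢
          refine Finset.sum_neg' (fun k _ => ?_) ⟨i, Finset.mem_univ i, ?_⟩
          · rcases hk k with h | h
            · rw [h]; simp
            · rw [h, ← mul_assoc, hσ2]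
              linarith [hℓ k]
          · rw [(hk i).resolve_left hi, ← mul_assoc, hσ2]
            linarith [hℓ i]
        rw [← Finset.mul_sum, hsum', mul_zero] at h5
        exact lt_irrefl _ h5
      obtain ⟨i, hi⟩ := hex 1 (by decide)
      obtain ⟨j, hj⟩ := hex (-1) (by decide)
      have hij : i ≠ j := by
        rintro rfl
        rw [hi] at hj
        exact absurd hj (by decide)
      have hother : ∀ k, k ≠ i → k ≠ j → ε k = 0 := by
        intro k hki hkj
        have h1 := fun h0 => hpair k i hki h0
        have h2 := fun h0 => hpair k j hkj h0
        rw [hi] at h1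
        rw [hj] at h2
        revert h1 h2
        generalize ε k = τ
        revert τ
        decide
      rw [← Finset.add_sum_erase _ _ (Finset.mem_univ i),
        ← Finset.add_sum_erase _ _ (show j ∈ Finset.univ.erase i by simp [hij.symm]),
        Finset.sum_eq_zero, hi, hj] at hsum
      · refine hij (hinj ?_)
        simp only [SignType.coe_one, one_smul, SignType.coe_neg_one, neg_smul, add_zero] at hsum
        exact add_neg_eq_zero.1 hsum
      · intro k hk
        simp only [Finset.mem_erase, Finset.mem_univ, and_true] at hk
        rw [hother k hk.2 hk.1]
        simp

theorem linearIndependent_real_of_int [FiniteDimensional ℝ V] [DiscreteTopology Λ] {d : ℕ}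
    {a : Fin d → Λ} (h : LinearIndependent ℤ a) :
    LinearIndependent ℝ fun i => ((a i : Λ) : V) := by
  rw [linearIndependent_iff_card_eq_finrank_span]
  have h1 := finrank_real_span_eq (Set.range a)
  rw [finrank_span_eq_card h, ← Set.range_comp] at h1
  exact h1.symm

/-- Induction on the length of the family. A repeated vector can be omitted. A dependent family has
an integral relation, and multiplying each vector by the absolute value of its coefficient turns the
coefficients into signs. -/
theorem vanishesOver_of_independent [FiniteDimensional ℝ V] [DiscreteTopology Λ]
    (hD : ∀ (a : Λ) (X : Multiset Λ), (∀ w ∈ a ::ₘ X, 0 < ℓ w) →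
      ∀ v, D (a ::ₘ X) v = D X v + D (a ::ₘ X) (v - a))
    (hbase : ∀ (d : ℕ) (a : Fin d → Λ), (∀ i, 0 < ℓ (a i)) →
      LinearIndependent ℝ (fun i => ((a i : Λ) : V)) → VanishesOver D x (Set.range a))
    {d : ℕ} {a : Fin d → Λ} (hℓ : ∀ i, 0 < ℓ (a i)) : VanishesOver D x (Set.range a) := by
  induction d with
  | zero =>
    exact hbase 0 a hℓ linearIndependent_empty_type
  | succ d ih =>
    have hdup : ∀ a : Fin (d + 1) → Λ, (∀ i, 0 < ℓ (a i)) → ¬ Function.Injective a →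
        VanishesOver D x (Set.range a) := by
      intro a hℓ hinj
      simp only [Function.Injective, not_forall] at hinj
      obtain ⟨i, j, hij, hne⟩ := hinj
      refine (ih (a := a ∘ j.succAbove) fun k => hℓ _).mono ?_
      rintro _ ⟨k, rfl⟩
      by_cases hk : k = j
      · subst hk
        obtain ⟨l, hl⟩ := Fin.exists_succAbove_eq hne
        exact ⟨l, by rw [Function.comp_apply, hl, hij]⟩
      · obtain ⟨l, hl⟩ := Fin.exists_succAbove_eq hk
        exact ⟨l, by rw [Function.comp_apply, hl]⟩
    by_cases hli : LinearIndependent ℤ a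
    · exact hbase _ a hℓ (linearIndependent_real_of_int hli)
    rw [Fintype.not_linearIndependent_iff] at hli
    obtain ⟨c, hc, i, hi⟩ := hli
    -- Vectors absent from the relation keep the multiplier 1, because multipliers have to be
    -- positive.
    let m : Fin (d + 1) → ℕ := fun i => if c i = 0 then 1 else (c i).natAbs
    have hm : ∀ i, 0 < m i := by
      intro i
      by_cases h : c i = 0
      · simp [m, h]
      · simp [m, h]
    refine vanishesOver_range_of_nsmul hD hℓ m hm ?_
    refine vanishesOver_of_sign_relation hD hdup _ (fun i => ?_) (fun i => SignType.sign (c i)) rfl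
      ⟨i, by simpa using hi⟩ ?_
    · rw [Submodule.coe_smul_of_tower, map_nsmul]
      exact nsmul_pos (hℓ i) (hm i).ne'
    · rw [← hc]
      refine Finset.sum_congr rfl fun k _ => ?_
      by_cases h : c k = 0
      · simp [h]
      · simp only [m, h, if_false]
        rw [← natCast_zsmul, smul_smul, ← Int.abs_eq_natAbs, sign_mul_abs]

end PartialFractions

/-! ### Raising multiplicities in the partition function. -/

section Multiplicities

variable {V : Type*} [NormedAddCommGroup V] [NormedSpace ℝ V] {Λ : Submodule ℤ V}

theorem eq_zero_of_periodic {ℓ : V →ₗ[ℝ] ℝ} {c : Λ} (hc : 0 < ℓ c) {H : Λ → ℝ}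
    (hper : ∀ v, H v = H (v - c)) (hneg : ∀ v : Λ, ℓ v < 0 → H v = 0) (v : Λ) : H v = 0 := by
  have h : ∀ n : ℕ, H v = H (v - n • c) := by
    intro n
    induction n with
    | zero => simp
    | succ n ih => rw [ih, hper, sub_sub, succ_nsmul]
  obtain ⟨n, hn⟩ := exists_nat_gt (ℓ v / ℓ c)
  rw [h n]
  apply hneg
  rw [div_lt_iff₀ hc] at hn
  rw [Submodule.coe_sub, Submodule.coe_smul_of_tower, map_sub, map_nsmul, nsmul_eq_mul]
  linarith

/-- Discrete analogue of `integral_linear_mul_coneMeasure`: the multiplicities of a, summed over all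
partitions of v, count the partitions of v - a using one extra copy of a. The induction shows that
the difference of the two sides is periodic along the new vector c and vanishes where ℓ < 0, hence
is zero. -/
theorem linear_mul_msPartition {X : Multiset Λ} (ℓ : V →ₗ[ℝ] ℝ) (hℓ : ∀ w ∈ X, 0 < ℓ w)
    (u : V →ₗ[ℝ] ℝ) (v : Λ) :
    u v * msPartition X v = (X.map fun a : Λ => u a * msPartition (a ::ₘ X) (v - a)).sum := by
  induction X using Multiset.induction_on generalizing v with
  | empty =>
    rw [Multiset.map_zero, Multiset.sum_zero, mul_eq_zero]
    by_cases h : msPartition (0 : Multiset Λ) v = 0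
    · right; rw [h]; simp
    · left
      have := mem_span_of_msPartition_ne_zero h
      simp only [Multiset.map_zero, Multiset.notMem_zero, Set.ofPred_false,
        Submodule.span_empty, Submodule.mem_bot] at this
      rw [this, map_zero]
  | cons c Y ih =>
    have hc : 0 < ℓ c := hℓ c (Multiset.mem_cons_self c Y)
    have hY : ∀ w ∈ Y, 0 < ℓ w := fun w hw => hℓ w (Multiset.mem_cons_of_mem hw)
    have ih := ih hY
    rw [← sub_eq_zero]
    have hcons : ∀ a ∈ c ::ₘ Y, ∀ v, (msPartition (a ::ₘ c ::ₘ Y) v : ℝ) =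
        msPartition (a ::ₘ Y) v + msPartition (a ::ₘ c ::ₘ Y) (v - c) := by
      intro a ha v
      rw [Multiset.cons_swap, msPartition_cons ℓ (a := c) (X := a ::ₘ Y) _ v]
      · push_cast; rfl
      · intro w hw
        simp only [Multiset.mem_cons] at hw
        rcases hw with rfl | rfl | hw
        exacts [hc, hℓ _ ha, hY w hw]
    refine eq_zero_of_periodic (H := fun v => u v * msPartition (c ::ₘ Y) v -
      ((c ::ₘ Y).map fun a : Λ => u a * msPartition (a ::ₘ c ::ₘ Y) (v - a)).sum) hc ?_ ?_ v
    · intro v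
      rw [sub_eq_sub_iff_sub_eq_sub, ← Multiset.sum_map_sub]
      have h1 : (msPartition (c ::ₘ Y) v : ℝ) =
          msPartition Y v + msPartition (c ::ₘ Y) (v - c) := by
        rw [msPartition_cons ℓ hℓ v]
        push_cast; rfl
      have h2 : ((c ::ₘ Y).map fun a : Λ => u a * (msPartition (a ::ₘ c ::ₘ Y) (v - a) : ℝ) -
          u a * msPartition (a ::ₘ c ::ₘ Y) (v - c - a)) =
          (c ::ₘ Y).map fun a : Λ => u a * (msPartition (a ::ₘ Y) (v - a) : ℝ) := by
        refine Multiset.map_congr rfl fun a ha => ?_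
        rw [hcons a ha (v - a), sub_right_comm v c a]
        ring
      rw [h2, Multiset.map_cons, Multiset.sum_cons, ← ih, h1, Submodule.coe_sub, map_sub]
      ring
    · intro v hv
      rw [msPartition_eq_zero_of_neg ℓ hℓ hv, Nat.cast_zero, mul_zero, zero_sub, neg_eq_zero]
      refine Multiset.sum_eq_zero fun r hr => ?_
      obtain ⟨a, ha, rfl⟩ := Multiset.mem_map.1 hr
      rw [msPartition_eq_zero_of_neg ℓ, Nat.cast_zero, mul_zero]
      · intro w hw
        rcases Multiset.mem_cons.1 hw with rfl | hw
        exacts [hℓ _ ha, hℓ w hw]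
      · rw [Submodule.coe_sub, map_sub]
        linarith [hℓ a ha]

theorem sum_map_smul_eq_count [DecidableEq Λ] {R M : Type*} [Semiring R] [AddCommMonoid M]
    [Module R M] {X : Multiset Λ} {b : Λ} (u : Λ → R) (f : Λ → M)
    (hu : ∀ a ∈ X, u a = if a = b then 1 else 0) :
    (X.map fun a => u a • f a).sum = (X.count b : R) • f b := by
  induction X using Multiset.induction_on with
  | empty => simp
  | cons a X ih =>
    rw [Multiset.map_cons, Multiset.sum_cons, ih fun w hw => hu w (Multiset.mem_cons_of_mem hw),
      hu a (Multiset.mem_cons_self a X)]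
    by_cases h : a = b
    · subst h
      rw [if_pos rfl, Multiset.count_cons_self]
      push_cast
      rw [add_smul, add_comm, one_smul]
    · rw [if_neg h, Multiset.count_cons_of_ne (Ne.symm h), zero_smul, zero_add]

theorem count_mul_msPartition_cons [DecidableEq Λ] {X : Multiset Λ} (ℓ : V →ₗ[ℝ] ℝ)
    (hℓ : ∀ w ∈ X, 0 < ℓ w) {u : V →ₗ[ℝ] ℝ} {b : Λ}
    (hu : ∀ a ∈ X, u a = if a = b then 1 else 0) (v : Λ) :
    (X.count b : ℝ) * msPartition (b ::ₘ X) (v - b) = u v * msPartition X v := by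
  rw [linear_mul_msPartition ℓ hℓ u v]
  exact (sum_map_smul_eq_count (fun a : Λ => u a)
    (fun a => (msPartition (a ::ₘ X) (v - a) : ℝ)) hu).symm

end Multiplicities

/-! ### The logarithmic derivative of the Todd series. -/

section LogDerivative

/-- The logarithmic derivative of the power series of `z / (1 - e^{-z})`. -/
def toddLogDeriv : PowerSeries ℂ :=
  PowerSeries.derivative ℂ (toddFactor 1) * (toddFactor 1)⁻¹

theorem constantCoeff_toddFactor_one_ne_zero : PowerSeries.constantCoeff (toddFactor 1) ≠ 0 := by
  rw [← PowerSeries.coeff_zero_eq_constantCoeff_apply]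
  exact constantCoeff_toddFactor_ne_zero 1

theorem derivative_toddFactor_one :
    PowerSeries.derivative ℂ (toddFactor 1) = toddLogDeriv * toddFactor 1 := by
  rw [toddLogDeriv, mul_assoc, PowerSeries.inv_mul_cancel _ constantCoeff_toddFactor_one_ne_zero,
    mul_one]

theorem derivative_expNegSeries : PowerSeries.derivative ℂ expNegSeries = -expNegSeries := by
  refine PowerSeries.ext fun n => ?_
  rw [PowerSeries.coeff_derivative, map_neg, coeff_expNegSeries, coeff_expNegSeries,
    Nat.factorial_succ]
  have h1 : (n.factorial : ℂ) ≠ 0 := Nat.cast_ne_zero.2 n.factorial_ne_zero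
  have h2 : (n : ℂ) + 1 ≠ 0 := Nat.cast_add_one_ne_zero n
  push_cast
  field_simp
  ring

/-- Differentiate (1 - e^{-z}) T = z and substitute T' = L T. The identity matches a translated Todd
operator with the correction that appears when it is commuted past a linear form. -/
theorem expNegSeries_mul_toddFactor_one :
    expNegSeries * toddFactor 1 = 1 - PowerSeries.X * toddLogDeriv := by
  have h := congrArg (PowerSeries.derivative ℂ) one_sub_expNegSeries_mul_toddFactor
  rw [Derivation.leibniz, map_sub, derivative_expNegSeries, derivative_toddFactor_one,
    PowerSeries.derivative_X] at h
  have h1 : PowerSeries.derivative ℂ (1 : PowerSeries ℂ) = 0 := Derivation.map_one_eq_zero _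
  rw [h1, smul_eq_mul, smul_eq_mul] at h
  linear_combination h - toddLogDeriv * one_sub_expNegSeries_mul_toddFactor

theorem constantCoeff_toddFactor_one : PowerSeries.coeff 0 (toddFactor 1) = 1 := by
  have h := congrArg PowerSeries.constantCoeff expNegSeries_mul_toddFactor_one
  simp only [map_mul, map_sub, map_one, PowerSeries.constantCoeff_X, zero_mul, sub_zero] at h
  rw [← PowerSeries.coeff_zero_eq_constantCoeff_apply expNegSeries, coeff_expNegSeries] at h
  simpa using h

end LogDerivative

/-! ### Raising multiplicities in the spline formula. -/

section SplineStep

variable {V : Type*} [NormedAddCommGroup V] [NormedSpace ℝ V] [FiniteDimensional ℝ V]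
  {Λ : Submodule ℤ V}

/-- Commuting T(D_a) past u produces u(a) T'(D_a) = u(a) L(D_a) T(D_a), once for each element of X.
-/
theorem charOp_linPoly_mul {χ : AddChar Λ ℂ} {X : Multiset Λ} (hχ : ∀ a ∈ X, χ a = 1)
    (u : V →ₗ[ℝ] ℝ) (p : PolyFun V) :
    charOp χ X (linPoly u * p) = linPoly u * charOp χ X p +
      (X.map fun a : Λ => (u a : ℂ) • serOp (a : V) toddLogDeriv (charOp χ X p)).sum := by
  induction X using Multiset.induction_on with
  | empty => simp [charOp_zero]
  | cons a X ih =>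
    rw [charOp_cons_apply, charOp_cons_apply, ih fun w hw => hχ w (Multiset.mem_cons_of_mem hw),
      hχ a (Multiset.mem_cons_self a X), map_add, serOp_linPoly_mul, map_multiset_sum,
      Multiset.map_map, Multiset.map_cons, Multiset.sum_cons, derivative_toddFactor_one, map_mul,
      Module.End.mul_apply, add_assoc]
    congr 3
    refine Multiset.map_congr rfl fun w _ => ?_
    rw [Function.comp_apply, map_smul, serOp_comm_apply]

theorem charOp_algebraMap {χ : AddChar Λ ℂ} {X : Multiset Λ} (hχ : ∀ a ∈ X, χ a = 1) (r : ℂ) :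
    charOp χ X (algebraMap ℂ (PolyFun V) r) = algebraMap ℂ (PolyFun V) r := by
  induction X using Multiset.induction_on with
  | empty => rfl
  | cons a X ih =>
    rw [charOp_cons_apply, ih fun w hw => hχ w (Multiset.mem_cons_of_mem hw),
      hχ a (Multiset.mem_cons_self a X), serOp_algebraMap, constantCoeff_toddFactor_one, one_smul]

variable [MeasurableSpace V] [BorelSpace V]
  {ν : Measure V} [ν.IsAddHaarMeasure] {x : V} {X : Multiset Λ}

theorem charGerm_eq_germ {χ : AddChar Λ ℂ} (hχ : ∀ a ∈ X, χ a = 1) :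
    charGerm ν x χ X = germ ν x (X.map (↑)) := by
  rw [charGerm, Multiset.filter_eq_self.2 hχ]

theorem IsGeneric.count_smul_germ_cons [DecidableEq Λ] (hx : IsGeneric Λ x) (ℓ : V →ₗ[ℝ] ℝ)
    (hℓ : ∀ w ∈ X, 0 < ℓ w) {u : V →ₗ[ℝ] ℝ} {b : Λ}
    (hu : ∀ a ∈ X, u a = if a = b then 1 else 0) :
    (X.count b : ℂ) • germ ν x ((b ::ₘ X).map (↑)) = linPoly u * germ ν x (X.map (↑)) := by
  rw [linPoly_mul_germ ℓ _ u (hx.exists_isGerm ℓ hℓ)]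
  · rw [Multiset.map_map]
    have h := sum_map_smul_eq_count (X := X) (b := b) (fun a : Λ => (u a : ℂ))
      (fun a => germ ν x ((a ::ₘ X).map (↑))) fun a ha => by
        rw [hu a ha]
        split_ifs <;> simp
    rw [← h]
    refine congrArg Multiset.sum (Multiset.map_congr rfl fun a _ => ?_)
    rw [Function.comp_apply, Multiset.map_cons]
  · intro v hv
    obtain ⟨a, ha, rfl⟩ := Multiset.mem_map.1 hv
    rw [← Multiset.map_cons]
    refine hx.exists_isGerm ℓ fun w hw => ?_
    rcases Multiset.mem_cons.1 hw with rfl | hw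
    exacts [hℓ _ ha, hℓ w hw]
  · intro v hv
    obtain ⟨a, ha, rfl⟩ := Multiset.mem_map.1 hv
    exact hℓ a ha

/-- Let m be the multiplicity of b, and g, G the germs of X and of X with b added. Then D_b G = g, m
G = u g, and e^{-D_b} T(D_b) = 1 - L(D_b) D_b. The left side thus becomes `charOp` applied to u g,
minus m L(D_b) applied to `charOp` of g. The second term is exactly the commutator of `charOp` with
u, so u times `charOp` of g remains. -/
theorem IsGeneric.count_mul_charTerm_cons [DiscreteTopology Λ] [IsZLattice ℝ Λ] [DecidableEq Λ]
    (hx : IsGeneric Λ x) (ℓ : V →ₗ[ℝ] ℝ)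
    (hℓ : ∀ w ∈ X, 0 < ℓ w) {u : V →ₗ[ℝ] ℝ} {b : Λ} (hb : b ∈ X)
    (hu : ∀ a ∈ X, u a = if a = b then 1 else 0) {χ : AddChar Λ ℂ} (hχ : ∀ a ∈ X, χ a = 1)
    (v : Λ) :
    (X.count b : ℂ) * charTerm ν x (b ::ₘ X) (v - b) χ = u v * charTerm ν x X v χ := by
  have hbX : ∀ w ∈ b ::ₘ X, 0 < ℓ w := by
    intro w hw
    rcases Multiset.mem_cons.1 hw with rfl | hw
    exacts [hℓ _ hb, hℓ w hw]
  have hχ' : ∀ w ∈ b ::ₘ X, χ w = 1 := by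
    intro w hw
    rcases Multiset.mem_cons.1 hw with rfl | hw
    exacts [hχ _ hb, hχ w hw]
  have hex := hx.exists_isGerm (ν := ν) ℓ hbX
  have hd : polyDeriv (b : V) (germ ν x ((b ::ₘ X).map (↑))) = germ ν x (X.map (↑)) := by
    rw [Multiset.map_cons] at hex ⊢
    refine polyDeriv_germ_cons ℓ ?_ hex
    intro w hw
    rw [← Multiset.map_cons] at hw
    obtain ⟨w', hw', rfl⟩ := Multiset.mem_map.1 hw
    exact hbX w' hw'
  have hm := hx.count_smul_germ_cons (ν := ν) ℓ hℓ hu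
  rw [charTerm, charTerm, charGerm_eq_germ hχ, charGerm_eq_germ hχ', char_sub, hχ b hb, inv_one,
    mul_one, Submodule.coe_sub, ← serOp_expNegSeries]
  set g := germ ν x (X.map ((↑) : Λ → V))
  set G := germ ν x ((b ::ₘ X).map ((↑) : Λ → V))
  have key : (X.count b : ℂ) • serOp (b : V) expNegSeries (charOp χ (b ::ₘ X) G) =
      linPoly u * charOp χ X g := by
    rw [charOp_cons_apply, hχ b hb, ← Module.End.mul_apply, ← map_mul,
      expNegSeries_mul_toddFactor_one, map_sub, map_one, LinearMap.sub_apply, Module.End.one_apply,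
      mul_comm PowerSeries.X, map_mul, Module.End.mul_apply, serOp_X, ← charOp_polyDeriv, hd,
      smul_sub, ← map_smul, hm, charOp_linPoly_mul hχ,
      sum_map_smul_eq_count (b := b) (fun a : Λ => (u a : ℂ))
        (fun a : Λ => serOp (a : V) toddLogDeriv (charOp χ X g)) (fun a ha => by
          rw [hu a ha]
          split_ifs <;> simp)]
    abel
  have key' := congrArg (fun p : PolyFun V => (p : V → ℂ) v) key
  have key2 : (X.count b : ℂ) * (serOp (b : V) expNegSeries (charOp χ (b ::ₘ X) G) : V → ℂ) v =
      u v * (charOp χ X g : V → ℂ) v := key'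
  linear_combination χ v * key2

end SplineStep

/-! ### Density of a basis cone and index of the sublattice. -/

section Index

variable {V : Type*} [NormedAddCommGroup V] [NormedSpace ℝ V] [FiniteDimensional ℝ V]
  [MeasurableSpace V] [BorelSpace V] {Λ : Submodule ℤ V} [DiscreteTopology Λ] [IsZLattice ℝ Λ]
  {ν : Measure V} [ν.IsAddHaarMeasure] {d : ℕ} {e : Fin d → Λ} {b : Module.Basis (Fin d) ℝ V}

theorem mul_measureReal_fundamentalDomain {c : ℝ} (hc : 0 ≤ c)
    (hb : volume.map (comb b) = ENNReal.ofReal c • ν) :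
    c * ν.real (ZSpan.fundamentalDomain b) = 1 := by
  have h := congrArg (fun μ : Measure V => μ (ZSpan.fundamentalDomain b)) hb
  have hmeas : Measurable (comb b) := by
    rw [comb_eq_equivFun_symm]
    exact (b.equivFunL.symm.continuous).measurable
  have hpre : comb b ⁻¹' ZSpan.fundamentalDomain b = Set.univ.pi fun _ => Set.Ico (0 : ℝ) 1 := by
    ext t
    rw [comb_eq_equivFun_symm, Set.mem_preimage, ZSpan.mem_fundamentalDomain, Set.mem_univ_pi]
    refine forall_congr' fun i => ?_
    rw [← b.equivFun_apply, LinearEquiv.apply_symm_apply]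
  simp only [Measure.smul_apply, smul_eq_mul] at h
  rw [Measure.map_apply hmeas (ZSpan.fundamentalDomain_measurableSet b), hpre,
    volume_pi_pi] at h
  simp only [Real.volume_Ico, sub_zero, ENNReal.ofReal_one, Finset.prod_const_one] at h
  have h2 := congrArg ENNReal.toReal h
  rw [ENNReal.toReal_mul, ENNReal.toReal_ofReal hc] at h2
  simpa [Measure.real] using h2.symm

/-- As Λ has covolume 1, c is the absolute determinant of a lattice basis with respect to b. The
index is the absolute determinant of the inverse change of basis. -/
theorem mul_card_quotient (hν : ZLattice.covolume Λ ν = 1) (hbe : ∀ i, b i = e i) {c : ℝ}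
    (hc : 0 ≤ c) (hb : volume.map (comb b) = ENNReal.ofReal c • ν) :
    c * Nat.card (Λ ⧸ Submodule.span ℤ (Set.range e)) = 1 := by
  classical
  have := ZLattice.module_finite ℝ Λ
  have := ZLattice.module_free ℝ Λ
  have hcard : Fintype.card (Module.Free.ChooseBasisIndex ℤ Λ) = Fintype.card (Fin d) := by
    rw [← Module.finrank_eq_card_chooseBasisIndex, ZLattice.rank ℝ Λ,
      Module.finrank_eq_card_basis b]
  let L := (Module.Free.chooseBasis ℤ Λ).reindex (Fintype.equivOfCardEq hcard)
  let B := L.ofZLatticeBasis ℝ Λ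
  have h1 := ZLattice.covolume_eq_det_mul_measureReal Λ ν L b
  have h2 := mul_measureReal_fundamentalDomain hc hb
  have hB : ((↑) : Λ → V) ∘ L = B := funext fun i => (L.ofZLatticeBasis_apply ℝ Λ i).symm
  rw [hν, hB] at h1
  have hcdet : c = |b.det B| := by
    have hne : ν.real (ZSpan.fundamentalDomain b) ≠ 0 := by
      intro h0
      rw [h0, mul_zero] at h2
      exact zero_ne_one h2
    exact mul_right_cancel₀ hne (h2.trans h1)
  have hli : LinearIndependent ℤ e := by
    refine LinearIndependent.of_comp Λ.subtype ?_
    have h3 : LinearIndependent ℝ (Λ.subtype ∘ e) := by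
      have : Λ.subtype ∘ e = b := funext fun i => (hbe i).symm
      rw [this]
      exact b.linearIndependent
    exact h3.restrict_scalars' ℤ
  have h4 := Submodule.natAbs_det_basis_change L _ (Module.Basis.span hli)
  have h5 : (↑) ∘ (Module.Basis.span hli) = e := by
    funext i
    rw [Function.comp_apply, Module.Basis.span_apply hli i]
  rw [h5] at h4
  have h6 : ((L.det e : ℤ) : ℝ) = B.det b := by
    rw [Module.Basis.det_apply, Module.Basis.det_apply, Int.cast_det]
    congr 1
    ext i j
    rw [Matrix.map_apply, Module.Basis.toMatrix_apply, Module.Basis.toMatrix_apply, hbe]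
    exact (L.ofZLatticeBasis_repr_apply ℝ Λ (e j) i).symm
  rw [← h4, Nat.cast_natAbs, Int.cast_abs, h6, hcdet, ← abs_mul, Module.Basis.det_mul_det,
    Module.Basis.det_self, abs_one]

end Index

/-! ### Basis lists without repetition. -/

section Start

variable {V : Type*} [NormedAddCommGroup V] [NormedSpace ℝ V] [FiniteDimensional ℝ V]
  [MeasurableSpace V] [BorelSpace V] {Λ : Submodule ℤ V} [DiscreteTopology Λ] [IsZLattice ℝ Λ]
  {ν : Measure V} [ν.IsAddHaarMeasure] {d : ℕ} {e : Fin d → Λ} {b : Module.Basis (Fin d) ℝ V}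
  {x : V} {X : Multiset Λ}

theorem coord_apply_eq_ite [DecidableEq Λ] (hbe : ∀ i, b i = e i) (k : Fin d) {a : Λ}
    (ha : a ∈ Set.range e) : b.coord k a = if a = e k then 1 else 0 := by
  classical
  obtain ⟨j, rfl⟩ := ha
  rw [← hbe, Module.Basis.coord_apply, Module.Basis.repr_self, Finsupp.single_apply]
  refine if_congr ?_ rfl rfl
  constructor
  · rintro rfl
    rfl
  · intro h
    exact b.injective (by rw [hbe, hbe, h])

theorem mem_of_span_eq_top (hbe : ∀ i, b i = e i) {S : Set Λ} (hS : S ⊆ Set.range e)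
    (hspan : Submodule.span ℝ (((↑) : Λ → V) '' S) = ⊤) (i : Fin d) : e i ∈ S := by
  by_contra hi
  have h1 := b.linearIndependent.notMem_span_image (s := {j | j ≠ i}) (x := i) (by simp)
  apply h1
  have h2 : ((↑) : Λ → V) '' S ⊆ b '' {j | j ≠ i} := by
    rintro _ ⟨w, hw, rfl⟩
    obtain ⟨j, rfl⟩ := hS hw
    refine ⟨j, ?_, hbe j⟩
    rintro rfl
    exact hi hw
  exact Submodule.span_mono h2 (hspan ▸ Submodule.mem_top)

theorem IsGeneric.char_eq_one_of_charTerm_ne_zero (hx : IsGeneric Λ x) (ℓ : V →ₗ[ℝ] ℝ)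
    (hℓ : ∀ w ∈ X, 0 < ℓ w) (hbe : ∀ i, b i = e i) (hX : ∀ w ∈ X, w ∈ Set.range e) {v : Λ}
    {χ : AddChar Λ ℂ} (h : charTerm ν x X v χ ≠ 0) : ∀ a ∈ Set.range e, χ a = 1 := by
  rintro _ ⟨i, rfl⟩
  exact (mem_of_span_eq_top hbe (fun w hw => hX w hw.1) (hx.span_of_charTerm_ne_zero ℓ hℓ h) i).2

theorem germ_basis (hbe : ∀ i, b i = e i) (hpos : ∀ i, 0 < b.coord i x)
    {c : ℝ} (hc : 0 ≤ c) (hb : volume.map (comb b) = ENNReal.ofReal c • ν) :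
    germ ν x ((Finset.univ.val.map e).map (↑)) = algebraMap ℂ _ (c : ℂ) := by
  have h : (Finset.univ.val.map e).map ((↑) : Λ → V) = Finset.univ.val.map b := by
    rw [Multiset.map_map]
    exact Multiset.map_congr rfl fun i _ => (hbe i).symm
  refine IsGerm.germ_eq ⟨_, isOpen_basis_pos b, hpos, ?_⟩
  rw [h, msMeasure_map]
  exact hasPolyDensity_basis b hc hb

-- The germ is the constant c, which the operators of the contributing characters fix. The sum is
-- therefore c times a sum over all characters of a finite group: orthogonality yields c times the
-- index, which is 1, on the sublattice, and 0 off it.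
open Classical in
theorem IsGeneric.splineSum_basis (hν : ZLattice.covolume Λ ν = 1) (hx : IsGeneric Λ x)
    (ℓ : V →ₗ[ℝ] ℝ) (hℓ : ∀ i, 0 < ℓ (e i)) (hbe : ∀ i, b i = e i)
    (hpos : ∀ i, 0 < b.coord i x) (v : Λ) :
    splineSum ν x (Finset.univ.val.map e) v =
      if v ∈ Submodule.span ℤ (Set.range e) then 1 else 0 := by
  obtain ⟨c, hc, hb⟩ := exists_map_comb_basis (ν := ν) b
  have hspan : Submodule.span ℝ (((↑) : Λ → V) '' Set.range e) = ⊤ := by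
    rw [← Set.range_comp, ← b.span_eq]
    congr 2
    exact funext fun i => (hbe i).symm
  have := finite_quotient_span hspan
  have := Fintype.ofFinite (Λ ⧸ Submodule.span ℤ (Set.range e))
  have hX : ∀ w ∈ Finset.univ.val.map e, w ∈ Set.range e := by
    intro w hw
    obtain ⟨i, -, rfl⟩ := Multiset.mem_map.1 hw
    exact ⟨i, rfl⟩
  have hℓ' : ∀ w ∈ Finset.univ.val.map e, 0 < ℓ w := by
    intro w hw
    obtain ⟨i, rfl⟩ := hX w hw
    exact hℓ i
  have hterm : ∀ χ : AddChar Λ ℂ, charTerm ν x (Finset.univ.val.map e) v χ =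
      ∑ᶠ _ : χ ∈ {χ : AddChar Λ ℂ | ∀ a ∈ Set.range e, χ a = 1}, χ v * c := by
    intro χ
    by_cases hχ : ∀ a ∈ Set.range e, χ a = 1
    · have hχ' : ∀ a ∈ Finset.univ.val.map e, χ a = 1 := fun a ha => hχ a (hX a ha)
      rw [finsum_eq_if, if_pos (show χ ∈ {χ : AddChar Λ ℂ | ∀ a ∈ Set.range e, χ a = 1} from hχ),
        charTerm, charGerm_eq_germ hχ', germ_basis hbe hpos hc hb, charOp_algebraMap hχ']
      rfl
    · rw [finsum_eq_if, if_neg (show χ ∉ {χ : AddChar Λ ℂ | ∀ a ∈ Set.range e, χ a = 1} from hχ)]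
      by_contra h0
      exact hχ (hx.char_eq_one_of_charTerm_ne_zero ℓ hℓ' hbe hX h0)
  rw [splineSum, finsum_congr hterm, setOf_char_eq_range,
    finsum_mem_range (AddChar.compAddMonoidHom_injective_left _ (Submodule.mkQ_surjective _)),
    finsum_eq_sum_of_fintype]
  simp only [AddChar.compAddMonoidHom_apply]
  rw [← Finset.sum_mul, AddChar.sum_apply_eq_ite]
  have hz : (Submodule.span ℤ (Set.range e)).mkQ.toAddMonoidHom v = 0 ↔
      v ∈ Submodule.span ℤ (Set.range e) := Submodule.Quotient.mk_eq_zero _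
  have hcc := mul_card_quotient hν hbe hc hb
  rw [Nat.card_eq_fintype_card] at hcc
  by_cases hv : v ∈ Submodule.span ℤ (Set.range e)
  · rw [if_pos (hz.2 hv), if_pos hv, mul_comm]
    exact_mod_cast hcc
  · rw [if_neg (mt hz.1 hv), if_neg hv, zero_mul]

-- Integral coordinates greater than -1 are non-negative, so a sublattice point in this range has
-- exactly one partition. The zonotope condition gives the bound -1, not 0.
open Classical in
theorem msPartition_basis (hbe : ∀ i, b i = e i) {v : Λ} (hv : ∀ i, -1 < b.coord i v) :
    msPartition (Finset.univ.val.map e) v =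
      if v ∈ Submodule.span ℤ (Set.range e) then 1 else 0 := by
  rw [msPartition_map, partitionFunction]
  have hcoe : ∀ (n : Fin d → ℕ), ((∑ i, n i • e i : Λ) : V) = ∑ i, (n i : ℝ) • b i := by
    intro n
    simp [hbe, Nat.cast_smul_eq_nsmul]
  split_ifs with h
  · obtain ⟨m, hm⟩ := (Submodule.mem_span_range_iff_exists_fun ℤ).1 h
    have hmv : ∀ i, b.coord i v = m i := by
      intro i
      have : (v : V) = ∑ j, (m j : ℝ) • b j := by
        rw [← hm]
        simp [hbe, Int.cast_smul_eq_zsmul]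
      rw [this, Module.Basis.coord_apply, Module.Basis.repr_sum_self]
    have hm0 : ∀ i, 0 ≤ m i := by
      intro i
      have := hv i
      rw [hmv] at this
      have h2 : (-1 : ℤ) < m i := by exact_mod_cast this
      omega
    rw [Set.ncard_eq_one]
    refine ⟨fun i => (m i).toNat, Set.eq_singleton_iff_unique_mem.2 ⟨?_, fun n hn => ?_⟩⟩
    · rw [Set.mem_ofPred_eq, ← hm]
      refine Finset.sum_congr rfl fun i _ => ?_
      rw [← natCast_zsmul, Int.toNat_of_nonneg (hm0 i)]
    · funext i
      have h3 : b.coord i v = n i := by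
        have : (v : V) = ∑ j, (n j : ℝ) • b j := by
          rw [← hcoe, Set.mem_ofPred_eq.mp hn]
        rw [this, Module.Basis.coord_apply, Module.Basis.repr_sum_self]
      rw [hmv] at h3
      have h4 : m i = n i := by exact_mod_cast h3
      rw [h4, Int.toNat_natCast]
  · have hempty : {n : Fin d → ℕ | ∑ i, n i • e i = v} = ∅ := by
      refine Set.eq_empty_iff_forall_notMem.2 fun n hn => h ?_
      rw [← Set.mem_ofPred_eq.mp hn]
      exact Submodule.sum_mem _ fun i _ =>
        Submodule.smul_of_tower_mem _ (n i) (Submodule.subset_span ⟨i, rfl⟩)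
    rw [hempty, Set.ncard_empty]

end Start

/-! ### Vanishing of the defect, first for independent support and then in general. -/

section Independent

variable {V : Type*} [NormedAddCommGroup V] [NormedSpace ℝ V] [FiniteDimensional ℝ V]
  [MeasurableSpace V] [BorelSpace V] {Λ : Submodule ℤ V} [DiscreteTopology Λ] [IsZLattice ℝ Λ]
  {ν : Measure V} [ν.IsAddHaarMeasure] {d : ℕ} {e : Fin d → Λ} {b : Module.Basis (Fin d) ℝ V}
  {x : V} {X : Multiset Λ}

/-- Induction on the extra copies Y. Adding a copy of `e k` relates the value at v to the value of
the shorter list at v + e k by the same factor on both sides, and the lower bound on the coordinate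
k moves down by one accordingly. -/
theorem IsGeneric.msPartition_eq_splineSum_of_basis [DecidableEq Λ]
    (hν : ZLattice.covolume Λ ν = 1) (hx : IsGeneric Λ x)
    (ℓ : V →ₗ[ℝ] ℝ) (hℓ : ∀ i, 0 < ℓ (e i)) (hbe : ∀ i, b i = e i)
    (hpos : ∀ i, 0 < b.coord i x) (Y : Multiset Λ) (hY : ∀ w ∈ Y, w ∈ Set.range e) {v : Λ}
    (hv : ∀ i, -((Y + Finset.univ.val.map e).count (e i) : ℝ) < b.coord i v) :
    (msPartition (Y + Finset.univ.val.map e) v : ℂ) =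
      splineSum ν x (Y + Finset.univ.val.map e) v := by
  induction Y using Multiset.induction_on generalizing v with
  | empty =>
    have he : Function.Injective e := fun i j h => b.injective (by rw [hbe, hbe, h])
    rw [zero_add] at hv ⊢
    rw [hx.splineSum_basis hν ℓ hℓ hbe hpos v, msPartition_basis hbe]
    · split_ifs <;> simp
    · intro i
      have h := hv i
      rwa [Multiset.count_map_eq_count' e _ he, Multiset.count_eq_one_of_mem
        Finset.univ.nodup (Finset.mem_univ_val i), Nat.cast_one] at h
  | cons a Y ih =>
    have hY' : ∀ w ∈ Y, w ∈ Set.range e := fun w hw => hY w (Multiset.mem_cons_of_mem hw)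
    rw [Multiset.cons_add] at hv ⊢
    set X := Y + Finset.univ.val.map e with hXdef
    have hX : ∀ w ∈ X, w ∈ Set.range e := by
      intro w hw
      rcases Multiset.mem_add.1 hw with hw | hw
      · exact hY' w hw
      · obtain ⟨i, -, rfl⟩ := Multiset.mem_map.1 hw
        exact ⟨i, rfl⟩
    have hℓX : ∀ w ∈ X, 0 < ℓ w := by
      intro w hw
      obtain ⟨i, rfl⟩ := hX w hw
      exact hℓ i
    have hmem : ∀ i, e i ∈ X := fun i =>
      Multiset.mem_add.2 (Or.inr (Multiset.mem_map_of_mem e (Finset.mem_univ_val i)))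
    obtain ⟨k, rfl⟩ := hY a (Multiset.mem_cons_self a Y)
    have haX : ∀ w ∈ e k ::ₘ X, w ∈ Set.range e := by
      intro w hw
      rcases Multiset.mem_cons.1 hw with rfl | hw
      exacts [⟨k, rfl⟩, hX w hw]
    have hℓaX : ∀ w ∈ e k ::ₘ X, 0 < ℓ w := by
      intro w hw
      obtain ⟨i, rfl⟩ := haX w hw
      exact hℓ i
    have hu : ∀ w ∈ X, b.coord k w = if w = e k then 1 else 0 := fun w hw =>
      coord_apply_eq_ite hbe k (hX w hw)
    have h1 := count_mul_msPartition_cons ℓ hℓX hu (v + e k)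
    have h2 : (X.count (e k) : ℂ) * splineSum ν x (e k ::ₘ X) (v + e k - e k) =
        b.coord k (v + e k : Λ) * splineSum ν x X (v + e k) := by
      unfold splineSum
      rw [mul_finsum, mul_finsum]
      refine finsum_congr fun χ => ?_
      by_cases hχ : ∀ a ∈ Set.range e, χ a = 1
      · exact hx.count_mul_charTerm_cons ℓ hℓX (hmem k) hu (fun a ha => hχ a (hX a ha)) _
      · have h3 : charTerm ν x (e k ::ₘ X) (v + e k - e k) χ = 0 := by
          by_contra h0
          exact hχ (hx.char_eq_one_of_charTerm_ne_zero ℓ hℓaX hbe haX h0)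
        have h4 : charTerm ν x X (v + e k) χ = 0 := by
          by_contra h0
          exact hχ (hx.char_eq_one_of_charTerm_ne_zero ℓ hℓX hbe hX h0)
        rw [h3, h4, mul_zero, mul_zero]
    have h5 : (msPartition X (v + e k) : ℂ) = splineSum ν x X (v + e k) := by
      refine ih hY' fun i => ?_
      have h := hv i
      rw [Submodule.coe_add, map_add, coord_apply_eq_ite hbe i ⟨k, rfl⟩]
      rw [Multiset.count_cons] at h
      split_ifs with h6
      · rw [if_pos h6.symm] at h
        push_cast at h
        linarith
      · rw [if_neg (Ne.symm h6), add_zero] at h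
        linarith
    have hcount : (X.count (e k) : ℂ) ≠ 0 :=
      Nat.cast_ne_zero.2 (Multiset.count_pos.2 (hmem k)).ne'
    rw [add_sub_cancel_right] at h1 h2
    refine mul_left_cancel₀ hcount ?_
    rw [h2, ← h5]
    exact_mod_cast congrArg (fun r : ℝ => (r : ℂ)) h1

theorem le_count_of_mem_zonotope [DecidableEq Λ] {u : V →ₗ[ℝ] ℝ} {a : Λ}
    (hu : ∀ w ∈ X, u w = if w = a then 1 else 0) {y : V} (hy : y ∈ zonotope X) :
    u y ≤ X.count a := by
  induction X using Multiset.induction_on generalizing y with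
  | empty =>
    have : y = 0 := hy
    simp [this]
  | cons w X ih =>
    obtain ⟨s, h0, h1, h⟩ := mem_zonotope_cons.1 hy
    have h2 := ih (fun w hw => hu w (Multiset.mem_cons_of_mem hw)) h
    rw [map_sub, map_smul, hu w (Multiset.mem_cons_self w X)] at h2
    rw [Multiset.count_cons]
    by_cases h3 : w = a
    · rw [if_pos h3] at h2
      rw [if_pos h3.symm]
      push_cast
      rw [smul_eq_mul] at h2
      linarith
    · rw [if_neg h3, smul_zero, sub_zero] at h2
      rw [if_neg (Ne.symm h3), add_zero]
      exact h2

theorem zonotope_subset_span {y : V} (hy : y ∈ zonotope X) :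
    y ∈ Submodule.span ℝ≥0 {v | v ∈ X.map ((↑) : Λ → V)} := by
  induction X using Multiset.induction_on generalizing y with
  | empty =>
    have : y = 0 := hy
    rw [this]
    exact Submodule.zero_mem _
  | cons w X ih =>
    obtain ⟨s, h0, h1, h⟩ := mem_zonotope_cons.1 hy
    have h2 : {v | v ∈ X.map ((↑) : Λ → V)} ⊆ {v | v ∈ (w ::ₘ X).map ((↑) : Λ → V)} := by
      intro v hv
      rw [Set.mem_ofPred_eq, Multiset.map_cons]
      exact Multiset.mem_cons_of_mem hv
    have h3 : (⟨s, h0⟩ : ℝ≥0) • (w : V) ∈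
        Submodule.span ℝ≥0 {v | v ∈ (w ::ₘ X).map ((↑) : Λ → V)} := by
      refine Submodule.smul_mem _ _ (Submodule.subset_span ?_)
      exact Multiset.mem_map_of_mem _ (Multiset.mem_cons_self w X)
    have h4 := Submodule.add_mem _ (Submodule.span_mono h2 (ih h)) h3
    have h5 : y - s • (w : V) + (⟨s, h0⟩ : ℝ≥0) • (w : V) = y := sub_add_cancel _ _
    rwa [h5] at h4

/-- The difference between the partition function and the spline formula with germs at `x`. -/
def defect (ν : Measure V) (x : V) (X : Multiset Λ) (v : Λ) : ℂ :=
  msPartition X v - splineSum ν x X v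

theorem IsGeneric.defect_cons (hx : IsGeneric Λ x) (ℓ : V →ₗ[ℝ] ℝ) {a : Λ}
    (hℓ : ∀ w ∈ a ::ₘ X, 0 < ℓ w) (v : Λ) :
    defect ν x (a ::ₘ X) v = defect ν x X v + defect ν x (a ::ₘ X) (v - a) := by
  unfold defect
  rw [msPartition_cons ℓ hℓ v, hx.splineSum_cons ℓ hℓ v]
  push_cast
  ring

/-- If x is outside the cone of X, both terms vanish: a partition of v would put x = (x - v) + v in
the cone. Otherwise genericity makes X contain the whole basis and the coordinates of x positive.
Coordinates of zonotope points are at most the multiplicities, so those of v exceed minus the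
multiplicities. -/
theorem IsGeneric.vanishesOver_defect_of_linearIndependent (hν : ZLattice.covolume Λ ν = 1)
    (hx : IsGeneric Λ x) (ℓ : V →ₗ[ℝ] ℝ) (hℓ : ∀ i, 0 < ℓ (e i))
    (hli : LinearIndependent ℝ fun i => ((e i : Λ) : V)) :
    VanishesOver (defect ν x) x (Set.range e) := by
  classical
  intro X hX v hv
  have hℓX : ∀ w ∈ X, 0 < ℓ w := by
    intro w hw
    obtain ⟨i, rfl⟩ := hX w hw
    exact hℓ i
  by_cases hxX : x ∈ Submodule.span ℝ≥0 {v | v ∈ X.map ((↑) : Λ → V)}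
  swap
  · rw [defect, splineSum_eq_zero ℓ hℓX v hxX, sub_zero, Nat.cast_eq_zero]
    by_contra h
    apply hxX
    have := Submodule.add_mem _ (zonotope_subset_span hv) (mem_span_of_msPartition_ne_zero h)
    rwa [sub_add_cancel] at this
  have hspanX := hx.span_eq_top hxX
  have hspan : ⊤ ≤ Submodule.span ℝ (Set.range fun i => ((e i : Λ) : V)) := by
    rw [← hspanX]
    refine Submodule.span_mono ?_
    rintro _ ⟨w, hw, rfl⟩
    obtain ⟨i, rfl⟩ := hX w hw
    exact ⟨i, rfl⟩
  let b := Module.Basis.mk hli hspan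
  have hbe : ∀ i, b i = e i := fun i => Module.Basis.mk_apply hli hspan i
  have hmem : ∀ i, e i ∈ X := mem_of_span_eq_top hbe (S := {a | a ∈ X}) hX hspanX
  have he : Function.Injective e := fun i j h => b.injective (by rw [hbe, hbe, h])
  obtain ⟨Y, hY⟩ : ∃ Y, X = Y + Finset.univ.val.map e := by
    have hle : Finset.univ.val.map e ≤ X := by
      rw [Multiset.le_iff_subset (Finset.univ.nodup.map he)]
      intro w hw
      obtain ⟨i, -, rfl⟩ := Multiset.mem_map.1 hw
      exact hmem i
    obtain ⟨Y, hY⟩ := Multiset.le_iff_exists_add.1 hle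
    exact ⟨Y, by rw [hY, add_comm]⟩
  have hpos : ∀ i, 0 < b.coord i x := by
    intro i
    have hnn : 0 ≤ b.coord i x := by
      refine Submodule.span_induction (p := fun y _ => 0 ≤ b.coord i y) ?_ ?_ ?_ ?_ hxX
      · intro y hy
        obtain ⟨w, hw, rfl⟩ := Multiset.mem_map.1 hy
        rw [coord_apply_eq_ite hbe i (hX w hw)]
        split_ifs <;> simp
      · simp
      · intro y z _ _ hy hz
        rw [map_add]
        exact add_nonneg hy hz
      · intro r y _ hy
        have : b.coord i (r • y) = (r : ℝ) * b.coord i y := map_smul (b.coord i) (r : ℝ) y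
        rw [this]
        exact mul_nonneg r.2 hy
    refine lt_of_le_of_ne hnn fun h0 => ?_
    refine hx (b '' {j | j ≠ i}) ?_ ?_ ?_
    · rintro _ ⟨j, -, rfl⟩
      rw [hbe]
      exact (e j).2
    · intro htop
      have := b.linearIndependent.notMem_span_image (s := {j | j ≠ i}) (x := i) (by simp)
      exact this (htop ▸ Submodule.mem_top)
    · rw [← b.sum_repr x]
      refine Submodule.sum_mem _ fun j _ => ?_
      by_cases hj : j = i
      · subst hj
        rw [← Module.Basis.coord_apply, ← h0, zero_smul]
        exact Submodule.zero_mem _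
      · exact Submodule.smul_mem _ _ (Submodule.subset_span ⟨j, hj, rfl⟩)
  have hYr : ∀ w ∈ Y, w ∈ Set.range e := fun w hw =>
    hX w (by rw [hY]; exact Multiset.mem_add.2 (Or.inl hw))
  have hv' : ∀ i, -((Y + Finset.univ.val.map e).count (e i) : ℝ) < b.coord i v := by
    intro i
    rw [← hY]
    have h1 := le_count_of_mem_zonotope (u := b.coord i) (a := e i)
      (fun w hw => coord_apply_eq_ite hbe i (hX w hw)) hv
    rw [map_sub] at h1
    linarith [hpos i]
  rw [defect, sub_eq_zero, hY]
  exact hx.msPartition_eq_splineSum_of_basis hν ℓ hℓ hbe hpos Y hYr hv'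

theorem IsGeneric.vanishesNear_defect (hν : ZLattice.covolume Λ ν = 1) (hx : IsGeneric Λ x)
    (ℓ : V →ₗ[ℝ] ℝ) (hℓ : ∀ w ∈ X, 0 < ℓ w) : VanishesNear (defect ν x) x X := by
  refine vanishesOver_of_independent (ℓ := ℓ) (fun a X h v => hx.defect_cons ℓ h v)
    (fun d a ha hli => hx.vanishesOver_defect_of_linearIndependent hν ℓ ha hli)
    (a := fam X) (fun i => hℓ _ (fam_mem X i)) X fun w hw => ?_
  rw [range_fam]
  exact hw

end Independent

/-! ### From a generic point to a regular lattice point. -/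

section Main

variable {V : Type*} [NormedAddCommGroup V] [NormedSpace ℝ V] [FiniteDimensional ℝ V]

theorem exists_pos_of_notMem_convexHull {κ : Type*} [Finite κ] {a : κ → V}
    (h : (0 : V) ∉ convexHull ℝ (Set.range a)) : ∃ ℓ : V →ₗ[ℝ] ℝ, ∀ i, 0 < ℓ (a i) := by
  obtain ⟨f, u, h0, hu⟩ := geometric_hahn_banach_point_closed (convex_convexHull ℝ (Set.range a))
    ((Set.finite_range a).isClosed_convexHull ℝ) h
  rw [map_zero] at h0
  exact ⟨f.toLinearMap, fun i => h0.trans (hu _ (subset_convexHull ℝ _ ⟨i, rfl⟩))⟩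

variable {Λ : Submodule ℤ V} {N : ℕ} {X : Fin N → Λ}

theorem sum_smul_mem_zonotope {κ : Type*} [DecidableEq κ] (X : κ → Λ) (s : Finset κ) {t : κ → ℝ}
    (ht : ∀ i, t i ∈ Set.Icc 0 1) : ∑ i ∈ s, t i • (X i : V) ∈ zonotope (s.val.map X) := by
  induction s using Finset.induction_on with
  | empty => exact Set.mem_singleton _
  | insert i s hi ih =>
    rw [Finset.sum_insert hi, Finset.insert_val_of_notMem hi, Multiset.map_cons]
    refine mem_zonotope_cons_of_sub (ht i).1 (ht i).2 ?_
    rwa [add_sub_cancel_left]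

open Classical in
theorem filter_map_eq_localList (χ : AddChar Λ ℂ) :
    ((Finset.univ.val.map X).filter fun a => χ a = 1).map ((↑) : Λ → V) =
      Finset.univ.val.map (localList X χ) := by
  have h : Finset.univ.val.map (Subtype.val : LocalIndex X χ → Fin N) =
      Finset.univ.val.filter fun i => χ (X i) = 1 := by
    refine (Multiset.Nodup.ext (Finset.univ.nodup.map Subtype.val_injective)
      (Finset.univ.nodup.filter _)).2 fun i => ?_
    simp
  rw [Multiset.filter_map, Multiset.map_map]
  have h2 : Finset.univ.val.map (localList X χ) =
      (Finset.univ.val.map (Subtype.val : LocalIndex X χ → Fin N)).map fun i => (X i : V) := by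
    rw [Multiset.map_map]
    rfl
  rw [h2, h]
  rfl

variable [MeasurableSpace V] [BorelSpace V]

theorem regularPoints_subset_localList (χ : AddChar Λ ℂ) :
    regularPoints (fun i => (X i : V)) ⊆ (singularPoints (localList X χ))ᶜ := fun _ hx h =>
  hx.2 (singularPoints_comp_subset (fun i => (X i : V))
    (Subtype.val_injective (p := fun i => χ (X i) = 1)) h)

variable [DiscreteTopology Λ] [IsZLattice ℝ Λ]

/-- As X spans, t ↦ ∑ t i X i is an open map. Small points of the open unit cube thus give a
nonempty open set of admissible x, which contains a generic point. -/
theorem exists_isGeneric_sub_mem_zonotope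
    (hspan : Submodule.span ℝ (Set.range fun i => (X i : V)) = ⊤) {U : Set V} (hU : IsOpen U)
    {v : V} (hv : v ∈ U) :
    ∃ x ∈ U, IsGeneric Λ x ∧ x - v ∈ zonotope (Finset.univ.val.map X) := by
  let m : (Fin N → ℝ) →ₗ[ℝ] V := Fintype.linearCombination ℝ fun i => (X i : V)
  have hm : ∀ t, m t = ∑ i, t i • (X i : V) := fun t => Fintype.linearCombination_apply ..
  have hsurj : Function.Surjective m := by
    rw [← LinearMap.range_eq_top, ← hspan]
    exact Fintype.range_linearCombination ℝ _
  have hopen : IsOpenMap m := m.isOpenMap_of_finiteDimensional hsurj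
  have hcont : Continuous fun t => v + m t :=
    continuous_const.add m.continuous_of_finiteDimensional
  let O : Set (Fin N → ℝ) := Set.univ.pi (fun _ => Set.Ioo 0 1) ∩ (fun t => v + m t) ⁻¹' U
  have hO : IsOpen O :=
    (isOpen_set_pi Set.finite_univ fun _ _ => isOpen_Ioo).inter (hU.preimage hcont)
  have hne : O.Nonempty := by
    have h1 : ∀ᶠ r : ℝ in 𝓝 0, (fun _ => r : Fin N → ℝ) ∈ (fun t => v + m t) ⁻¹' U := by
      have hc : Continuous fun r : ℝ => (fun _ => r : Fin N → ℝ) :=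
        continuous_pi fun _ => continuous_id
      refine (hU.preimage (hcont.comp hc)).mem_nhds ?_
      have h0 : m (fun _ => (0 : ℝ)) = 0 := m.map_zero
      simpa [h0] using hv
    have h2 : ∀ᶠ r : ℝ in 𝓝[>] 0, r ∈ Set.Ioo (0 : ℝ) 1 := Ioo_mem_nhdsGT one_pos
    obtain ⟨r, hr, hr'⟩ := ((h1.filter_mono nhdsWithin_le_nhds).and h2).exists
    exact ⟨fun _ => r, fun _ _ => hr', hr⟩
  obtain ⟨x, ⟨y, ⟨t, ht, rfl⟩, rfl⟩, hx⟩ := exists_isGeneric Λ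
    (U := (fun y => v + y) '' (m '' O)) ((isOpenMap_add_left v) _ (hopen _ hO))
    ((hne.image _).image _)
  refine ⟨_, ht.2, hx, ?_⟩
  rw [add_sub_cancel_left, hm]
  exact sum_smul_mem_zonotope X Finset.univ fun i =>
    ⟨(ht.1 i (Set.mem_univ i)).1.le, (ht.1 i (Set.mem_univ i)).2.le⟩

theorem span_range_localList (χ : AddChar Λ ℂ) :
    Submodule.span ℝ (((↑) : Λ → V) '' {a | a ∈ Finset.univ.val.map X ∧ χ a = 1}) =
      Submodule.span ℝ (Set.range (localList X χ)) := by
  congr 1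
  ext w
  constructor
  · rintro ⟨_, ⟨ha, hi⟩, rfl⟩
    obtain ⟨i, -, rfl⟩ := Multiset.mem_map.1 ha
    exact ⟨⟨i, hi⟩, rfl⟩
  · rintro ⟨i, rfl⟩
    exact ⟨X i.1, ⟨Multiset.mem_map_of_mem X (Finset.mem_univ_val _), i.2⟩, rfl⟩

variable {ν : Measure V} [ν.IsAddHaarMeasure]

theorem partitionFunction_eq_finsum (hν : ZLattice.covolume Λ ν = 1)
    (hspan : Submodule.span ℝ (Set.range fun i => (X i : V)) = ⊤) (ℓ : V →ₗ[ℝ] ℝ)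
    (hℓ : ∀ i, 0 < ℓ (X i)) (φ : AddChar Λ ℂ → (V →ₗ[ℝ] ℂ))
    (hφ : ∀ χ ∈ arrangementPoints X, Represents (φ χ) χ) (v : Λ)
    (hv : (v : V) ∈ regularPoints fun i => (X i : V)) :
    (partitionFunction X v : ℂ) = ∑ᶠ χ ∈ arrangementPoints X,
      seriesOp (φ χ) (fun i => (X i : V)) (localSeries X χ) (localSpline ν X χ (φ χ)) (v : V) := by
  classical
  have hℓχ : ∀ (χ : AddChar Λ ℂ) i, 0 < ℓ (localList X χ i) := fun χ i => hℓ i.1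
  have hex : ∀ χ : AddChar Λ ℂ, ∃ p U, IsOpen U ∧ (v : V) ∈ U ∧
      HasPolyDensity ν (coneMeasure (localList X χ)) U p := fun χ =>
    exists_hasPolyDensity_family ℓ (hℓχ χ) (regularPoints_subset_localList χ hv)
  choose p U hU hvU hp using hex
  have hO : IsOpen (⋂ χ ∈ arrangementPoints X, U χ) :=
    (finite_arrangementPoints X).isOpen_biInter fun χ _ => hU χ
  -- The point x lies in every U χ with χ in the finite arrangement, so each germ at x is the
  -- polynomial density valid around v. The other characters have germ zero at x.
  obtain ⟨x, hxU, hx, hxz⟩ := exists_isGeneric_sub_mem_zonotope hspan hO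
    (Set.mem_iInter₂.2 fun χ _ => hvU χ)
  have hℓ' : ∀ w ∈ Finset.univ.val.map X, 0 < ℓ w := by
    intro w hw
    obtain ⟨i, -, rfl⟩ := Multiset.mem_map.1 hw
    exact hℓ i
  have h0 := hx.vanishesNear_defect hν ℓ hℓ' v hxz
  rw [defect, sub_eq_zero, msPartition_map] at h0
  rw [h0, splineSum]
  refine finsum_congr fun χ => ?_
  rw [finsum_eq_if]
  split_ifs with hχ
  · have hgerm : charGerm ν x χ (Finset.univ.val.map X) = p χ := by
      rw [charGerm, filter_map_eq_localList]
      refine IsGerm.germ_eq ⟨U χ, hU χ, Set.mem_iInter₂.1 hxU χ hχ, ?_⟩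
      rw [msMeasure_map]
      exact hp χ
    rw [charTerm, hgerm, ← mvOp_localSeries, hφ χ hχ v]
    refine (seriesOp_expPoly (φ χ) _ _ (hU χ) (fun y hy => ?_) _ (hvU χ)).symm
    exact eSpline_eq_of_hasPolyDensity ℓ (hℓχ χ)
      ((mem_arrangementPoints_iff X χ).1 hχ) (φ χ) (fun i => rfl) (hU χ) (hp χ) hy
  · by_contra hne
    apply hχ
    rw [mem_arrangementPoints_iff, ← span_range_localList]
    exact hx.span_of_charTerm_ne_zero ℓ hℓ' hne

end Main

end PartitionSpline

end

open PartitionSpline in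
theorem mainTheorem8
    {V : Type*} [NormedAddCommGroup V] [NormedSpace ℝ V] [FiniteDimensional ℝ V]
    [MeasurableSpace V] [BorelSpace V]
    (Λ : Submodule ℤ V) [DiscreteTopology Λ] [IsZLattice ℝ Λ]
    (ν : MeasureTheory.Measure V) [ν.IsAddHaarMeasure] (hν : ZLattice.covolume Λ ν = 1)
    {N : ℕ} (X : Fin N → Λ)
    (hspan : Submodule.span ℝ (Set.range fun i => (X i : V)) = ⊤)
    (hconv : (0 : V) ∉ convexHull ℝ (Set.range fun i => (X i : V))) :
    -- the points of the arrangement are finitely many and have representatives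
    (arrangementPoints X).Finite ∧
    (∀ χ ∈ arrangementPoints X, ∃ φ : V →ₗ[ℝ] ℂ, Represents φ χ) ∧
    -- for every choice of representatives
    ∀ φ : AddChar Λ ℂ → (V →ₗ[ℝ] ℂ), (∀ χ ∈ arrangementPoints X, Represents (φ χ) χ) →
      (∀ χ ∈ arrangementPoints X,
        -- the local E-spline
        IsESpline ν (localList X χ) (localParam X χ (φ χ)) (localSpline ν X χ (φ χ)) ∧
        IsLocallyExpPoly (φ χ) (regularPoints fun i => (X i : V)) (localSpline ν X χ (φ χ)) ∧
        -- the operator is locally a polynomial in derivatives, and is invertible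
        (∀ f : V → ℂ, IsLocallyExpPoly (φ χ) (regularPoints fun i => (X i : V)) f →
          (∀ x ∈ regularPoints fun i => (X i : V), ∀ᶠ n in Filter.cofinite,
            ∀ᶠ y in nhds x, monomialOp (φ χ) (fun i => (X i : V)) n f y = 0) ∧
          IsLocallyExpPoly (φ χ) (regularPoints fun i => (X i : V))
            (seriesOp (φ χ) (fun i => (X i : V)) (localSeries X χ) f) ∧
          IsLocallyExpPoly (φ χ) (regularPoints fun i => (X i : V))
            (seriesOp (φ χ) (fun i => (X i : V)) (localSeries X χ)⁻¹ f) ∧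
          ∀ x ∈ regularPoints fun i => (X i : V),
            seriesOp (φ χ) (fun i => (X i : V)) (localSeries X χ)⁻¹
              (seriesOp (φ χ) (fun i => (X i : V)) (localSeries X χ) f) x = f x ∧
            seriesOp (φ χ) (fun i => (X i : V)) (localSeries X χ)
              (seriesOp (φ χ) (fun i => (X i : V)) (localSeries X χ)⁻¹ f) x = f x)) ∧
      -- the formula
      ∀ v : Λ, (v : V) ∈ regularPoints (fun i => (X i : V)) →
        (partitionFunction X v : ℂ) =
          ∑ᶠ χ ∈ arrangementPoints X,
            seriesOp (φ χ) (fun i => (X i : V)) (localSeries X χ)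
              (localSpline ν X χ (φ χ)) (v : V) := by
  obtain ⟨ℓ, hℓ⟩ := exists_pos_of_notMem_convexHull hconv
  refine ⟨finite_arrangementPoints X, fun χ _ => exists_represents χ, fun φ hφ =>
    ⟨fun χ hχ => ?_, fun v hv => partitionFunction_eq_finsum hν hspan ℓ hℓ φ hφ v hv⟩⟩
  have hspanχ := (mem_arrangementPoints_iff X χ).1 hχ
  have hℓχ : ∀ i, 0 < ℓ (localList X χ i) := fun i => hℓ i.1
  refine ⟨isESpline_eSpline ℓ hℓχ hspanχ (φ χ) fun i => rfl, fun x hx =>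
    isLocallyExpPoly_eSpline ℓ hℓχ hspanχ (φ χ) (fun i => rfl) x
      (regularPoints_subset_localList χ hx), fun f hf => ⟨fun x hx =>
    hf.eventually_monomialOp _ hx, hf.seriesOp _ _, hf.seriesOp _ _, fun x hx => ⟨?_, ?_⟩⟩⟩
  · exact hf.seriesOp_seriesOp _ (by rw [mul_comm]; exact toddSeries_mul_inv _) hx
  · exact hf.seriesOp_seriesOp _ (toddSeries_mul_inv _) hx
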